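/- Let $\Omega=\mathbb{R}$, or let $\Omega=(a,b)$ be a bounded interval with homogeneous Dirichlet or periodic boundary conditions. For an integer $n\ge 2$ and $\varepsilon>0$ let \[ f_n^\varepsilon(\rho)=\ln\rho\quad(\rho\ge\varepsilon^2),\qquad f_n^\varepsilon(\rho)=\ln(\varepsilon^2)-\frac{n+1}{n}\Big(1-\frac{\rho}{\varepsilon^2}\Big)^n-\sum_{k=1}^{n-1}\frac1k\Big(1-\frac{\rho}{\varepsilon^2}\Big)^k\quad(0\le\rho<\varepsilon^2), \] and consider the energy regularized logarithmic Schrödinger equation (ERLogSE) \[ i\partial_t u^\varepsilon=-\partial_{xx}u^\varepsilon+u^\varepsilon f_n^\varepsilon(|u^\varepsilon|^2)\ \text{ in }\Omega,\qquad u^\varepsilon(\cdot,0)=u_0 . \] Its solutions on $[0,T]$ are understood as weak solutions $u^\varepsilon\in C([0,T];L^2)\cap L^\infty([0,T];H^1)$ satisfying the boundary condition, i.e. with $u^\varepsilon(t)\in H^1_0(\Omega)$ in the Dirichlet case, and with $H^m$ ($m=1,2$) denoting the periodic Sobolev space in the periodic case. Let $\Phi_A^t=e^{it\partial_{xx}}$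 be the free Schrödinger group on $L^2(\Omega)$ with the given boundary condition, let $\Phi_B^t(w)=w\,e^{-itf_n^\varepsilon(|w|^2)}$, and for a time step $\tau\in(0,\tau_0]$ define the Lie–Trotter splitting \[ u^{\varepsilon,k+1}=\Phi_B^\tau\big(\Phi_A^\tau(u^{\varepsilon,k})\big),\quad k\ge0,\qquad u^{\varepsilon,0}=u_0 . \] \textbf{Theorem.} Let $\Omega$ (with its boundary condition), $n\ge2$, $\tau_0>0$ and $T>0$ be given, and assume that the solution of the ERLogSE satisfies $u^\varepsilon\in L^\infty([0,T];H^2(\Omega))$. Then there exists $\varepsilon_0>0$, depending (besides $\Omega$) only on $n$, $\tau_0$ and $M=\|u^\varepsilon\|_{L^\infty([0,T];H^1(\Omega))}$, such that whenever $0<\varepsilon\le\varepsilon_0$, $0<\tau\le\tau_0$ and $t_k:=k\tau\le T$, \[ \|u^{\varepsilon,k}-u^\varepsilon(t_k)\|_{L^2(\Omega)}\le C\big(n,\tau_0,T,\|u^\varepsilon\|_{L^\infty([0,T];H^2(\Omega))}\big)\,\frac{\tau}{\varepsilon}, \] where $C$ depends (besides $\Omega$) only on the quantities displayed and not on $\varepsilon$,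 $\tau$, $k$ or $u^\varepsilon$ otherwise. Both $\varepsilon_0$ and $C$ may be evaluated at any upper bounds of the two norms instead of the norms themselves. -/

import Mathlib

open MeasureTheory Filter Topology Set
open scoped ENNReal NNReal ContDiff

noncomputable section

namespace ERLog

/-- The spatial domains in dimension one, with their boundary condition: the real line, a bounded
interval `(a, b)` with homogeneous Dirichlet conditions, and a bounded interval `(a, b)` with
periodic conditions. -/
inductive Domain : Type
  | line : Domain
  | dirichlet (a b : ℝ) (hab : a < b) : Domain
  | periodic (a b : ℝ) (hab : a < b) : Domain

/-- Lebesgue measure on the domain. -/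
def Domain.measure : Domain → Measure ℝ
  | .line => volume
  | .dirichlet a b _ => volume.restrict (Ioo a b)
  | .periodic a b _ => volume.restrict (Ioo a b)

/-- The complex Hilbert space `L²(Ω)`. -/
abbrev Domain.L2 (Ω : Domain) : Type := Lp ℂ 2 Ω.measure

/-- Smooth test functions: compactly supported in the open domain (line, Dirichlet), or smooth and
periodic with period `b - a` (periodic). -/
def Domain.IsTest : Domain → (ℝ → ℂ) → Prop
  | .line, φ => ContDiff ℝ ∞ φ ∧ HasCompactSupport φ
  | .dirichlet a b _, φ => ContDiff ℝ ∞ φ ∧ HasCompactSupport φ ∧ tsupport φ ⊆ Ioo a b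
  | .periodic a b _, φ => ContDiff ℝ ∞ φ ∧ Function.Periodic φ (b - a)

/-- `g` is the weak derivative of `v` (on the circle in the periodic case). -/
def Domain.HasWeakDeriv (Ω : Domain) (v g : Ω.L2) : Prop :=
  ∀ φ : ℝ → ℂ, Ω.IsTest φ →
    ∫ x, v x * deriv φ x ∂Ω.measure = -∫ x, g x * φ x ∂Ω.measure

/-- The norm of `H^m(Ω)` (of the periodic space `H^m` in the periodic case), that is
`(∑_{j ≤ m} ‖∂ₓʲ v‖²)^{1/2}`, with value `∞` if `v` is not in `H^m`. Weak derivatives are unique,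
so that the infimum is over at most one value. -/
def Domain.sobolevNorm (Ω : Domain) (m : ℕ) (v : Ω.L2) : ℝ≥0∞ :=
  ⨅ (g : ℕ → Ω.L2) (_ : g 0 = v ∧ ∀ j < m, Ω.HasWeakDeriv (g j) (g (j + 1))),
    ENNReal.ofReal (Real.sqrt (∑ j ∈ Finset.range (m + 1), ‖g j‖ ^ 2))

/-- The norm of `L^∞([0,T]; H^m(Ω))`, with values in `[0, ∞]`. -/
def Domain.LinftySobolevNorm (Ω : Domain) (m : ℕ) (T : ℝ) (u : ℝ → Ω.L2) : ℝ≥0∞ :=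
  essSup (fun t => Ω.sobolevNorm m (u t)) (volume.restrict (Icc 0 T))

/-- The energy space: the closure of the test functions in `H¹`. It is `H¹(ℝ)` for the line,
`H¹₀(a, b)` in the Dirichlet case and the periodic `H¹` in the periodic case. -/
def Domain.MemEnergySpace (Ω : Domain) (v : Ω.L2) : Prop :=
  ∃ (g : Ω.L2) (φ : ℕ → ℝ → ℂ), (∀ j, Ω.IsTest (φ j)) ∧
    Tendsto (fun j => eLpNorm (fun x => φ j x - v x) 2 Ω.measure) atTop (𝓝 0) ∧
    Tendsto (fun j => eLpNorm (fun x => deriv (φ j) x - g x) 2 Ω.measure) atTop (𝓝 0)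

/-- The locally regularized logarithm `f_n^ε(ρ)`, `ρ ≥ 0`. -/
def fReg (n : ℕ) (ε ρ : ℝ) : ℝ :=
  if ρ < ε ^ 2 then
    Real.log (ε ^ 2) - ((n : ℝ) + 1) / n * (1 - ρ / ε ^ 2) ^ n
      - ∑ k ∈ Finset.Ico 1 n, 1 / (k : ℝ) * (1 - ρ / ε ^ 2) ^ k
  else Real.log ρ

theorem measurable_fReg (n : ℕ) (ε : ℝ) : Measurable (fReg n ε) := by
  unfold fReg
  refine Measurable.ite measurableSet_Iio ?_ Real.measurable_log
  fun_prop

/-- `u` is a weak solution on `[0, T]` of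
`i ∂ₜu = -∂ₓₓu + u f_n^ε(|u|²)`, `u(0) = u₀`, with the boundary condition of `Ω`:
`u ∈ C([0,T]; L²)`, bounded in `H¹` with values in the energy space, and the equation holds
against every test function, integrated in time. -/
structure IsWeakSolution (Ω : Domain) (n : ℕ) (ε T : ℝ) (u₀ : Ω.L2) (u : ℝ → Ω.L2) : Prop where
  initial : u 0 = u₀
  continuousOn : ContinuousOn u (Icc 0 T)
  energySpace : ∀ᵐ t ∂(volume.restrict (Icc 0 T)), Ω.MemEnergySpace (u t)
  bounded : Ω.LinftySobolevNorm 1 T u < ⊤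
  equation : ∀ φ : ℝ → ℂ, Ω.IsTest φ → ∀ t ∈ Icc (0 : ℝ) T,
    Complex.I * (∫ x, u t x * φ x ∂Ω.measure - ∫ x, u₀ x * φ x ∂Ω.measure) =
      ∫ s in (0 : ℝ)..t,
        (-(∫ x, u s x * deriv (deriv φ) x ∂Ω.measure) +
          ∫ x, u s x * (fReg n ε (‖u s x‖ ^ 2) : ℂ) * φ x ∂Ω.measure)

theorem memLp_phase_mul {μ : Measure ℝ} {θ : ℝ → ℝ} (hθ : AEStronglyMeasurable θ μ)
    (w : Lp ℂ 2 μ) : MemLp (fun x => w x * Complex.exp (Complex.I * (θ x : ℂ))) 2 μ := by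
  refine (Lp.memLp w).congr_norm ?_ (ae_of_all _ fun x => ?_)
  · refine (Lp.aestronglyMeasurable w).mul ?_
    have hc : Continuous fun r : ℝ => Complex.exp (Complex.I * (r : ℂ)) := by fun_prop
    exact hc.comp_aestronglyMeasurable hθ
  · rw [norm_mul, mul_comm Complex.I, Complex.norm_exp_ofReal_mul_I, mul_one]

/-- Multiplication of an `L²` function by `e^{iθ}`, `θ` real. -/
def phaseMul {μ : Measure ℝ} (θ : ℝ → ℝ) (hθ : AEStronglyMeasurable θ μ) (w : Lp ℂ 2 μ) :
    Lp ℂ 2 μ :=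
  (memLp_phase_mul hθ w).toLp _

theorem aestronglyMeasurable_phase {μ : Measure ℝ} (n : ℕ) (ε t : ℝ) (w : Lp ℂ 2 μ) :
    AEStronglyMeasurable (fun x => -(t * fReg n ε (‖w x‖ ^ 2))) μ := by
  have h : AEMeasurable (fun x => ‖w x‖ ^ 2) μ :=
    ((Lp.aestronglyMeasurable w).norm.aemeasurable).pow_const 2
  exact ((((measurable_fReg n ε).comp_aemeasurable h).const_mul t).neg).aestronglyMeasurable

/-- The nonlinear flow `Φ_B^t(w) = w e^{-i t f_n^ε(|w|²)}`. -/
def flowB (Ω : Domain) (n : ℕ) (ε t : ℝ) (w : Ω.L2) : Ω.L2 :=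
  phaseMul (fun x => -(t * fReg n ε (‖w x‖ ^ 2))) (aestronglyMeasurable_phase n ε t w) w

/-- The Dirichlet eigenfunctions of `-∂ₓₓ` on `(a, b)`, with eigenvalue `((k+1)π/(b-a))²`. -/
def dirichletMode (a b : ℝ) (k : ℕ) (x : ℝ) : ℂ :=
  ((Real.sqrt (2 / (b - a)) * Real.sin ((k + 1) * Real.pi * (x - a) / (b - a)) : ℝ) : ℂ)

/-- The periodic eigenfunctions of `-∂ₓₓ` on `(a, b)`, with eigenvalue `(2πk/(b-a))²`. -/
def periodicMode (a b : ℝ) (k : ℤ) (x : ℝ) : ℂ :=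
  ((Real.sqrt (1 / (b - a)) : ℝ) : ℂ) *
    Complex.exp (((2 * Real.pi * k * (x - a) / (b - a) : ℝ) : ℂ) * Complex.I)

theorem memLp_dirichletMode (a b : ℝ) (k : ℕ) :
    MemLp (dirichletMode a b k) 2 (volume.restrict (Ioo a b)) := by
  refine MemLp.of_bound (Continuous.aestronglyMeasurable ?_) (Real.sqrt (2 / (b - a)))
    (ae_of_all _ fun x => ?_)
  · unfold dirichletMode
    fun_prop
  · rw [dirichletMode, Complex.norm_real, norm_mul, Real.norm_of_nonneg (Real.sqrt_nonneg _)]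
    exact mul_le_of_le_one_right (Real.sqrt_nonneg _) (Real.abs_sin_le_one _)

theorem memLp_periodicMode (a b : ℝ) (k : ℤ) :
    MemLp (periodicMode a b k) 2 (volume.restrict (Ioo a b)) := by
  refine MemLp.of_bound (Continuous.aestronglyMeasurable ?_) (Real.sqrt (1 / (b - a)))
    (ae_of_all _ fun x => ?_)
  · unfold periodicMode
    fun_prop
  · rw [periodicMode, norm_mul, Complex.norm_exp_ofReal_mul_I, mul_one, Complex.norm_real,
      Real.norm_of_nonneg (Real.sqrt_nonneg _)]

/-- The free Schrödinger flow `Φ_A^t = e^{it∂ₓₓ}` on `L²(Ω)`: the Fourier multiplier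
`e^{-it(2πξ)²}` on the line (the Fourier transform has the kernel `e^{-2πixξ}`), and the expansion
in the orthonormal basis of Dirichlet or periodic eigenfunctions on an interval. -/
def flowA : (Ω : Domain) → ℝ → Ω.L2 → Ω.L2
  | .line, t, v =>
      (Lp.fourierTransformₗᵢ ℝ ℂ).symm
        (phaseMul (fun ξ : ℝ => -(t * (2 * Real.pi * ξ) ^ 2))
          (Continuous.aestronglyMeasurable (by fun_prop))
          (Lp.fourierTransformₗᵢ ℝ ℂ v))
  | .dirichlet a b _, t, v =>
      ∑' k : ℕ, (Complex.exp (-Complex.I * ((t * ((k + 1) * Real.pi / (b - a)) ^ 2 : ℝ) : ℂ)) *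
          inner ℂ ((memLp_dirichletMode a b k).toLp _) v) • (memLp_dirichletMode a b k).toLp _
  | .periodic a b _, t, v =>
      ∑' k : ℤ, (Complex.exp (-Complex.I * ((t * (2 * Real.pi * k / (b - a)) ^ 2 : ℝ) : ℂ)) *
          inner ℂ ((memLp_periodicMode a b k).toLp _) v) • (memLp_periodicMode a b k).toLp _

/-- The Lie–Trotter splitting `u^{k+1} = Φ_B^τ(Φ_A^τ(u^k))`, `u^0 = u₀`. -/
def lieTrotter (Ω : Domain) (n : ℕ) (ε τ : ℝ) (u₀ : Ω.L2) : ℕ → Ω.L2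
  | 0 => u₀
  | k + 1 => flowB Ω n ε τ (flowA Ω τ (lieTrotter Ω n ε τ u₀ k))

end ERLog

end

open MeasureTheory Filter Topology Set
open scoped ENNReal NNReal ContDiff

noncomputable section

namespace ERLog

/-! The argument is a fan of local errors: a stability bound for one splitting step that is free of
ε, and a local error of order τ²/ε, so that at most T/τ steps accumulate to τ/ε.

Stability. The free group is an isometry of L². For the nonlinear flow, write the difference of two
values so that the difference of phases is multiplied by the smaller of the two moduli. It then
suffices that r|f(s²) - f(r²)| ≤ 4n(s - r) for r ≤ s (`mul_abs_fReg_sq_sub_le`), which holds because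
ρ f'(ρ) ≤ 2n uniformly in ε. Hence Φ_B^τ is Lipschitz on L² with constant 1 + 4nτ
(`norm_flowB_sub_le`), and no bound on the numerical iterates is needed.

Local error. Put W = Φ_A^τ u(t) and F(u) = u f(|u|²). Both the splitting step and, by Duhamel's
formula, the exact solution equal W - iτF(W) up to second order, so only remainders have to be
estimated. In the splitting step the remainder is quadratic in τf. In Duhamel's formula the
Lipschitz constant Λ of F contributes Λτ² and Λ²τ², and removing the group in front of F(u) costs
τ²‖∂ₓₓF(u)‖. Both |f| and Λ grow only like log(1/ε). Bounding this by a multiple of 1/√ε keeps even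
their squares within 1/ε. Finally ‖∂ₓₓF(u)‖ = O(1/ε), since f' is at most of order 1/max(ρ, ε²) with
a Lipschitz modulus of order 1/max(ρ, ε²)², so that the worst terms are of order |u'|²/ε
(`IsRegular.ae_norm_deriv_nonlinDeriv_le`, `exists_gen_nonlin`).

Functional setting. The three boundary conditions are treated together through `UnitaryFlow`, a
unitary group with a core of its generator: Schwartz functions on the line, eigenfunctions on an
interval. `UnitaryFlow.gen_of_core` shows that membership in the domain may be tested on the core.
Consequently the domain consists of the functions that have a C¹ representative with absolutely
continuous derivative, square integrable second derivative and the right boundary behaviour, and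
both the function and its derivative are bounded by the graph norm (`gen_of_isRegular`,
`exists_isRegular_of_gen`). The group conserves the graph norm, so one bound K holds for u(t) and
for Φ_A^r u(t) for every r. Truncating f at modulus K is therefore invisible along the solution, and
it makes F globally Lipschitz on L².

Weak solutions. The H² bound is available only for almost every t. The properties that the error
analysis uses are collected in `IsTame`; they are closed in L², so continuity in time extends them
to every t. The equation is given against test functions only and is extended to the whole domain of
the generator in `IsWeakSolution.isWeakEvolution`, where L² density of the test functions is enough.
-/

/-! ### The regularized logarithm -/

/-- The correction of `1 / ρ` in the derivative of the regularized logarithm, in the variable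
`s = 1 - ρ / ε²`. -/
def regBump (n : ℕ) (s : ℝ) : ℝ :=
  ∑ j ∈ Finset.Ico 1 (n - 1), s ^ j + ((n : ℝ) + 1) * s ^ (n - 1)

/-- The derivative of the regularized logarithm. -/
def fRegDeriv (n : ℕ) (ε ρ : ℝ) : ℝ :=
  1 / max ρ (ε ^ 2) + 1 / ε ^ 2 * regBump n (max 0 (1 - ρ / ε ^ 2))

/-- The two branches are differentiated on closed half-lines that share ε². Since n ≥ 2 the
correction term vanishes at s = 0, so the one-sided derivatives agree there. -/
theorem hasDerivAt_fReg {n : ℕ} (hn : 2 ≤ n) {ε : ℝ} (hε : 0 < ε) (ρ : ℝ) :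
    HasDerivAt (fReg n ε) (fRegDeriv n ε ρ) ρ := by
  have hε2 : 0 < ε ^ 2 := by positivity
  have hn0 : (n : ℝ) ≠ 0 := by positivity
  have hlow : ∀ ρ ≤ ε ^ 2, HasDerivWithinAt (fReg n ε) (fRegDeriv n ε ρ) (Iic (ε ^ 2)) ρ := by
    intro ρ hρ
    have hs : 0 ≤ 1 - ρ / ε ^ 2 := by
      rw [sub_nonneg, div_le_one hε2]; exact hρ
    have hlin : HasDerivAt (fun ρ : ℝ => 1 - ρ / ε ^ 2) (-(1 / ε ^ 2)) ρ := by
      simpa using ((hasDerivAt_id ρ).div_const (ε ^ 2)).const_sub 1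
    have hpoly : HasDerivAt (fun ρ : ℝ => Real.log (ε ^ 2)
        - ((n : ℝ) + 1) / n * (1 - ρ / ε ^ 2) ^ n
        - ∑ k ∈ Finset.Ico 1 n, 1 / (k : ℝ) * (1 - ρ / ε ^ 2) ^ k)
        (0 - ((n : ℝ) + 1) / n * ((n : ℝ) * (1 - ρ / ε ^ 2) ^ (n - 1) * (-(1 / ε ^ 2)))
        - ∑ k ∈ Finset.Ico 1 n, 1 / (k : ℝ) *
          ((k : ℝ) * (1 - ρ / ε ^ 2) ^ (k - 1) * (-(1 / ε ^ 2)))) ρ := by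
      refine ((hasDerivAt_const _ _).sub ((hlin.pow n).const_mul _)).sub
        (HasDerivAt.fun_sum fun k _ => ((hlin.pow k).const_mul _))
    have hval : (0 - ((n : ℝ) + 1) / n * ((n : ℝ) * (1 - ρ / ε ^ 2) ^ (n - 1) * (-(1 / ε ^ 2)))
        - ∑ k ∈ Finset.Ico 1 n, 1 / (k : ℝ) *
          ((k : ℝ) * (1 - ρ / ε ^ 2) ^ (k - 1) * (-(1 / ε ^ 2)))) = fRegDeriv n ε ρ := by
      have h1 : ∑ k ∈ Finset.Ico 1 n, 1 / (k : ℝ) *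
          ((k : ℝ) * (1 - ρ / ε ^ 2) ^ (k - 1) * (-(1 / ε ^ 2)))
          = -(1 / ε ^ 2) * ∑ k ∈ Finset.Ico 1 n, (1 - ρ / ε ^ 2) ^ (k - 1) := by
        rw [Finset.mul_sum]
        refine Finset.sum_congr rfl fun k hk => ?_
        have : (k : ℝ) ≠ 0 := by
          have := (Finset.mem_Ico.1 hk).1
          positivity
        field_simp
      -- The term k = 1 supplies the summand 1 / ε², which below the threshold is 1 / max ρ ε². The
      -- remaining terms form `regBump`.
      have h2 : ∑ k ∈ Finset.Ico 1 n, (1 - ρ / ε ^ 2) ^ (k - 1)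
          = 1 + ∑ j ∈ Finset.Ico 1 (n - 1), (1 - ρ / ε ^ 2) ^ j := by
        obtain ⟨m, rfl⟩ : ∃ m, n = m + 2 := ⟨n - 2, by omega⟩
        rw [Finset.sum_Ico_eq_sum_range, Finset.sum_Ico_eq_sum_range]
        simp only [Nat.add_sub_cancel_left, show m + 2 - 1 = m + 1 by omega,
          show m + 1 - 1 = m by omega]
        rw [Finset.sum_range_succ']
        simp [add_comm]
      rw [h1, h2, fRegDeriv, regBump, max_eq_right hρ, max_eq_right hs]
      field_simp
      ring
    rw [← hval]
    refine hpoly.hasDerivWithinAt.congr_of_mem (fun x hx => ?_) hρ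
    rcases lt_or_eq_of_le (show x ≤ ε ^ 2 from hx) with hlt | heq
    · simp [fReg, hlt]
    · subst heq
      have hsum : ∑ k ∈ Finset.Ico 1 n, ((k : ℝ))⁻¹ * (0 : ℝ) ^ k = 0 :=
        Finset.sum_eq_zero fun k hk => by
          have := (Finset.mem_Ico.1 hk).1
          rw [zero_pow (by omega), mul_zero]
      simp [fReg, div_self hε2.ne', zero_pow (show n ≠ 0 by omega), hsum]
  have hhigh : ∀ ρ, ε ^ 2 ≤ ρ → HasDerivWithinAt (fReg n ε) (fRegDeriv n ε ρ) (Ici (ε ^ 2)) ρ := by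
    intro ρ hρ
    have hpos : 0 < ρ := hε2.trans_le hρ
    have hs : 1 - ρ / ε ^ 2 ≤ 0 := by
      rw [sub_nonpos, one_le_div hε2]; exact hρ
    have hval : fRegDeriv n ε ρ = ρ⁻¹ := by
      have hsum : ∑ j ∈ Finset.Ico 1 (n - 1), (0 : ℝ) ^ j = 0 :=
        Finset.sum_eq_zero fun k hk => by
          have := (Finset.mem_Ico.1 hk).1
          rw [zero_pow (by omega)]
      simp [fRegDeriv, regBump, max_eq_left hρ, max_eq_left hs, hsum,
        zero_pow (show n - 1 ≠ 0 by omega)]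
    rw [hval]
    refine (Real.hasDerivAt_log hpos.ne').hasDerivWithinAt.congr_of_mem (fun x hx => ?_) hρ
    simp [fReg, not_lt.2 (show ε ^ 2 ≤ x from hx)]
  rcases lt_trichotomy ρ (ε ^ 2) with h | h | h
  · exact (hlow ρ h.le).hasDerivAt (Iic_mem_nhds h)
  · have := (hlow ρ h.le).union (hhigh ρ h.ge)
    rwa [Iic_union_Ici, hasDerivWithinAt_univ] at this
  · exact (hhigh ρ h.le).hasDerivAt (Ici_mem_nhds h)

theorem regBump_nonneg (n : ℕ) {s : ℝ} (hs : 0 ≤ s) : 0 ≤ regBump n s := by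
  unfold regBump
  have : 0 ≤ ∑ j ∈ Finset.Ico 1 (n - 1), s ^ j := Finset.sum_nonneg fun _ _ => by positivity
  positivity

theorem regBump_le {n : ℕ} (hn : 2 ≤ n) {s : ℝ} (hs : 0 ≤ s) (hs1 : s ≤ 1) :
    regBump n s ≤ 2 * n - 1 := by
  have h1 : ∑ j ∈ Finset.Ico 1 (n - 1), s ^ j ≤ (n : ℝ) - 2 := by
    refine (Finset.sum_le_card_nsmul _ _ 1 fun j _ => pow_le_one₀ hs hs1).trans ?_
    rw [Nat.card_Ico, nsmul_eq_mul, mul_one, show n - 1 - 1 = n - 2 by omega, Nat.cast_sub hn]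
    norm_num
  have h2 : ((n : ℝ) + 1) * s ^ (n - 1) ≤ n + 1 :=
    mul_le_of_le_one_right (by positivity) (pow_le_one₀ hs hs1)
  unfold regBump
  linarith

theorem regBump_zero {n : ℕ} (hn : 2 ≤ n) : regBump n 0 = 0 := by
  have hsum : ∑ j ∈ Finset.Ico 1 (n - 1), (0 : ℝ) ^ j = 0 :=
    Finset.sum_eq_zero fun k hk => by
      have := (Finset.mem_Ico.1 hk).1
      rw [zero_pow (by omega)]
  simp [regBump, hsum, zero_pow (show n - 1 ≠ 0 by omega)]

/-- A Lipschitz constant of `regBump n` on `[0, 1]`. -/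
def regBumpLip (n : ℕ) : ℝ :=
  ∑ j ∈ Finset.Ico 1 (n - 1), (j : ℝ) + ((n : ℝ) + 1) * (n - 1 : ℕ)

theorem regBumpLip_nonneg (n : ℕ) : 0 ≤ regBumpLip n := by
  unfold regBumpLip
  positivity

theorem abs_regBump_sub_le (n : ℕ) {s t : ℝ} (hs : 0 ≤ s) (hs1 : s ≤ 1) (ht : 0 ≤ t)
    (ht1 : t ≤ 1) : |regBump n s - regBump n t| ≤ regBumpLip n * |s - t| := by
  have hpow : ∀ j : ℕ, |s ^ j - t ^ j| ≤ j * |s - t| := by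
    intro j
    refine (abs_pow_sub_pow_le s t j).trans ?_
    have h1 : max |s| |t| ^ (j - 1) ≤ 1 := by
      refine pow_le_one₀ (by positivity) (max_le ?_ ?_)
      · rwa [abs_of_nonneg hs]
      · rwa [abs_of_nonneg ht]
    calc |s - t| * j * max |s| |t| ^ (j - 1) ≤ |s - t| * j * 1 := by gcongr
      _ = j * |s - t| := by ring
  have hsplit : regBump n s - regBump n t = ∑ j ∈ Finset.Ico 1 (n - 1), (s ^ j - t ^ j)
      + ((n : ℝ) + 1) * (s ^ (n - 1) - t ^ (n - 1)) := by
    rw [Finset.sum_sub_distrib, regBump, regBump]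
    ring
  rw [hsplit, regBumpLip, add_mul (Finset.sum _ _), Finset.sum_mul]
  refine (abs_add_le _ _).trans (add_le_add ?_ ?_)
  · exact (Finset.abs_sum_le_sum_abs _ _).trans (Finset.sum_le_sum fun j _ => hpow j)
  · rw [abs_mul, abs_of_nonneg (by positivity : (0 : ℝ) ≤ (n : ℝ) + 1), mul_assoc]
    exact mul_le_mul_of_nonneg_left (hpow _) (by positivity)

theorem fRegDeriv_nonneg (n : ℕ) (ε : ℝ) {ρ : ℝ} (hρ : 0 ≤ ρ) : 0 ≤ fRegDeriv n ε ρ := by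
  have := regBump_nonneg n (le_max_left 0 (1 - ρ / ε ^ 2))
  have h2 : 0 ≤ max ρ (ε ^ 2) := hρ.trans (le_max_left _ _)
  unfold fRegDeriv
  positivity

theorem fRegDeriv_le {n : ℕ} (hn : 2 ≤ n) {ε ρ : ℝ} (hε : 0 < ε) (hρ : 0 ≤ ρ) :
    fRegDeriv n ε ρ ≤ 2 * n / max ρ (ε ^ 2) := by
  have hε2 : 0 < ε ^ 2 := by positivity
  have hn' : (2 : ℝ) ≤ n := by exact_mod_cast hn
  rcases le_total ρ (ε ^ 2) with h | h
  · have hs : 0 ≤ 1 - ρ / ε ^ 2 := by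
      rw [sub_nonneg, div_le_one hε2]; exact h
    have hs1 : 1 - ρ / ε ^ 2 ≤ 1 := by
      have : 0 ≤ ρ / ε ^ 2 := by positivity
      linarith
    have hb := regBump_le hn hs hs1
    rw [fRegDeriv, max_eq_right h, max_eq_right hs]
    calc 1 / ε ^ 2 + 1 / ε ^ 2 * regBump n (1 - ρ / ε ^ 2)
        ≤ 1 / ε ^ 2 + 1 / ε ^ 2 * (2 * n - 1) := by gcongr
      _ = 2 * n / ε ^ 2 := by ring
  · have hs : 1 - ρ / ε ^ 2 ≤ 0 := by
      rw [sub_nonpos, one_le_div hε2]; exact h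
    rw [fRegDeriv, max_eq_left h, max_eq_left hs, regBump_zero hn, mul_zero, add_zero]
    have : 0 < ρ := hε2.trans_le h
    gcongr
    linarith

/-- A substitute for a bound on f'', which need not exist: for n = 2 the derivative f' has a corner
at ε². The shape is that of |1/ρ - 1/σ|. The factor 1/ε² in front of the correction is compensated
because the correction lives on ρ ≤ ε². -/
theorem abs_fRegDeriv_sub_le {n : ℕ} {ε ρ σ : ℝ} (hε : 0 < ε) (hρ : 0 ≤ ρ)
    (hσ : 0 ≤ σ) :
    |fRegDeriv n ε ρ - fRegDeriv n ε σ|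
      ≤ (1 + regBumpLip n) * (|ρ - σ| / (max ρ (ε ^ 2) * max σ (ε ^ 2))) := by
  have hε2 : 0 < ε ^ 2 := by positivity
  have hM : ∀ ρ, 0 < max ρ (ε ^ 2) := fun ρ => hε2.trans_le (le_max_right _ _)
  have hinv : |1 / max ρ (ε ^ 2) - 1 / max σ (ε ^ 2)|
      ≤ |ρ - σ| / (max ρ (ε ^ 2) * max σ (ε ^ 2)) := by
    rw [div_sub_div _ _ (hM ρ).ne' (hM σ).ne', abs_div,
      abs_of_pos (mul_pos (hM ρ) (hM σ)), one_mul, mul_one, abs_sub_comm]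
    exact div_le_div_of_nonneg_right (abs_max_sub_max_le_abs ρ σ (ε ^ 2))
      (mul_pos (hM ρ) (hM σ)).le
  -- The interesting case is ρ ≤ ε² ≤ σ, where 1 - ρ/ε² ≤ 1 - ρ/σ = (σ - ρ)/σ.
  have key : ∀ ρ σ : ℝ, 0 ≤ ρ → ρ ≤ σ →
      |max 0 (1 - ρ / ε ^ 2) - max 0 (1 - σ / ε ^ 2)|
        ≤ ε ^ 2 * (|ρ - σ| / (max ρ (ε ^ 2) * max σ (ε ^ 2))) := by
    intro ρ σ hρ hle
    rw [abs_sub_comm ρ σ, abs_of_nonneg (sub_nonneg.2 hle)]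
    rcases le_total (ε ^ 2) ρ with h | h
    · have h1 : 1 - ρ / ε ^ 2 ≤ 0 := by rw [sub_nonpos, one_le_div hε2]; exact h
      have h2 : 1 - σ / ε ^ 2 ≤ 0 := by rw [sub_nonpos, one_le_div hε2]; exact h.trans hle
      rw [max_eq_left h1, max_eq_left h2, sub_self, abs_zero]
      have := hM ρ
      have := hM σ
      have := sub_nonneg.2 hle
      positivity
    · have h1 : 0 ≤ 1 - ρ / ε ^ 2 := by rw [sub_nonneg, div_le_one hε2]; exact h
      rw [max_eq_right h1, max_eq_right h]
      rcases le_total σ (ε ^ 2) with h' | h'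
      · have h2 : 0 ≤ 1 - σ / ε ^ 2 := by rw [sub_nonneg, div_le_one hε2]; exact h'
        have : 1 - ρ / ε ^ 2 - (1 - σ / ε ^ 2) = (σ - ρ) / ε ^ 2 := by ring
        rw [max_eq_right h2, max_eq_right h', this,
          abs_of_nonneg (div_nonneg (sub_nonneg.2 hle) hε2.le)]
        apply le_of_eq
        field_simp
      · have h2 : 1 - σ / ε ^ 2 ≤ 0 := by rw [sub_nonpos, one_le_div hε2]; exact h'
        have hσ : 0 < σ := hε2.trans_le h'
        rw [max_eq_left h2, max_eq_left h', sub_zero, abs_of_nonneg h1]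
        have h3 : ρ / σ ≤ ρ / ε ^ 2 := by gcongr
        calc 1 - ρ / ε ^ 2 ≤ 1 - ρ / σ := by linarith
          _ = ε ^ 2 * ((σ - ρ) / (ε ^ 2 * σ)) := by field_simp
  have key' : |max 0 (1 - ρ / ε ^ 2) - max 0 (1 - σ / ε ^ 2)|
        ≤ ε ^ 2 * (|ρ - σ| / (max ρ (ε ^ 2) * max σ (ε ^ 2))) := by
    rcases le_total ρ σ with h | h
    · exact key ρ σ hρ h
    · rw [abs_sub_comm, abs_sub_comm ρ, mul_comm (max ρ (ε ^ 2))]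
      exact key σ ρ hσ h
  have hs1 : ∀ ρ : ℝ, 0 ≤ ρ → max 0 (1 - ρ / ε ^ 2) ≤ 1 := by
    intro ρ hρ
    have : 0 ≤ ρ / ε ^ 2 := by positivity
    exact max_le zero_le_one (by linarith)
  have hb := abs_regBump_sub_le n (le_max_left 0 (1 - ρ / ε ^ 2)) (hs1 ρ hρ)
    (le_max_left 0 (1 - σ / ε ^ 2)) (hs1 σ hσ)
  have hL := regBumpLip_nonneg n
  calc |fRegDeriv n ε ρ - fRegDeriv n ε σ|
      = |(1 / max ρ (ε ^ 2) - 1 / max σ (ε ^ 2)) + 1 / ε ^ 2 *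
          (regBump n (max 0 (1 - ρ / ε ^ 2)) - regBump n (max 0 (1 - σ / ε ^ 2)))| := by
        unfold fRegDeriv; congr 1; ring
    _ ≤ |ρ - σ| / (max ρ (ε ^ 2) * max σ (ε ^ 2)) + 1 / ε ^ 2 * (regBumpLip n *
          (ε ^ 2 * (|ρ - σ| / (max ρ (ε ^ 2) * max σ (ε ^ 2))))) := by
        refine (abs_add_le _ _).trans (add_le_add hinv ?_)
        rw [abs_mul, abs_of_nonneg (by positivity : (0 : ℝ) ≤ 1 / ε ^ 2)]
        gcongr
        exact hb.trans (by gcongr)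
    _ = _ := by field_simp

/-- The derivative of x ↦ f(x²) is at most 4n/x, hence at most 4n/r on [r, s], and the weight r
cancels the singularity. The absence of ε on the right is what makes the scheme stable uniformly in
ε. -/
theorem mul_abs_fReg_sq_sub_le {n : ℕ} (hn : 2 ≤ n) {ε : ℝ} (hε : 0 < ε) {r s : ℝ} (hr : 0 ≤ r)
    (hrs : r ≤ s) : r * |fReg n ε (s ^ 2) - fReg n ε (r ^ 2)| ≤ 4 * n * (s - r) := by
  rcases hr.eq_or_lt with rfl | hr
  · have : (0 : ℝ) ≤ 4 * n * (s - 0) := by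
      have := sub_nonneg.2 hrs
      positivity
    simpa using this
  have hder : ∀ x : ℝ, HasDerivAt (fun x => fReg n ε (x ^ 2))
      (fRegDeriv n ε (x ^ 2) * (2 * x)) x := by
    intro x
    have := (hasDerivAt_fReg hn hε (x ^ 2)).comp x (hasDerivAt_pow 2 x)
    rw [Nat.cast_ofNat, Nat.add_one_sub_one, pow_one] at this
    exact this
  have hbound : ∀ x ∈ Icc r s, ‖fRegDeriv n ε (x ^ 2) * (2 * x)‖ ≤ 4 * n / r := by
    intro x hx
    have hx0 : 0 < x := hr.trans_le hx.1
    have h0 := fRegDeriv_nonneg n ε (sq_nonneg x)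
    rw [Real.norm_of_nonneg (by positivity)]
    have h1 : fRegDeriv n ε (x ^ 2) ≤ 2 * n / x ^ 2 := by
      refine (fRegDeriv_le hn hε (sq_nonneg x)).trans ?_
      gcongr
      exact le_max_left _ _
    calc fRegDeriv n ε (x ^ 2) * (2 * x) ≤ 2 * n / x ^ 2 * (2 * x) := by gcongr
      _ = 4 * n / x := by field_simp; ring
      _ ≤ 4 * n / r := by gcongr; exact hx.1
  have hmv := (convex_Icc r s).norm_image_sub_le_of_norm_hasDerivWithin_le
    (fun x _ => (hder x).hasDerivWithinAt) hbound (left_mem_Icc.2 hrs) (right_mem_Icc.2 hrs)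
  rw [Real.norm_eq_abs, Real.norm_eq_abs, abs_of_nonneg (sub_nonneg.2 hrs)] at hmv
  calc r * |fReg n ε (s ^ 2) - fReg n ε (r ^ 2)| ≤ r * (4 * n / r * (s - r)) := by gcongr
    _ = 4 * n * (s - r) := by field_simp

/-- The constant in the growth bound of the regularized logarithm. -/
def growthConst (n : ℕ) (K : ℝ) : ℝ := 2 * n + 4 + 2 * Real.log K

theorem one_le_growthConst (n : ℕ) {K : ℝ} (hK : 1 ≤ K) : 1 ≤ growthConst n K := by
  have := Real.log_nonneg hK
  have : (0 : ℝ) ≤ n := n.cast_nonneg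
  unfold growthConst
  linarith

/-- The true growth is logarithmic in ε. It is weakened to 1/√ε because squares of this bound occur
in the local error and have to fit into 1/ε. -/
theorem abs_fReg_le {n : ℕ} (hn : 2 ≤ n) {ε K ρ : ℝ} (hε : 0 < ε) (hε1 : ε ≤ 1) (hK : 1 ≤ K)
    (hρ : 0 ≤ ρ) (hρK : ρ ≤ K ^ 2) : |fReg n ε ρ| ≤ growthConst n K / √ε := by
  have hε2 : 0 < ε ^ 2 := by positivity
  have hn' : (2 : ℝ) ≤ n := by exact_mod_cast hn
  have hlogK := Real.log_nonneg hK
  have hlogε : Real.log ε ≤ 0 := Real.log_nonpos hε.le hε1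
  have hsq : 0 < √ε := Real.sqrt_pos.2 hε
  have hsq1 : √ε ≤ 1 := Real.sqrt_le_one.2 hε1
  -- This is log x ≤ x - 1 at x = 1/√ε.
  have hlog : -Real.log ε ≤ 2 / √ε - 2 := by
    have h := Real.log_le_sub_one_of_pos (inv_pos.2 hsq)
    rw [Real.log_inv, Real.log_sqrt hε.le] at h
    have : 2 / √ε = 2 * (√ε)⁻¹ := div_eq_mul_inv _ _
    linarith
  have hmain : |fReg n ε ρ| ≤ 2 * n + 2 * Real.log K - 2 * Real.log ε := by
    have hlow : 2 * Real.log ε - 2 * n ≤ fReg n ε ρ ∧ fReg n ε ρ ≤ 2 * Real.log K := by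
      by_cases h : ρ < ε ^ 2
      · have hs : 0 ≤ 1 - ρ / ε ^ 2 := by rw [sub_nonneg, div_le_one hε2]; exact h.le
        have hs1 : 1 - ρ / ε ^ 2 ≤ 1 := by
          have : 0 ≤ ρ / ε ^ 2 := by positivity
          linarith
        have h1 : ((n : ℝ) + 1) / n * (1 - ρ / ε ^ 2) ^ n ≤ 2 := by
          calc ((n : ℝ) + 1) / n * (1 - ρ / ε ^ 2) ^ n ≤ ((n : ℝ) + 1) / n * 1 := by
                gcongr; exact pow_le_one₀ hs hs1
            _ ≤ 2 := by rw [mul_one, div_le_iff₀ (by positivity)]; linarith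
        have h2 : ∑ k ∈ Finset.Ico 1 n, 1 / (k : ℝ) * (1 - ρ / ε ^ 2) ^ k ≤ (n : ℝ) - 1 := by
          refine (Finset.sum_le_card_nsmul _ _ 1 fun k hk => ?_).trans ?_
          · have hk1 : (1 : ℝ) ≤ k := by exact_mod_cast (Finset.mem_Ico.1 hk).1
            have hk2 : 1 / (k : ℝ) ≤ 1 := by
              rw [div_le_one (zero_lt_one.trans_le hk1)]
              exact hk1
            exact mul_le_one₀ hk2 (pow_nonneg hs k) (pow_le_one₀ hs hs1)
          · rw [Nat.card_Ico, nsmul_eq_mul, mul_one, Nat.cast_sub (by omega), Nat.cast_one]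
        have h1' : 0 ≤ ((n : ℝ) + 1) / n * (1 - ρ / ε ^ 2) ^ n := by positivity
        have h2' : 0 ≤ ∑ k ∈ Finset.Ico 1 n, 1 / (k : ℝ) * (1 - ρ / ε ^ 2) ^ k :=
          Finset.sum_nonneg fun k _ => by positivity
        rw [fReg, if_pos h, Real.log_pow, Nat.cast_ofNat]
        constructor <;> linarith
      · have hle : ε ^ 2 ≤ ρ := not_lt.1 h
        have hpos : 0 < ρ := hε2.trans_le hle
        rw [fReg, if_neg h]
        have h1 := Real.log_le_log hε2 hle
        have h2 := Real.log_le_log hpos hρK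
        rw [Real.log_pow, Nat.cast_ofNat] at h1 h2
        constructor <;> linarith
    rw [abs_le]
    constructor <;> linarith [hlow.1, hlow.2]
  have h1 : 1 ≤ 1 / √ε := by rw [one_le_div hsq]; exact hsq1
  have h3 : 2 * n + 2 * Real.log K ≤ (2 * n + 2 * Real.log K) * (1 / √ε) :=
    le_mul_of_one_le_right (by positivity) h1
  calc |fReg n ε ρ| ≤ 2 * n + 2 * Real.log K - 2 * Real.log ε := hmain
    _ ≤ (2 * n + 2 * Real.log K) * (1 / √ε) + 4 / √ε := by
      have : 4 / √ε = 2 * (2 / √ε) := by ring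
      linarith
    _ = growthConst n K / √ε := by unfold growthConst; ring

/-! ### The truncated nonlinearity -/

/-- The nonlinearity `z f(|z|²)`, with `|z|` truncated at `K` in the argument of `f`. -/
def nonlin (n : ℕ) (ε K : ℝ) (z : ℂ) : ℂ := z * (fReg n ε ((min ‖z‖ K) ^ 2) : ℂ)

theorem nonlin_zero (n : ℕ) (ε K : ℝ) : nonlin n ε K 0 = 0 := by simp [nonlin]

theorem nonlin_of_norm_le {n : ℕ} {ε K : ℝ} {z : ℂ} (hz : ‖z‖ ≤ K) :
    nonlin n ε K z = z * (fReg n ε (‖z‖ ^ 2) : ℂ) := by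
  rw [nonlin, min_eq_left hz]

/-- The Lipschitz constant of the truncated nonlinearity, up to the factor `1 / √ε`. -/
def lipConst (n : ℕ) (K : ℝ) : ℝ := growthConst n K + 4 * n

theorem lipConst_nonneg (n : ℕ) {K : ℝ} (hK : 1 ≤ K) : 0 ≤ lipConst n K := by
  have := one_le_growthConst n hK
  have : (0 : ℝ) ≤ n := n.cast_nonneg
  unfold lipConst
  linarith

/-- With the larger modulus in the undivided logarithm and the smaller one in front of the
difference of logarithms, the first part costs the size of f and the second is covered by
`mul_abs_fReg_sq_sub_le`. The truncation makes the bound global in z and w. -/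
theorem norm_nonlin_sub_le {n : ℕ} (hn : 2 ≤ n) {ε K : ℝ} (hε : 0 < ε) (hε1 : ε ≤ 1) (hK : 1 ≤ K)
    (z w : ℂ) : ‖nonlin n ε K z - nonlin n ε K w‖ ≤ lipConst n K / √ε * ‖z - w‖ := by
  wlog h : ‖w‖ ≤ ‖z‖ generalizing z w
  · rw [norm_sub_rev, norm_sub_rev z]
    exact this w z (not_le.1 h).le
  have hK0 : 0 ≤ K := zero_le_one.trans hK
  have hsq : 0 < √ε := Real.sqrt_pos.2 hε
  have hsq1 : √ε ≤ 1 := Real.sqrt_le_one.2 hε1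
  have hgrow : |fReg n ε ((min ‖z‖ K) ^ 2)| ≤ growthConst n K / √ε :=
    abs_fReg_le hn hε hε1 hK (sq_nonneg _)
      (pow_le_pow_left₀ (le_min (norm_nonneg _) hK0) (min_le_right _ _) 2)
  have hdiff : ‖w‖ * |fReg n ε ((min ‖z‖ K) ^ 2) - fReg n ε ((min ‖w‖ K) ^ 2)|
      ≤ 4 * n * ‖z - w‖ := by
    rcases le_total K ‖w‖ with hw | hw
    · rw [min_eq_right (hw.trans h), min_eq_right hw, sub_self, abs_zero, mul_zero]
      positivity
    · rw [min_eq_left hw]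
      refine (mul_abs_fReg_sq_sub_le hn hε (norm_nonneg w) (le_min h hw)).trans ?_
      gcongr
      refine (sub_le_sub_right (min_le_left _ _) _).trans (norm_sub_norm_le _ _)
  have hsplit : nonlin n ε K z - nonlin n ε K w = (z - w) * (fReg n ε ((min ‖z‖ K) ^ 2) : ℂ)
      + w * ((fReg n ε ((min ‖z‖ K) ^ 2) - fReg n ε ((min ‖w‖ K) ^ 2) : ℝ) : ℂ) := by
    simp only [nonlin]
    push_cast
    ring
  rw [hsplit]
  refine (norm_add_le _ _).trans ?_
  rw [norm_mul, norm_mul, Complex.norm_real, Complex.norm_real, Real.norm_eq_abs,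
    Real.norm_eq_abs]
  have h4 : (4 * n : ℝ) ≤ 4 * n / √ε := by
    rw [le_div_iff₀ hsq]
    exact mul_le_of_le_one_right (by positivity) hsq1
  calc ‖z - w‖ * |fReg n ε ((min ‖z‖ K) ^ 2)|
        + ‖w‖ * |fReg n ε ((min ‖z‖ K) ^ 2) - fReg n ε ((min ‖w‖ K) ^ 2)|
      ≤ ‖z - w‖ * (growthConst n K / √ε) + 4 * n / √ε * ‖z - w‖ := by
        refine add_le_add (by gcongr) (hdiff.trans (by gcongr))
    _ = lipConst n K / √ε * ‖z - w‖ := by unfold lipConst; ring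

/-! ### Pointwise bounds of the nonlinear flow -/

/-- For |θ| ≤ 1 this is Taylor's formula; for larger θ the trivial bound 2|θ| is already below 2θ².
-/
theorem norm_exp_I_mul_sub_one_add_le (θ : ℝ) :
    ‖Complex.exp (Complex.I * ((-θ : ℝ) : ℂ)) - 1 + Complex.I * θ‖ ≤ 2 * θ ^ 2 := by
  by_cases h : |θ| ≤ 1
  · have h1 : ‖Complex.I * ((-θ : ℝ) : ℂ)‖ ≤ 1 := by simpa using h
    have := Complex.norm_exp_sub_one_sub_id_le h1
    rw [norm_mul, Complex.norm_I, one_mul, Complex.norm_real, Real.norm_eq_abs, sq_abs,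
      neg_sq] at this
    have heq : Complex.exp (Complex.I * ((-θ : ℝ) : ℂ)) - 1 + Complex.I * θ
        = Complex.exp (Complex.I * ((-θ : ℝ) : ℂ)) - 1 - Complex.I * ((-θ : ℝ) : ℂ) := by
      push_cast
      ring
    rw [heq]
    nlinarith [sq_nonneg θ]
  · have h1 : 1 < |θ| := not_le.1 h
    have h2 : ‖Complex.exp (Complex.I * ((-θ : ℝ) : ℂ)) - 1‖ ≤ |θ| := by
      simpa using Real.norm_exp_I_mul_ofReal_sub_one_le (x := -θ)
    have h3 : ‖Complex.I * (θ : ℂ)‖ = |θ| := by simp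
    have h4 := norm_add_le (Complex.exp (Complex.I * ((-θ : ℝ) : ℂ)) - 1) (Complex.I * θ)
    nlinarith [sq_abs θ]

/-- The phase difference is multiplied by the smaller modulus, so `mul_abs_fReg_sq_sub_le` applies
and ε drops out. -/
theorem norm_phase_sub_le {n : ℕ} (hn : 2 ≤ n) {ε : ℝ} (hε : 0 < ε) {t : ℝ} (ht : 0 ≤ t)
    (z w : ℂ) :
    ‖z * Complex.exp (Complex.I * ((-(t * fReg n ε (‖z‖ ^ 2)) : ℝ) : ℂ))
        - w * Complex.exp (Complex.I * ((-(t * fReg n ε (‖w‖ ^ 2)) : ℝ) : ℂ))‖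
      ≤ (1 + 4 * n * t) * ‖z - w‖ := by
  wlog h : ‖w‖ ≤ ‖z‖ generalizing z w
  · rw [norm_sub_rev, norm_sub_rev z]
    exact this w z (not_le.1 h).le
  set θ : ℂ → ℝ := fun z => -(t * fReg n ε (‖z‖ ^ 2)) with hθ
  have hexp : ‖Complex.exp (Complex.I * (θ z : ℂ)) - Complex.exp (Complex.I * (θ w : ℂ))‖
      ≤ t * |fReg n ε (‖z‖ ^ 2) - fReg n ε (‖w‖ ^ 2)| := by
    have h1 : Complex.exp (Complex.I * (θ z : ℂ)) - Complex.exp (Complex.I * (θ w : ℂ))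
        = Complex.exp (Complex.I * (θ w : ℂ)) *
          (Complex.exp (Complex.I * ((θ z - θ w : ℝ) : ℂ)) - 1) := by
      rw [mul_sub, ← Complex.exp_add, mul_one]
      congr 2
      push_cast
      ring
    rw [h1, norm_mul, Complex.norm_exp_I_mul_ofReal, one_mul]
    refine Real.norm_exp_I_mul_ofReal_sub_one_le.trans (le_of_eq ?_)
    have h2 : θ z - θ w = -(t * (fReg n ε (‖z‖ ^ 2) - fReg n ε (‖w‖ ^ 2))) := by
      simp only [hθ]
      ring
    rw [h2, norm_neg, norm_mul, Real.norm_of_nonneg ht, Real.norm_eq_abs]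
  have hsplit : z * Complex.exp (Complex.I * (θ z : ℂ)) - w * Complex.exp (Complex.I * (θ w : ℂ))
      = (z - w) * Complex.exp (Complex.I * (θ z : ℂ))
        + w * (Complex.exp (Complex.I * (θ z : ℂ)) - Complex.exp (Complex.I * (θ w : ℂ))) := by
    ring
  change ‖z * Complex.exp (Complex.I * (θ z : ℂ)) - w * Complex.exp (Complex.I * (θ w : ℂ))‖ ≤ _
  rw [hsplit]
  refine (norm_add_le _ _).trans ?_
  rw [norm_mul, norm_mul, Complex.norm_exp_I_mul_ofReal, mul_one]
  have h1 := mul_abs_fReg_sq_sub_le hn hε (norm_nonneg w) h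
  have h2 : ‖z‖ - ‖w‖ ≤ ‖z - w‖ := norm_sub_norm_le z w
  calc ‖z - w‖ + ‖w‖ * ‖Complex.exp (Complex.I * (θ z : ℂ)) - Complex.exp (Complex.I * (θ w : ℂ))‖
      ≤ ‖z - w‖ + ‖w‖ * (t * |fReg n ε (‖z‖ ^ 2) - fReg n ε (‖w‖ ^ 2)|) := by gcongr
    _ = ‖z - w‖ + t * (‖w‖ * |fReg n ε (‖z‖ ^ 2) - fReg n ε (‖w‖ ^ 2)|) := by ring
    _ ≤ ‖z - w‖ + t * (4 * n * ‖z - w‖) := by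
        have h3 : 4 * (n : ℝ) * (‖z‖ - ‖w‖) ≤ 4 * n * ‖z - w‖ := by gcongr
        exact add_le_add_right (mul_le_mul_of_nonneg_left (h1.trans h3) ht) _
    _ = (1 + 4 * n * t) * ‖z - w‖ := by ring

/-! ### Unitary groups given on a core of their generator -/

/-- A one-parameter group of isometries `S t = e^{itA}` together with a set of pairs `(φ, Aφ)` whose
span is invariant and whose first components are total. -/
structure UnitaryFlow (H : Type*) [NormedAddCommGroup H] [InnerProductSpace ℂ H] where
  S : ℝ → H →ₗᵢ[ℂ] H
  map_zero : ∀ v, S 0 v = v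
  map_add : ∀ s t v, S (s + t) v = S s (S t v)
  core : Set (H × H)
  core_hasDerivAt : ∀ p ∈ core, HasDerivAt (fun t => S t p.1) (Complex.I • p.2) 0
  core_map : ∀ p ∈ core, ∀ t, (S t p.1, S t p.2) ∈ Submodule.span ℂ core
  core_dense : Dense (Prod.fst '' (Submodule.span ℂ core : Set (H × H)))

namespace UnitaryFlow

variable {H : Type*} [NormedAddCommGroup H] [InnerProductSpace ℂ H] (P : UnitaryFlow H)

/-- `Aφ = ψ` for the generator `iA` of the group. -/
def Gen (φ ψ : H) : Prop := HasDerivAt (fun t => P.S t φ) (Complex.I • ψ) 0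

variable {P} {φ ψ v w : H}

theorem map_comm (s t : ℝ) (v : H) : P.S s (P.S t v) = P.S t (P.S s v) := by
  rw [← P.map_add, add_comm, P.map_add]

theorem map_neg_map (t : ℝ) (v : H) : P.S (-t) (P.S t v) = v := by
  rw [← P.map_add, neg_add_cancel, P.map_zero]

theorem inner_map_left (t : ℝ) (v w : H) : inner ℂ (P.S t v) w = inner ℂ v (P.S (-t) w) := by
  have h : w = P.S t (P.S (-t) w) := by rw [map_comm, map_neg_map]
  conv_lhs => rw [h]
  exact (P.S t).inner_map_map _ _

theorem Gen.hasDerivAt (h : P.Gen φ ψ) (t : ℝ) :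
    HasDerivAt (fun s => P.S s φ) (Complex.I • P.S t ψ) t := by
  have h0 : HasDerivAt (fun s => P.S s φ) (Complex.I • ψ) (t - t) := by rw [sub_self]; exact h
  have h1 : HasDerivAt (fun s => P.S (s - t) φ) (Complex.I • ψ) t := h0.comp_sub_const t t
  have h2 := (((P.S t).toContinuousLinearMap.restrictScalars ℝ).hasFDerivAt
    (x := P.S (t - t) φ)).comp_hasDerivAt t h1
  convert h2 using 1
  · ext s
    simp [← P.map_add]
  · simp

theorem Gen.hasDerivAt_neg (h : P.Gen φ ψ) (t : ℝ) :
    HasDerivAt (fun s => P.S (-s) φ) (-(Complex.I • P.S (-t) ψ)) t := by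
  have := (h.hasDerivAt (-t)).scomp t (_root_.hasDerivAt_neg t)
  rw [neg_smul, one_smul] at this
  exact this

theorem Gen.map (h : P.Gen φ ψ) (t : ℝ) : P.Gen (P.S t φ) (P.S t ψ) := by
  have h2 := (((P.S t).toContinuousLinearMap.restrictScalars ℝ).hasFDerivAt
    (x := P.S 0 φ)).comp_hasDerivAt (0 : ℝ) h
  unfold Gen
  convert h2 using 1
  · ext s
    simp [map_comm s t]
  · simp

theorem Gen.add (h : P.Gen φ ψ) (h' : P.Gen v w) : P.Gen (φ + v) (ψ + w) := by
  have := HasDerivAt.fun_add h h'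
  unfold Gen
  simpa only [smul_add, _root_.map_add] using this

theorem Gen.smul (h : P.Gen φ ψ) (c : ℂ) : P.Gen (c • φ) (c • ψ) := by
  have := HasDerivAt.const_smul c h
  unfold Gen
  rw [smul_comm]
  convert this using 1
  ext t
  simp

theorem gen_zero : P.Gen 0 0 := by
  unfold Gen
  simpa using hasDerivAt_const (0 : ℝ) (0 : H)

/-- Symmetry of the generator, obtained by differentiating ⟨S t φ, v⟩ = ⟨φ, S (-t) v⟩ at t = 0. -/
theorem Gen.inner_eq (h : P.Gen φ ψ) (h' : P.Gen v w) : inner ℂ ψ v = inner ℂ φ w := by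
  have h1 : HasDerivAt (fun t => inner ℂ (P.S t φ) v) (inner ℂ (Complex.I • ψ) v) (0 : ℝ) := by
    simpa only [inner_zero_right, zero_add] using HasDerivAt.inner ℂ h (hasDerivAt_const (0 : ℝ) v)
  have h2 : HasDerivAt (fun t : ℝ => P.S (-t) v) (-(Complex.I • w)) 0 := by
    simpa only [neg_zero, P.map_zero] using h'.hasDerivAt_neg 0
  have h3 : HasDerivAt (fun t => inner ℂ (P.S t φ) v) (inner ℂ φ (-(Complex.I • w))) (0 : ℝ) := by
    simp only [inner_map_left]
    simpa only [inner_zero_left, add_zero] using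
      HasDerivAt.inner ℂ (hasDerivAt_const (0 : ℝ) φ) h2
  have h4 := h1.unique h3
  rw [inner_smul_left, Complex.conj_I, inner_neg_right, inner_smul_right, neg_mul, neg_inj] at h4
  exact mul_left_cancel₀ Complex.I_ne_zero h4

/-- The orbit has speed ‖w‖ at all times, since the group is isometric. -/
theorem Gen.norm_map_sub_le (h : P.Gen v w) (r : ℝ) : ‖P.S r v - v‖ ≤ |r| * ‖w‖ := by
  have hb := Convex.norm_image_sub_le_of_norm_hasDerivWithin_le (𝕜 := ℝ)
    (f := fun s => P.S s v) (C := ‖w‖) (s := univ) (x := 0) (y := r)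
    (fun x _ => (h.hasDerivAt x).hasDerivWithinAt)
    (fun x _ => by rw [norm_smul, Complex.norm_I, one_mul, LinearIsometry.norm_map])
    convex_univ (mem_univ _) (mem_univ _)
  simp only [P.map_zero, sub_zero, Real.norm_eq_abs] at hb
  rw [mul_comm]
  exact hb

theorem gen_of_mem_span {p : H × H} (hp : p ∈ Submodule.span ℂ P.core) : P.Gen p.1 p.2 := by
  induction hp using Submodule.span_induction with
  | mem p hp => exact P.core_hasDerivAt p hp
  | zero => exact gen_zero
  | add p q _ _ hp hq => exact hp.add hq
  | smul c p _ hp => exact hp.smul c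

theorem map_mem_span {p : H × H} (hp : p ∈ Submodule.span ℂ P.core) (t : ℝ) :
    (P.S t p.1, P.S t p.2) ∈ Submodule.span ℂ P.core := by
  induction hp using Submodule.span_induction with
  | mem p hp => exact P.core_map p hp t
  | zero =>
    simp only [Prod.fst_zero, Prod.snd_zero, _root_.map_zero]
    exact zero_mem _
  | add p q _ _ hp hq => simpa using add_mem hp hq
  | smul c p _ hp => simpa using Submodule.smul_mem _ c hp

variable (P) in
theorem dense_gen : Dense {φ : H | ∃ ψ, P.Gen φ ψ} := by
  refine P.core_dense.mono ?_
  rintro _ ⟨p, hp, rfl⟩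
  exact ⟨p.2, gen_of_mem_span hp⟩

-- Strong continuity is not part of the structure: orbits of domain vectors are differentiable, and
-- by density and isometry every orbit is a uniform limit of such orbits.
variable (P) in
theorem continuous_map (v : H) : Continuous fun t => P.S t v := by
  refine continuous_of_uniform_approx_of_continuous fun u hu => ?_
  obtain ⟨ε, hε, hu⟩ := Metric.mem_uniformity_dist.1 hu
  obtain ⟨φ, ⟨ψ, hφ⟩, hd⟩ := P.dense_gen.exists_dist_lt v hε
  refine ⟨fun t => P.S t φ, continuous_iff_continuousAt.2 fun t => (hφ.hasDerivAt t).continuousAt,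
    fun t => hu ?_⟩
  rwa [LinearIsometry.dist_map]

/-- A vector is in the domain of the generator if this holds weakly, tested with the core. -/
theorem gen_of_core [CompleteSpace H]
    (h : ∀ p ∈ P.core, inner ℂ p.2 v = inner ℂ p.1 w) : P.Gen v w := by
  have hspan : ∀ p ∈ Submodule.span ℂ P.core, inner ℂ p.2 v = inner ℂ p.1 w := by
    intro p hp
    induction hp using Submodule.span_induction with
    | mem p hp => exact h p hp
    | zero => simp
    | add p q _ _ hp hq => simp [hp, hq]
    | smul c p _ hp => simp [hp]
  -- It suffices to prove the integrated form of the generator equation, paired with the span of the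
  -- core. The group is moved to the core vector, and invariance of the span under the group keeps
  -- the weak hypothesis applicable to the moved vector.
  have hint : ∀ r, P.S r v - v = ∫ s in (0 : ℝ)..r, Complex.I • P.S s w := by
    intro r
    have hcont : Continuous fun s => Complex.I • P.S s w := (P.continuous_map w).const_smul _
    refine P.core_dense.eq_of_inner_right ℂ ?_
    rintro _ ⟨p, hp, rfl⟩
    have hder : ∀ s ∈ uIcc 0 r, HasDerivAt (fun s => inner ℂ p.1 (P.S s v))
        (inner ℂ p.1 (Complex.I • P.S s w)) s := by
      intro s _
      have h1 : HasDerivAt (fun s : ℝ => P.S (-s) p.1) (-(Complex.I • P.S (-s) p.2)) s :=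
        (gen_of_mem_span hp).hasDerivAt_neg s
      have h2 := HasDerivAt.inner ℂ h1 (hasDerivAt_const s v)
      have hfun : (fun s => inner ℂ p.1 (P.S s v)) = fun s : ℝ => inner ℂ (P.S (-s) p.1) v := by
        ext s
        rw [inner_map_left, neg_neg]
      rw [hfun]
      refine h2.congr_deriv ?_
      have h3 := hspan _ (map_mem_span hp (-s))
      simp only at h3
      rw [inner_zero_right, zero_add, inner_neg_left, inner_smul_left, h3, inner_map_left, neg_neg,
        Complex.conj_I, inner_smul_right]
      ring
    have hftc := intervalIntegral.integral_eq_sub_of_hasDerivAt hder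
      ((Continuous.inner continuous_const hcont).intervalIntegrable _ _)
    rw [P.map_zero, ← inner_sub_right] at hftc
    rw [← hftc]
    exact ((innerSL ℂ p.1).intervalIntegral_comp_comm (hcont.intervalIntegrable _ _))
  have hcont : Continuous fun s => Complex.I • P.S s w := (P.continuous_map w).const_smul _
  have hder := (hcont.integral_hasStrictDerivAt 0 0).hasDerivAt
  unfold Gen
  rw [P.map_zero] at hder
  convert hder.add_const v using 1
  ext r
  rw [← hint r]
  abel

end UnitaryFlow

end ERLog

/-! ### Absolutely continuous complex-valued functions -/

namespace AbsolutelyContinuousOnInterval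

theorem lipschitzWith_comp {X Y : Type*} [PseudoMetricSpace X] [PseudoMetricSpace Y] {f : ℝ → X}
    {g : X → Y} {K : ℝ≥0} {a b : ℝ} (hg : LipschitzWith K g)
    (hf : AbsolutelyContinuousOnInterval f a b) :
    AbsolutelyContinuousOnInterval (fun x => g (f x)) a b := by
  unfold AbsolutelyContinuousOnInterval at hf ⊢
  refine squeeze_zero (fun E => Finset.sum_nonneg fun _ _ => dist_nonneg) (fun E => ?_)
    (by simpa using hf.const_mul (K : ℝ))
  rw [Finset.mul_sum]
  exact Finset.sum_le_sum fun i _ => hg.dist_le_mul _ _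

variable {f : ℝ → ℂ} {a b : ℝ}

theorem complex_mul {g : ℝ → ℂ} (hf : AbsolutelyContinuousOnInterval f a b)
    (hg : AbsolutelyContinuousOnInterval g a b) :
    AbsolutelyContinuousOnInterval (fun x => f x * g x) a b :=
  hf.smul hg

theorem complex_re (hf : AbsolutelyContinuousOnInterval f a b) :
    AbsolutelyContinuousOnInterval (fun x => (f x).re) a b :=
  hf.lipschitzWith_comp (LipschitzWith.of_dist_le_mul (K := 1) fun x y => by
    simpa [dist_eq_norm] using Complex.abs_re_le_norm (x - y))

theorem complex_im (hf : AbsolutelyContinuousOnInterval f a b) :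
    AbsolutelyContinuousOnInterval (fun x => (f x).im) a b :=
  hf.lipschitzWith_comp (LipschitzWith.of_dist_le_mul (K := 1) fun x y => by
    simpa [dist_eq_norm] using Complex.abs_im_le_norm (x - y))

theorem ofReal {g : ℝ → ℝ} (hg : AbsolutelyContinuousOnInterval g a b) :
    AbsolutelyContinuousOnInterval (fun x => (g x : ℂ)) a b :=
  hg.lipschitzWith_comp (LipschitzWith.of_dist_le_mul (K := 1) fun x y => by
    rw [Complex.dist_of_im_eq (by simp)]; simp [Real.dist_eq])

theorem ae_differentiableAt_complex (hf : AbsolutelyContinuousOnInterval f a b) :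
    ∀ᵐ x : ℝ, x ∈ uIcc a b → DifferentiableAt ℝ f x :=
  hf.boundedVariationOn.ae_differentiableAt_of_mem_uIcc

theorem intervalIntegrable_deriv_complex (hf : AbsolutelyContinuousOnInterval f a b) :
    IntervalIntegrable (deriv f) volume a b := by
  have hre := hf.complex_re.intervalIntegrable_deriv
  have him := hf.complex_im.intervalIntegrable_deriv
  have hre' : IntervalIntegrable (fun x => ((deriv (fun x => (f x).re) x : ℝ) : ℂ)) volume a b :=
    ⟨hre.1.ofReal, hre.2.ofReal⟩
  have him' : IntervalIntegrable (fun x => ((deriv (fun x => (f x).im) x : ℝ) : ℂ)) volume a b :=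
    ⟨him.1.ofReal, him.2.ofReal⟩
  have h := hre'.add (him'.mul_const Complex.I)
  refine h.congr_ae ?_
  refine (ae_restrict_iff' measurableSet_uIoc).2 ?_
  filter_upwards [hf.ae_differentiableAt_complex] with x hx hxm
  have hd := (hx (uIoc_subset_uIcc hxm)).hasDerivAt
  have hre : HasDerivAt (fun x => (f x).re) (deriv f x).re x :=
    Complex.reCLM.hasFDerivAt.comp_hasDerivAt x hd
  have him : HasDerivAt (fun x => (f x).im) (deriv f x).im x :=
    Complex.imCLM.hasFDerivAt.comp_hasDerivAt x hd
  simp [hre.deriv, him.deriv]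

theorem _root_.IntervalIntegrable.absolutelyContinuousOnInterval_intervalIntegral_complex {c : ℝ}
    (h : IntervalIntegrable f volume a b) (hc : c ∈ uIcc a b) :
    AbsolutelyContinuousOnInterval (fun x => ∫ y in c..x, f y) a b := by
  have hsub : ∀ x ∈ uIcc a b, IntervalIntegrable f volume c x := fun x hx =>
    h.mono_set (uIcc_subset_uIcc hc hx)
  have hre : IntervalIntegrable (fun x => (f x).re) volume a b :=
    ⟨h.1.re, h.2.re⟩
  have him : IntervalIntegrable (fun x => (f x).im) volume a b :=
    ⟨h.1.im, h.2.im⟩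
  have h1 := (hre.absolutelyContinuousOnInterval_intervalIntegral hc).ofReal
  have h2 := ((him.absolutelyContinuousOnInterval_intervalIntegral hc).ofReal).const_smul Complex.I
  have h3 := h1.add h2
  rw [absolutelyContinuousOnInterval_iff] at h3 ⊢
  intro ε hε
  obtain ⟨δ, hδ, h⟩ := h3 ε hε
  refine ⟨δ, hδ, fun E hE hlt => ?_⟩
  have hval : ∀ x ∈ uIcc a b, ((∫ y in c..x, (f y).re : ℝ) : ℂ)
      + Complex.I • ((∫ y in c..x, (f y).im : ℝ) : ℂ) = ∫ y in c..x, f y := by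
    intro x hx
    have h1 := Complex.reCLM.intervalIntegral_comp_comm (hsub x hx)
    have h2 := Complex.imCLM.intervalIntegral_comp_comm (hsub x hx)
    simp only [Complex.reCLM_apply, Complex.imCLM_apply] at h1 h2
    rw [h1, h2, smul_eq_mul, mul_comm, Complex.re_add_im]
  have h' := h E hE hlt
  refine lt_of_eq_of_lt (Finset.sum_congr rfl fun i hi => ?_) h'
  have hmem := hE.1 i hi
  simp only [Pi.add_apply]
  rw [hval _ hmem.1, hval _ hmem.2]

/-- The difference of f and the primitive of its derivative is absolutely continuous with derivative
zero almost everywhere, hence constant. -/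
theorem integral_deriv_eq_sub_complex (hf : AbsolutelyContinuousOnInterval f a b) :
    ∫ x in a..b, deriv f x = f b - f a := by
  have hac := hf.intervalIntegrable_deriv_complex
    |>.absolutelyContinuousOnInterval_intervalIntegral_complex (c := a) left_mem_uIcc
  have hzero : ∀ᵐ x : ℝ, x ∈ uIcc a b →
      HasDerivAt (f - fun x => ∫ y in a..x, deriv f y) 0 x := by
    filter_upwards [hf.ae_differentiableAt_complex,
      hf.intervalIntegrable_deriv_complex.ae_hasDerivAt_integral] with x h1 h2 hx
    simpa using (h1 hx).hasDerivAt.sub (h2 hx a left_mem_uIcc)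
  obtain ⟨C, hC⟩ := (hf.sub hac).const_of_ae_hasDerivAt_zero hzero
  have ha := hC a left_mem_uIcc
  have hb := hC b right_mem_uIcc
  simp only [Pi.sub_apply, intervalIntegral.integral_same, sub_zero] at ha hb
  rw [ha, ← hb]
  ring

theorem integral_mul_deriv_eq_sub {ψ : ℝ → ℂ} (hf : AbsolutelyContinuousOnInterval f a b)
    (hψ : ContDiff ℝ ∞ ψ) :
    ∫ x in a..b, f x * deriv ψ x = f b * ψ b - f a * ψ a - ∫ x in a..b, deriv f x * ψ x := by
  have hψac : AbsolutelyContinuousOnInterval ψ a b :=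
    ((hψ.of_le (by simp)).contDiffOn (s := uIcc a b)).absolutelyContinuousOnInterval
  have hprod := hf.complex_mul hψac
  have hcont' : Continuous (deriv ψ) := hψ.continuous_deriv (by simp)
  have hint1 : IntervalIntegrable (fun x => f x * deriv ψ x) volume a b :=
    (hf.continuousOn.mul hcont'.continuousOn).intervalIntegrable
  have hint2 : IntervalIntegrable (fun x => deriv f x * ψ x) volume a b :=
    hf.intervalIntegrable_deriv_complex.mul_continuousOn hψ.continuous.continuousOn
  have hsum : ∫ x in a..b, (deriv f x * ψ x + f x * deriv ψ x) = f b * ψ b - f a * ψ a := by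
    rw [← hprod.integral_deriv_eq_sub_complex]
    refine intervalIntegral.integral_congr_ae ?_
    filter_upwards [hf.ae_differentiableAt_complex] with x hx hxm
    have h1 := (hx (uIoc_subset_uIcc hxm)).hasDerivAt
    have h2 := ((hψ.differentiable (by simp)) x).hasDerivAt
    exact (h1.mul h2).deriv.symm
  rw [← hsum, intervalIntegral.integral_add hint2 hint1]
  ring

end AbsolutelyContinuousOnInterval

/-! ### Functions with absolutely continuous derivative -/

namespace ERLog

/-- A continuously differentiable function on the line whose derivative is locally absolutely
continuous. -/
structure IsRegular (V V' : ℝ → ℂ) : Prop where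
  hasDerivAt : ∀ x, HasDerivAt V (V' x) x
  ac : ∀ p q, AbsolutelyContinuousOnInterval V' p q

namespace IsRegular

variable {V V' : ℝ → ℂ}

theorem continuous (h : IsRegular V V') : Continuous V :=
  continuous_iff_continuousAt.2 fun x => (h.hasDerivAt x).continuousAt

theorem continuous_deriv (h : IsRegular V V') : Continuous V' := by
  refine continuous_iff_continuousAt.2 fun x => ?_
  refine (h.ac (x - 1) (x + 1)).continuousOn.continuousAt ?_
  rw [uIcc_of_le (by linarith)]
  exact Icc_mem_nhds (by linarith) (by linarith)

theorem ae_differentiableAt (h : IsRegular V V') : ∀ᵐ x : ℝ, DifferentiableAt ℝ V' x := by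
  have : ∀ᵐ x : ℝ, ∀ k : ℕ, x ∈ uIcc (-(k : ℝ)) k → DifferentiableAt ℝ V' x :=
    ae_all_iff.2 fun k => (h.ac _ _).ae_differentiableAt_complex
  filter_upwards [this] with x hx
  obtain ⟨k, hk⟩ := exists_nat_ge |x|
  refine hx k ?_
  rw [uIcc_of_le (by have := abs_nonneg x; linarith)]
  exact abs_le.1 hk

theorem contDiff_one (h : IsRegular V V') : ContDiff ℝ 1 V := by
  rw [contDiff_one_iff_deriv]
  have hd : deriv V = V' := funext fun x => (h.hasDerivAt x).deriv
  exact ⟨fun x => (h.hasDerivAt x).differentiableAt, hd ▸ h.continuous_deriv⟩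

theorem ac_self (h : IsRegular V V') (p q : ℝ) : AbsolutelyContinuousOnInterval V p q :=
  h.contDiff_one.contDiffOn.absolutelyContinuousOnInterval

/-- Two integrations by parts. -/
theorem integral_mul_deriv_deriv (h : IsRegular V V') {ψ : ℝ → ℂ} (hψ : ContDiff ℝ ∞ ψ)
    (p q : ℝ) :
    ∫ x in p..q, V x * deriv (deriv ψ) x = (V q * deriv ψ q - V' q * ψ q)
      - (V p * deriv ψ p - V' p * ψ p) + ∫ x in p..q, deriv V' x * ψ x := by
  have hψ' : ContDiff ℝ ∞ (deriv ψ) := (contDiff_infty_iff_deriv.1 hψ).2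
  have hd : deriv V = V' := funext fun x => (h.hasDerivAt x).deriv
  rw [(h.ac_self p q).integral_mul_deriv_eq_sub hψ', hd, (h.ac p q).integral_mul_deriv_eq_sub hψ]
  ring

end IsRegular

/-! ### Weak second derivatives on an interval -/

/-- Smooth real functions with compact support in `U`. -/
structure IsBump (U : Set ℝ) (g : ℝ → ℝ) : Prop where
  contDiff : ContDiff ℝ ∞ g
  compact : HasCompactSupport g
  subset : tsupport g ⊆ U

namespace IsBump

variable {U : Set ℝ} {g : ℝ → ℝ}

theorem deriv (hg : IsBump U g) : IsBump U (deriv g) :=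
  ⟨(contDiff_infty_iff_deriv.1 hg.contDiff).2, hg.compact.deriv,
    (tsupport_deriv_subset (𝕜 := ℝ)).trans hg.subset⟩

theorem integrable (hg : IsBump U g) : Integrable g :=
  hg.contDiff.continuous.integrable_of_hasCompactSupport hg.compact

theorem integrable_smul (hg : IsBump U g) {z : ℝ → ℂ} (hz : LocallyIntegrable z volume) :
    Integrable fun x => g x • z x :=
  hz.integrable_smul_left_of_hasCompactSupport hg.contDiff.continuous hg.compact

theorem sub_smul {h : ℝ → ℝ} (hg : IsBump U g) (hh : IsBump U h) (c : ℝ) :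
    IsBump U fun x => g x - c * h x := by
  have hsupp : tsupport (fun x => g x - c * h x) ⊆ tsupport g ∪ tsupport h := by
    refine closure_minimal (fun x hx => ?_) ((isClosed_tsupport g).union (isClosed_tsupport h))
    by_contra hx'
    rw [mem_union, not_or] at hx'
    exact hx (by simp [image_eq_zero_of_notMem_tsupport hx'.1,
      image_eq_zero_of_notMem_tsupport hx'.2])
  refine ⟨hg.contDiff.sub (contDiff_const.mul hh.contDiff), ?_,
    hsupp.trans (union_subset hg.subset hh.subset)⟩
  exact (hg.compact.isCompact.union hh.compact.isCompact).of_isClosed_subset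
    (isClosed_tsupport _) hsupp

theorem exists_integral_eq_one (hU : IsOpen U) (hne : U.Nonempty) :
    ∃ η, IsBump U η ∧ ∫ x, η x = 1 := by
  obtain ⟨c, hc⟩ := hne
  obtain ⟨r, hr, hball⟩ := Metric.isOpen_iff.1 hU c hc
  let f : ContDiffBump c := ⟨r / 4, r / 2, by positivity, by linarith⟩
  refine ⟨f.normed volume, ⟨f.contDiff_normed, f.hasCompactSupport_normed, ?_⟩, f.integral_normed⟩
  rw [f.tsupport_normed_eq]
  exact (Metric.closedBall_subset_ball (by simp only [f]; linarith)).trans hball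

/-- The primitive starts to the left of the support and vanishes again to its right because the
total integral is zero. Order-connectedness keeps the convex hull of the support inside U. -/
theorem exists_deriv_eq (hU : U.OrdConnected) (hg : IsBump U g) (h0 : ∫ x, g x = 0) :
    ∃ φ, IsBump U φ ∧ _root_.deriv φ = g := by
  rcases (tsupport g).eq_empty_or_nonempty with hemp | hne
  · have hg0 : g = 0 := tsupport_eq_empty_iff.1 hemp
    subst hg0
    refine ⟨0, hg, ?_⟩
    ext x
    simp
  have hcomp : IsCompact (tsupport g) := hg.compact
  set p := sInf (tsupport g)
  set q := sSup (tsupport g)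
  have hp : p ∈ tsupport g := hcomp.sInf_mem hne
  have hq : q ∈ tsupport g := hcomp.sSup_mem hne
  have hsub : tsupport g ⊆ Icc p q := fun x hx =>
    ⟨csInf_le hcomp.bddBelow hx, le_csSup hcomp.bddAbove hx⟩
  have hout : ∀ x, x ∉ Icc p q → g x = 0 := fun x hx =>
    image_eq_zero_of_notMem_tsupport fun h => hx (hsub h)
  have hcont := hg.contDiff.continuous
  have hder : ∀ x, HasDerivAt (fun x => ∫ y in (p - 1)..x, g y) (g x) x := fun x =>
    (hcont.integral_hasStrictDerivAt (p - 1) x).hasDerivAt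
  have hderiv : _root_.deriv (fun x => ∫ y in (p - 1)..x, g y) = g :=
    funext fun x => (hder x).deriv
  have hzero : ∀ x, x ∉ Icc p q → ∫ y in (p - 1)..x, g y = 0 := by
    intro x hx
    by_cases hxp : x < p
    · rw [intervalIntegral.integral_congr (g := fun _ => (0 : ℝ)), intervalIntegral.integral_zero]
      intro y hy
      refine hout y fun hy' => ?_
      have : y ≤ max (p - 1) x := hy.2
      have h2 : max (p - 1) x < p := max_lt (by linarith) hxp
      linarith [hy'.1]
    · have hqx : q < x := by
        by_contra h
        exact hx ⟨not_lt.1 hxp, not_lt.1 h⟩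
      rw [intervalIntegral.integral_eq_integral_of_support_subset, h0]
      intro y hy
      have := hsub (subset_tsupport g hy)
      exact ⟨by linarith [this.1], by linarith [this.2]⟩
  have hsupp : tsupport (fun x => ∫ y in (p - 1)..x, g y) ⊆ Icc p q :=
    closure_minimal (fun x hx => by
      by_contra h
      exact hx (hzero x h)) isClosed_Icc
  refine ⟨fun x => ∫ y in (p - 1)..x, g y, ⟨?_, ?_, ?_⟩, hderiv⟩
  · refine contDiff_infty_iff_deriv.2 ⟨fun x => (hder x).differentiableAt, ?_⟩
    rw [hderiv]
    exact hg.contDiff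
  · exact isCompact_Icc.of_isClosed_subset (isClosed_tsupport _) hsupp
  · exact hsupp.trans (hU.out (hg.subset hp) (hg.subset hq))

end IsBump

variable {U : Set ℝ}

/-- The lemma of du Bois-Reymond. -/
theorem ae_eq_const_of_integral_deriv_smul (hU : IsOpen U) (hconn : U.OrdConnected)
    (hne : U.Nonempty) {z : ℝ → ℂ} (hz : LocallyIntegrable z volume)
    (h : ∀ φ, IsBump U φ → ∫ x, deriv φ x • z x = 0) :
    ∃ c : ℂ, ∀ᵐ x : ℝ, x ∈ U → z x = c := by
  obtain ⟨η, hη, hη1⟩ := IsBump.exists_integral_eq_one hU hne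
  refine ⟨∫ x, η x • z x, ?_⟩
  set c := ∫ x, η x • z x
  have hzc : LocallyIntegrable (fun x => z x - c) volume := hz.sub (locallyIntegrable_const c)
  have := hU.ae_eq_zero_of_integral_contDiff_smul_eq_zero (hzc.locallyIntegrableOn U)
    (fun g hg1 hg2 hg3 => ?_)
  · filter_upwards [this] with x hx hxU
    exact sub_eq_zero.1 (hx hxU)
  have hg : IsBump U g := ⟨hg1, hg2, hg3⟩
  -- Removing the multiple of η with the same integral turns g into the derivative of a bump, to
  -- which the hypothesis applies.
  have hθ := hg.sub_smul hη (∫ x, g x)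
  have hθ0 : ∫ x, (g x - (∫ y, g y) * η x) = 0 := by
    rw [integral_sub hg.integrable (hη.integrable.const_mul _), integral_const_mul, hη1]
    ring
  obtain ⟨φ, hφ, hφd⟩ := hθ.exists_deriv_eq hconn hθ0
  have h1 := h φ hφ
  rw [hφd] at h1
  have h2 : ∀ x, (g x - (∫ y, g y) * η x) • z x = g x • z x - (∫ y, g y) • (η x • z x) := by
    intro x
    rw [_root_.sub_smul, mul_smul]
  simp_rw [h2] at h1
  rw [integral_sub (hg.integrable_smul hz) ((hη.integrable_smul hz).fun_smul _), integral_smul] at h1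
  simp_rw [smul_sub]
  rw [integral_sub (hg.integrable_smul hz) (hg.integrable.smul_const c), integral_smul_const]
  exact h1

theorem ae_eq_affine_of_integral_deriv_deriv_smul (hU : IsOpen U) (hconn : U.OrdConnected)
    (hne : U.Nonempty) {z : ℝ → ℂ} (hz : LocallyIntegrable z volume)
    (h : ∀ φ, IsBump U φ → ∫ x, deriv (deriv φ) x • z x = 0) :
    ∃ α β : ℂ, ∀ᵐ x : ℝ, x ∈ U → z x = α + x * β := by
  obtain ⟨η, hη, hη1⟩ := IsBump.exists_integral_eq_one hU hne
  -- This is minus the slope of z: tested with φ', the function z gives (∫ φ) c, because φ - (∫ φ) η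
  -- is a derivative, while x c gives -(∫ φ) c. Hence z + x c has vanishing weak derivative.
  set c := ∫ x, deriv η x • z x
  have hlin : LocallyIntegrable (fun x : ℝ => (x : ℂ) * c) volume :=
    (Continuous.mul Complex.continuous_ofReal continuous_const).locallyIntegrable
  have key : ∀ φ, IsBump U φ → ∫ x, deriv φ x • (z x + x * c) = 0 := by
    intro φ hφ
    have hθ := hφ.sub_smul hη (∫ x, φ x)
    have hθ0 : ∫ x, (φ x - (∫ y, φ y) * η x) = 0 := by
      rw [integral_sub hφ.integrable (hη.integrable.const_mul _), integral_const_mul, hη1]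
      ring
    obtain ⟨χ, hχ, hχd⟩ := hθ.exists_deriv_eq hconn hθ0
    have h1 := h χ hχ
    have hdφ := hφ.contDiff.differentiable (by simp)
    have hdη := hη.contDiff.differentiable (by simp)
    have h2 : ∀ x, deriv (deriv χ) x • z x = deriv φ x • z x - (∫ y, φ y) • (deriv η x • z x) := by
      intro x
      rw [hχd, ((hdφ x).hasDerivAt.fun_sub ((hdη x).hasDerivAt.const_mul _)).deriv,
        _root_.sub_smul, mul_smul]
    simp_rw [h2] at h1
    rw [integral_sub (hφ.deriv.integrable_smul hz) ((hη.deriv.integrable_smul hz).fun_smul _),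
      integral_smul, sub_eq_zero] at h1
    have h3 : ∫ x : ℝ, deriv φ x • ((x : ℂ) * c) = -((∫ y, φ y) • c) := by
      have h4 : ∫ x : ℝ, deriv φ x * x = -∫ x, φ x := by
        have hpart := integral_mul_deriv_eq_deriv_mul_of_integrable (u := fun x : ℝ => x) (v := φ)
          (u' := fun _ => 1) (v' := deriv φ) (fun x _ => hasDerivAt_id x)
          (fun x _ => (hdφ x).hasDerivAt)
          ((continuous_id.mul hφ.deriv.contDiff.continuous).integrable_of_hasCompactSupport
            hφ.deriv.compact.mul_left)
          ((continuous_const.mul hφ.contDiff.continuous).integrable_of_hasCompactSupport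
            hφ.compact.mul_left)
          ((continuous_id.mul hφ.contDiff.continuous).integrable_of_hasCompactSupport
            hφ.compact.mul_left)
        simpa [mul_comm] using hpart
      rw [← neg_smul, ← h4, ← integral_smul_const]
      refine integral_congr_ae (ae_of_all _ fun x => ?_)
      simp [mul_assoc]
    simp_rw [smul_add]
    rw [integral_add (hφ.deriv.integrable_smul hz) (hφ.deriv.integrable_smul hlin), h1, h3,
      add_neg_cancel]
  obtain ⟨α, hα⟩ := ae_eq_const_of_integral_deriv_smul hU hconn hne (hz.add hlin) key
  refine ⟨α, -c, ?_⟩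
  filter_upwards [hα] with x hx hxU
  have := hx hxU
  simp only [Pi.add_apply] at this
  rw [← this]
  ring

theorem IsBump.deriv_ofReal {g : ℝ → ℝ} (hg : IsBump U g) :
    _root_.deriv (fun x => (g x : ℂ)) = fun x => ((_root_.deriv g x : ℝ) : ℂ) :=
  funext fun x => ((hg.contDiff.differentiable (by simp) x).hasDerivAt.ofReal_comp).deriv

theorem IsBump.contDiff_ofReal {g : ℝ → ℝ} (hg : IsBump U g) :
    ContDiff ℝ ∞ fun x => (g x : ℂ) :=
  Complex.ofRealCLM.contDiff.comp hg.contDiff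

theorem IsRegular.integral_deriv_deriv_smul {V V' : ℝ → ℂ} (h : IsRegular V V') {φ : ℝ → ℝ}
    (hφ : IsBump U φ) : ∫ x, deriv (deriv φ) x • V x = ∫ x, φ x • deriv V' x := by
  have hdd : Function.support (deriv (deriv φ)) ⊆ tsupport φ :=
    (subset_tsupport _).trans ((tsupport_deriv_subset (𝕜 := ℝ)).trans
      (tsupport_deriv_subset (𝕜 := ℝ)))
  have hd : Function.support (deriv φ) ⊆ tsupport φ :=
    (subset_tsupport _).trans (tsupport_deriv_subset (𝕜 := ℝ))
  obtain ⟨R, hR⟩ := hφ.compact.isCompact.isBounded.subset_closedBall 0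
  have hsub : ∀ x, x ∈ tsupport φ → |x| ≤ R := fun x hx => by simpa using hR hx
  have hR1 : R < |R| + 1 := by linarith [le_abs_self R]
  have hpos : (0 : ℝ) ≤ |R| + 1 := by positivity
  set r := |R| + 1
  have hout : r ∉ tsupport φ ∧ -r ∉ tsupport φ := by
    constructor
    · intro h
      have := hsub _ h
      rw [abs_of_nonneg hpos] at this
      linarith
    · intro h
      have := hsub _ h
      rw [abs_neg, abs_of_nonneg hpos] at this
      linarith
  have hIoc : tsupport φ ⊆ Ioc (-r) r := fun x hx => by
    have := abs_le.1 (hsub x hx)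
    exact ⟨by linarith, by linarith⟩
  have hz : ∀ x, x ∉ tsupport φ → φ x = 0 ∧ deriv φ x = 0 := fun x hx =>
    ⟨image_eq_zero_of_notMem_tsupport hx, by
      by_contra h
      exact hx (hd h)⟩
  have hparts := h.integral_mul_deriv_deriv hφ.contDiff_ofReal (-r) r
  rw [hφ.deriv_ofReal, hφ.deriv.deriv_ofReal] at hparts
  beta_reduce at hparts
  rw [(hz _ hout.1).1, (hz _ hout.1).2, (hz _ hout.2).1, (hz _ hout.2).2] at hparts
  simp only [Complex.ofReal_zero, mul_zero, sub_zero, zero_add] at hparts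
  rw [← intervalIntegral.integral_eq_integral_of_support_subset (a := -r) (b := r),
    ← intervalIntegral.integral_eq_integral_of_support_subset (a := -r) (b := r)]
  · simpa [mul_comm] using hparts
  · refine (Function.support_smul_subset_left _ _).trans ((subset_tsupport φ).trans hIoc)
  · refine (Function.support_smul_subset_left _ _).trans (hdd.trans hIoc)

/-- A function with a locally integrable weak second derivative `w` on an interval has a regular
representative. -/
theorem exists_isRegular_of_weak (hU : IsOpen U) (hconn : U.OrdConnected)
    (hne : U.Nonempty) {v w : ℝ → ℂ} (hv : LocallyIntegrable v volume)
    (hw : LocallyIntegrable w volume)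
    (h : ∀ φ, IsBump U φ → ∫ x, deriv (deriv φ) x • v x = ∫ x, φ x • w x) :
    ∃ V V' : ℝ → ℂ, IsRegular V V' ∧ (∀ p x, V' x - V' p = ∫ y in p..x, w y) ∧
      (∀ᵐ x : ℝ, deriv V' x = w x) ∧ ∀ᵐ x : ℝ, x ∈ U → v x = V x := by
  have hint : ∀ p q, IntervalIntegrable w volume p q := fun p q =>
    (hw.integrableOn_isCompact isCompact_uIcc).intervalIntegrable
  set W : ℝ → ℂ := fun x => ∫ y in (0 : ℝ)..x, w y with hW
  have hWac : ∀ p q, AbsolutelyContinuousOnInterval W p q := by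
    intro p q
    refine ((hint (min (min p q) 0) (max (max p q) 0)
      ).absolutelyContinuousOnInterval_intervalIntegral_complex (c := 0) ?_).mono ?_
    · rw [mem_uIcc]
      simp
    · exact Icc_subset_Icc ((min_le_left _ _).trans (min_le_left _ _))
        ((le_max_left _ _).trans (le_max_right _ _))
  have hWc : Continuous W := intervalIntegral.continuous_primitive hint 0
  have hWd : ∀ᵐ x : ℝ, HasDerivAt W (w x) x := by
    have : ∀ᵐ x : ℝ, ∀ k : ℕ, x ∈ uIcc (-(k : ℝ)) k → ∀ c ∈ uIcc (-(k : ℝ)) k,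
        HasDerivAt (fun x => ∫ y in c..x, w y) (w x) x :=
      ae_all_iff.2 fun k => (hint (-(k : ℝ)) k).ae_hasDerivAt_integral
    filter_upwards [this] with x hx
    obtain ⟨k, hk⟩ := exists_nat_ge |x|
    have h0 : -(k : ℝ) ≤ k := by have := abs_nonneg x; linarith
    refine hx k ?_ 0 ?_
    · rw [uIcc_of_le h0]
      exact abs_le.1 hk
    · rw [uIcc_of_le h0]
      constructor <;> linarith
  -- The second primitive of w accounts for the weak second derivative, so v - W₂ has none and is
  -- affine.
  set W₂ : ℝ → ℂ := fun x => ∫ y in (0 : ℝ)..x, W y with hW₂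
  have hW₂d : ∀ x, HasDerivAt W₂ (W x) x := fun x =>
    (hWc.integral_hasStrictDerivAt 0 x).hasDerivAt
  have hreg : IsRegular W₂ W := ⟨hW₂d, hWac⟩
  have hz : LocallyIntegrable (fun x => v x - W₂ x) volume :=
    hv.sub hreg.continuous.locallyIntegrable
  have key : ∀ φ, IsBump U φ → ∫ x, deriv (deriv φ) x • (v x - W₂ x) = 0 := by
    intro φ hφ
    simp_rw [smul_sub]
    rw [integral_sub (hφ.deriv.deriv.integrable_smul hv)
      (hφ.deriv.deriv.integrable_smul hreg.continuous.locallyIntegrable), h φ hφ, sub_eq_zero]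
    rw [hreg.integral_deriv_deriv_smul hφ]
    refine integral_congr_ae ?_
    filter_upwards [hWd] with x hx
    rw [hx.deriv]
  obtain ⟨α, β, hαβ⟩ := ae_eq_affine_of_integral_deriv_deriv_smul hU hconn hne hz key
  refine ⟨fun x => W₂ x + (α + x * β), fun x => W x + β, ⟨fun x => ?_, fun p q => ?_⟩, ?_, ?_, ?_⟩
  · have h1 : HasDerivAt (fun x : ℝ => (x : ℂ) * β) (1 * β) x :=
      (Complex.ofRealCLM.hasDerivAt (x := x)).mul_const β
    rw [one_mul] at h1
    exact (hW₂d x).add (h1.const_add α)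
  · exact (hWac p q).add (LipschitzOnWith.absolutelyContinuousOnInterval
      (K := 0) (f := fun _ => β) (LipschitzWith.const β).lipschitzOnWith)
  · intro p x
    rw [add_sub_add_right_eq_sub, hW]
    exact intervalIntegral.integral_interval_sub_left (hint _ _) (hint _ _)
  · filter_upwards [hWd] with x hx
    exact (hx.add_const β).deriv
  · filter_upwards [hαβ] with x hx hxU
    rw [← hx hxU]
    ring

/-- The derivative of a regular function on an interval is bounded by the `L¹` norms of the
function and of its second derivative. -/
theorem IsRegular.norm_deriv_le {V V' w : ℝ → ℂ} (h : IsRegular V V')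
    (hw : LocallyIntegrable w volume) (hV' : ∀ p x, V' x - V' p = ∫ y in p..x, w y) {p q : ℝ}
    (hpq : p < q) {x : ℝ} (hx : x ∈ Icc p q) :
    ‖V' x‖ ≤ 6 / (q - p) ^ 2 * ((∫ y in p..q, ‖V y‖) + (q - p) ^ 2 * ∫ y in p..q, ‖w y‖)
      + ∫ y in p..q, ‖w y‖ := by
  have hint : ∀ p q, IntervalIntegrable w volume p q := fun p q =>
    (hw.integrableOn_isCompact isCompact_uIcc).intervalIntegrable
  set W := ∫ y in p..q, ‖w y‖
  set N := ∫ y in p..q, ‖V y‖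
  set ℓ := q - p with hℓ
  have hℓ0 : 0 < ℓ := sub_pos.2 hpq
  have hdiff : ∀ y ∈ Icc p q, ‖V' y - V' p‖ ≤ W := by
    intro y hy
    rw [hV' p y]
    refine (intervalIntegral.norm_integral_le_integral_norm hy.1).trans ?_
    exact intervalIntegral.integral_mono_interval le_rfl hy.1 hy.2
      (ae_of_all _ fun _ => norm_nonneg _) (hint p q).norm
  set m := V' p
  -- V stays within ℓ W of its tangent line at p, since its derivative varies by at most W.
  have hA : ∀ y ∈ Icc p q, ‖V y - (V p + m * (y - p))‖ ≤ ℓ * W := by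
    intro y hy
    have hder : ∀ z ∈ Icc p q, HasDerivWithinAt (fun y : ℝ => V y - (V p + m * (y - p)))
        (V' z - m) (Icc p q) z := by
      intro z _
      have h1 : HasDerivAt (fun y : ℝ => V p + m * ((y : ℂ) - p)) (m * 1) z :=
        (((Complex.ofRealCLM.hasDerivAt (x := z)).sub_const (p : ℂ)).const_mul m).const_add _
      rw [mul_one] at h1
      exact ((h.hasDerivAt z).sub h1).hasDerivWithinAt
    have := (convex_Icc p q).norm_image_sub_le_of_norm_hasDerivWithin_le hder hdiff
      (left_mem_Icc.2 hpq.le) hy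
    simp only [sub_self, mul_zero, add_zero, sub_zero] at this
    refine this.trans ?_
    rw [mul_comm, Real.norm_of_nonneg (sub_nonneg.2 hy.1)]
    have hW0 : 0 ≤ W := intervalIntegral.integral_nonneg hpq.le fun _ _ => norm_nonneg _
    gcongr
    linarith [hy.2]
  -- The weight is odd about the midpoint, so it kills constants and isolates the slope m. This
  -- bounds m by the L¹ norm of the tangent line.
  have hmom : ∫ y in p..q, ((y : ℂ) - p - ℓ / 2) * (V p + m * (y - p)) = m * ℓ ^ 3 / 12 := by
    have hder : ∀ y ∈ uIcc p q, HasDerivAt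
        (fun y : ℝ => V p * (((y : ℂ) - p) ^ 2 / 2 - ℓ / 2 * ((y : ℂ) - p))
          + m * (((y : ℂ) - p) ^ 3 / 3 - ℓ / 4 * ((y : ℂ) - p) ^ 2))
        (((y : ℂ) - p - ℓ / 2) * (V p + m * (y - p))) y := by
      intro y _
      have h1 : HasDerivAt (fun y : ℝ => (y : ℂ) - p) 1 y :=
        (Complex.ofRealCLM.hasDerivAt (x := y)).sub_const (p : ℂ)
      have h2 := ((((h1.pow 2).div_const 2).sub (h1.const_mul (ℓ / 2 : ℂ))).const_mul (V p)).add
        ((((h1.pow 3).div_const 3).sub ((h1.pow 2).const_mul (ℓ / 4 : ℂ))).const_mul m)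
      refine h2.congr_deriv ?_
      push_cast
      ring
    rw [intervalIntegral.integral_eq_sub_of_hasDerivAt hder
      (Continuous.intervalIntegrable (by fun_prop) _ _)]
    have : (q : ℂ) = p + ℓ := by rw [hℓ]; push_cast; ring
    rw [this]
    ring
  have hL1 : ∫ y in p..q, ‖V p + m * ((y : ℂ) - p)‖ ≤ N + ℓ ^ 2 * W := by
    have hmono : ∫ y in p..q, ‖V p + m * ((y : ℂ) - p)‖ ≤ ∫ y in p..q, (‖V y‖ + ℓ * W) := by
      refine intervalIntegral.integral_mono_on hpq.le
        (Continuous.intervalIntegrable (by fun_prop) _ _)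
        ((h.continuous.norm.add continuous_const).intervalIntegrable _ _) fun y hy => ?_
      have h1 := hA y hy
      have h2 : V p + m * ((y : ℂ) - p) = V y - (V y - (V p + m * ((y : ℂ) - p))) := by ring
      rw [h2]
      exact (norm_sub_le _ _).trans (add_le_add le_rfl h1)
    refine hmono.trans (le_of_eq ?_)
    rw [intervalIntegral.integral_add (h.continuous.norm.intervalIntegrable _ _)
      (continuous_const.intervalIntegrable _ _), intervalIntegral.integral_const, smul_eq_mul]
    ring
  have hm : ‖m‖ ≤ 6 / ℓ ^ 2 * (N + ℓ ^ 2 * W) := by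
    have h1 : ‖m * (ℓ : ℂ) ^ 3 / 12‖ ≤ ℓ / 2 * ∫ y in p..q, ‖V p + m * ((y : ℂ) - p)‖ := by
      rw [← hmom, ← intervalIntegral.integral_const_mul]
      refine (intervalIntegral.norm_integral_le_integral_norm hpq.le).trans ?_
      refine intervalIntegral.integral_mono_on hpq.le
        (Continuous.intervalIntegrable (by fun_prop) _ _)
        (Continuous.intervalIntegrable (by fun_prop) _ _) fun y hy => ?_
      rw [norm_mul]
      gcongr
      have : (y : ℂ) - p - ℓ / 2 = ((y - p - ℓ / 2 : ℝ) : ℂ) := by push_cast; ring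
      rw [this, Complex.norm_real, Real.norm_eq_abs, abs_le]
      constructor <;> linarith [hy.1, hy.2]
    have h2 : ‖m * (ℓ : ℂ) ^ 3 / 12‖ = ‖m‖ * ℓ ^ 3 / 12 := by
      rw [norm_div, norm_mul, norm_pow, Complex.norm_real, Real.norm_of_nonneg hℓ0.le]
      simp
    rw [h2] at h1
    have h3 : ‖m‖ * ℓ ^ 3 / 12 ≤ ℓ / 2 * (N + ℓ ^ 2 * W) :=
      h1.trans (by gcongr)
    rw [div_mul_eq_mul_div, le_div_iff₀ (by positivity)]
    have h4 : ℓ * (‖m‖ * ℓ ^ 2) ≤ ℓ * (6 * (N + ℓ ^ 2 * W)) := by nlinarith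
    exact le_of_mul_le_mul_left h4 hℓ0
  calc ‖V' x‖ = ‖m + (V' x - m)‖ := by rw [add_sub_cancel]
    _ ≤ ‖m‖ + ‖V' x - m‖ := norm_add_le _ _
    _ ≤ _ := add_le_add hm (hdiff x hx)

/-- Average over y in [p, q] the mean value bound ‖V x‖ ≤ ‖V y‖ + (q - p) B. -/
theorem IsRegular.norm_le {V V' : ℝ → ℂ} (h : IsRegular V V') {p q B : ℝ} (hpq : p < q)
    (hB : ∀ x ∈ Icc p q, ‖V' x‖ ≤ B) {x : ℝ} (hx : x ∈ Icc p q) :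
    ‖V x‖ ≤ (∫ y in p..q, ‖V y‖) / (q - p) + (q - p) * B := by
  have hℓ0 : 0 < q - p := sub_pos.2 hpq
  have hB0 : 0 ≤ B := (norm_nonneg _).trans (hB x hx)
  have hpt : ∀ y ∈ Icc p q, ‖V x‖ ≤ ‖V y‖ + (q - p) * B := by
    intro y hy
    have := (convex_Icc p q).norm_image_sub_le_of_norm_hasDerivWithin_le
      (fun z _ => (h.hasDerivAt z).hasDerivWithinAt) hB hy hx
    have h2 : ‖x - y‖ ≤ q - p := by
      rw [Real.norm_eq_abs, abs_le]
      constructor <;> linarith [hx.1, hx.2, hy.1, hy.2]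
    calc ‖V x‖ = ‖V y + (V x - V y)‖ := by rw [add_sub_cancel]
      _ ≤ ‖V y‖ + ‖V x - V y‖ := norm_add_le _ _
      _ ≤ ‖V y‖ + (q - p) * B := by
        gcongr
        refine this.trans ?_
        rw [mul_comm]
        gcongr
  have hmono : ∫ _ in p..q, ‖V x‖ ≤ ∫ y in p..q, (‖V y‖ + (q - p) * B) :=
    intervalIntegral.integral_mono_on hpq.le (continuous_const.intervalIntegrable _ _)
      ((h.continuous.norm.add continuous_const).intervalIntegrable _ _) hpt
  rw [intervalIntegral.integral_add (h.continuous.norm.intervalIntegrable _ _)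
    (continuous_const.intervalIntegrable _ _), intervalIntegral.integral_const,
    intervalIntegral.integral_const, smul_eq_mul, smul_eq_mul] at hmono
  rw [← sub_le_iff_le_add, le_div_iff₀ hℓ0]
  linarith

/-! ### The nonlinearity of a regular function -/

theorem continuous_fRegDeriv (n : ℕ) {ε : ℝ} (hε : 0 < ε) : Continuous (fRegDeriv n ε) := by
  have hε2 : 0 < ε ^ 2 := by positivity
  have h1 : Continuous fun ρ : ℝ => 1 / max ρ (ε ^ 2) :=
    continuous_const.div (continuous_id.max continuous_const)
      fun ρ => (hε2.trans_le (le_max_right _ _)).ne'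
  have h2 : Continuous (regBump n) := by unfold regBump; fun_prop
  unfold fRegDeriv
  fun_prop

/-- Only a qualitative tool, giving absolute continuity of f'(|V|²); the power ε⁻⁴ never enters an
error constant. The inner `max` extends f' from the half-line to all reals. -/
theorem lipschitzWith_fRegDeriv (n : ℕ) {ε : ℝ} (hε : 0 < ε) :
    LipschitzWith (Real.toNNReal ((1 + regBumpLip n) / ε ^ 4)) fun ρ => fRegDeriv n ε (max ρ 0) := by
  have hL := regBumpLip_nonneg n
  refine LipschitzWith.of_dist_le_mul fun ρ σ => ?_
  rw [Real.dist_eq, Real.dist_eq, Real.coe_toNNReal _ (by positivity)]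
  refine (abs_fRegDeriv_sub_le hε (le_max_right _ _) (le_max_right _ _)).trans ?_
  rw [div_mul_eq_mul_div, ← mul_div_assoc]
  have h1 : |max ρ 0 - max σ 0| ≤ |ρ - σ| := abs_max_sub_max_le_abs ρ σ 0
  have h2 : ε ^ 4 ≤ max (max ρ 0) (ε ^ 2) * max (max σ 0) (ε ^ 2) := by
    calc ε ^ 4 = ε ^ 2 * ε ^ 2 := by ring
      _ ≤ _ := by gcongr <;> exact le_max_right _ _
  exact div_le_div₀ (by positivity) (by gcongr) (by positivity) h2

/-- The chain rule may fail at the corner of f', so the derivative is bounded through the limit of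
its difference quotients. -/
theorem abs_le_of_hasDerivAt_fRegDeriv_comp {n : ℕ} {ε : ℝ} (hε : 0 < ε) {ρ : ℝ → ℝ}
    (hρ : ∀ x, 0 ≤ ρ x) {x ρ' c : ℝ} (h : HasDerivAt ρ ρ' x)
    (hc : HasDerivAt (fun x => fRegDeriv n ε (ρ x)) c x) :
    |c| ≤ (1 + regBumpLip n) * (|ρ'| / (max (ρ x) (ε ^ 2) * max (ρ x) (ε ^ 2))) := by
  have hε2 : 0 < ε ^ 2 := by positivity
  have hM : ∀ ρ, 0 < max ρ (ε ^ 2) := fun ρ => hε2.trans_le (le_max_right _ _)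
  have h1 := (hasDerivAt_iff_tendsto_slope.1 hc).abs
  have h2 := (hasDerivAt_iff_tendsto_slope.1 h).abs
  have h3 : Tendsto (fun y => max (ρ y) (ε ^ 2) * max (ρ x) (ε ^ 2)) (𝓝[≠] x)
      (𝓝 (max (ρ x) (ε ^ 2) * max (ρ x) (ε ^ 2))) := by
    have : Tendsto ρ (𝓝[≠] x) (𝓝 (ρ x)) := h.continuousAt.tendsto.mono_left nhdsWithin_le_nhds
    exact (this.max tendsto_const_nhds).mul tendsto_const_nhds
  have h4 := (h2.div h3 (mul_pos (hM _) (hM _)).ne').const_mul (1 + regBumpLip n)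
  refine le_of_tendsto_of_tendsto' h1 h4 fun y => ?_
  have h5 := abs_fRegDeriv_sub_le (n := n) hε (hρ y) (hρ x)
  simp only [slope_def_field, abs_div]
  have h6 : (1 + regBumpLip n) * (|ρ y - ρ x| / |y - x| / (max (ρ y) (ε ^ 2) * max (ρ x) (ε ^ 2)))
      = (1 + regBumpLip n) * (|ρ y - ρ x| / (max (ρ y) (ε ^ 2) * max (ρ x) (ε ^ 2))) / |y - x| := by
    ring
  change _ ≤ (1 + regBumpLip n) *
    (|ρ y - ρ x| / |y - x| / (max (ρ y) (ε ^ 2) * max (ρ x) (ε ^ 2)))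
  rw [h6]
  gcongr

/-- The derivative of the nonlinearity `V f(|V|²)` along a function `V` with derivative `V'`. -/
def nonlinDeriv (n : ℕ) (ε : ℝ) (V V' : ℝ → ℂ) (x : ℝ) : ℂ :=
  (fReg n ε (‖V x‖ ^ 2) : ℂ) * V' x
    + ((fRegDeriv n ε (‖V x‖ ^ 2) * (2 * inner ℝ (V x) (V' x)) : ℝ) : ℂ) * V x

variable {V V' : ℝ → ℂ}

theorem IsRegular.hasDerivAt_normSq (h : IsRegular V V') (x : ℝ) :
    HasDerivAt (fun x => ‖V x‖ ^ 2) (2 * inner ℝ (V x) (V' x)) x :=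
  (h.hasDerivAt x).norm_sq

theorem IsRegular.hasDerivAt_fReg (h : IsRegular V V') {n : ℕ} (hn : 2 ≤ n) {ε : ℝ} (hε : 0 < ε)
    (x : ℝ) : HasDerivAt (fun x => fReg n ε (‖V x‖ ^ 2))
      (fRegDeriv n ε (‖V x‖ ^ 2) * (2 * inner ℝ (V x) (V' x))) x :=
  (ERLog.hasDerivAt_fReg hn hε _).comp x (h.hasDerivAt_normSq x)

theorem IsRegular.ac_inner (h : IsRegular V V') (p q : ℝ) :
    AbsolutelyContinuousOnInterval (fun x => (inner ℝ (V x) (V' x) : ℝ)) p q := by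
  have h1 : AbsolutelyContinuousOnInterval (fun x => (starRingEnd ℂ) (V x)) p q :=
    (h.ac_self p q).lipschitzWith_comp (K := 1)
      (LipschitzWith.of_dist_le_mul fun x y => by simp [dist_eq_norm, ← map_sub])
  have h2 := ((h.ac p q).complex_mul h1).complex_re
  simpa only [Complex.inner] using h2

theorem IsRegular.ac_normSq (h : IsRegular V V') (p q : ℝ) :
    AbsolutelyContinuousOnInterval (fun x => ‖V x‖ ^ 2) p q :=
  ((h.contDiff_one.norm_sq ℝ).contDiffOn).absolutelyContinuousOnInterval

theorem IsRegular.ac_fRegDeriv (h : IsRegular V V') (n : ℕ) {ε : ℝ} (hε : 0 < ε) (p q : ℝ) :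
    AbsolutelyContinuousOnInterval (fun x => fRegDeriv n ε (‖V x‖ ^ 2)) p q := by
  have := (h.ac_normSq p q).lipschitzWith_comp (lipschitzWith_fRegDeriv n hε)
  simpa only [max_eq_left (sq_nonneg _)] using this

theorem IsRegular.ac_fReg (h : IsRegular V V') {n : ℕ} (hn : 2 ≤ n) {ε : ℝ} (hε : 0 < ε)
    (p q : ℝ) : AbsolutelyContinuousOnInterval (fun x => fReg n ε (‖V x‖ ^ 2)) p q := by
  refine ContDiffOn.absolutelyContinuousOnInterval (ContDiff.contDiffOn ?_)
  rw [contDiff_one_iff_deriv]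
  refine ⟨fun x => (h.hasDerivAt_fReg hn hε x).differentiableAt, ?_⟩
  rw [funext fun x => (h.hasDerivAt_fReg hn hε x).deriv]
  exact ((continuous_fRegDeriv n hε).comp (h.continuous.norm.pow 2)).mul
    (continuous_const.mul (h.continuous.inner h.continuous_deriv))

theorem IsRegular.nonlin (h : IsRegular V V') {n : ℕ} (hn : 2 ≤ n) {ε : ℝ} (hε : 0 < ε) :
    IsRegular (fun x => V x * (fReg n ε (‖V x‖ ^ 2) : ℂ)) (nonlinDeriv n ε V V') := by
  refine ⟨fun x => ?_, fun p q => ?_⟩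
  · refine ((h.hasDerivAt x).mul (h.hasDerivAt_fReg hn hε x).ofReal_comp).congr_deriv ?_
    unfold nonlinDeriv
    ring
  · exact ((h.ac_fReg hn hε p q).ofReal.complex_mul (h.ac p q)).fun_add
      ((((h.ac_fRegDeriv n hε p q).fun_mul
        ((h.ac_inner p q).const_mul 2)).ofReal).complex_mul (h.ac_self p q))

/-- The constant in the bound of the second derivative of the nonlinearity. -/
def curvConst (n : ℕ) : ℝ := 12 * n + 4 * (1 + regBumpLip n)

theorem curvConst_nonneg (n : ℕ) : 0 ≤ curvConst n := by
  have := regBumpLip_nonneg n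
  unfold curvConst
  positivity

theorem IsRegular.ae_norm_deriv_nonlinDeriv_le (h : IsRegular V V') {n : ℕ} (hn : 2 ≤ n) {ε : ℝ}
    (hε : 0 < ε) :
    ∀ᵐ x : ℝ, ‖deriv (nonlinDeriv n ε V V') x‖ ≤ curvConst n / ε * ‖V' x‖ ^ 2
      + (|fReg n ε (‖V x‖ ^ 2)| + 4 * n) * ‖deriv V' x‖ := by
  have hκ : ∀ᵐ x : ℝ, DifferentiableAt ℝ (fun x => fRegDeriv n ε (‖V x‖ ^ 2)) x := by
    have : ∀ᵐ x : ℝ, ∀ k : ℕ, x ∈ uIcc (-(k : ℝ)) k →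
        DifferentiableAt ℝ (fun x => fRegDeriv n ε (‖V x‖ ^ 2)) x :=
      ae_all_iff.2 fun k => (h.ac_fRegDeriv n hε _ _).ae_differentiableAt
    filter_upwards [this] with x hx
    obtain ⟨k, hk⟩ := exists_nat_ge |x|
    refine hx k ?_
    rw [uIcc_of_le (by have := abs_nonneg x; linarith)]
    exact abs_le.1 hk
  filter_upwards [hκ, h.ae_differentiableAt] with x hκx hVx
  set c := deriv (fun x => fRegDeriv n ε (‖V x‖ ^ 2)) x
  set d := deriv V' x
  have hc := hκx.hasDerivAt
  have hd := hVx.hasDerivAt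
  have hinner : HasDerivAt (fun x => (2 * inner ℝ (V x) (V' x) : ℝ))
      (2 * (inner ℝ (V x) d + inner ℝ (V' x) (V' x))) x :=
    ((h.hasDerivAt x).inner ℝ hd).const_mul 2
  have hder := ((h.hasDerivAt_fReg hn hε x).ofReal_comp.mul hd).add
    ((hc.mul hinner).ofReal_comp.mul (h.hasDerivAt x))
  have hderiv : deriv (nonlinDeriv n ε V V') x = _ := hder.deriv
  rw [hderiv]
  set ρ := ‖V x‖ ^ 2 with hρ
  set κ := fRegDeriv n ε ρ
  set i₁ : ℝ := inner ℝ (V x) (V' x)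
  set i₂ : ℝ := inner ℝ (V x) d
  have hi₁ : |i₁| ≤ ‖V x‖ * ‖V' x‖ := abs_real_inner_le_norm _ _
  have hi₂ : |i₂| ≤ ‖V x‖ * ‖d‖ := abs_real_inner_le_norm _ _
  have hi₃ : (inner ℝ (V' x) (V' x) : ℝ) = ‖V' x‖ ^ 2 := real_inner_self_eq_norm_sq _
  have hcb : |c| ≤ (1 + regBumpLip n) * (|2 * i₁| / (max ρ (ε ^ 2) * max ρ (ε ^ 2))) :=
    abs_le_of_hasDerivAt_fRegDeriv_comp (ρ := fun x => ‖V x‖ ^ 2) hε (fun x => sq_nonneg _)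
      (h.hasDerivAt_normSq x) hc
  have hρ0 : 0 ≤ ρ := sq_nonneg _
  have hκ0 : 0 ≤ κ := fRegDeriv_nonneg n ε hρ0
  have hκ1 : κ ≤ 2 * n / max ρ (ε ^ 2) := fRegDeriv_le hn hε hρ0
  have hL := regBumpLip_nonneg n
  have hM : 0 < max ρ (ε ^ 2) := lt_of_lt_of_le (by positivity) (le_max_right _ _)
  have hMρ : ‖V x‖ ^ 2 ≤ max ρ (ε ^ 2) := le_max_left _ _
  -- Together with |V|² ≤ max ρ ε², this lets every denominator max ρ ε² be absorbed at the cost of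
  -- at most one factor 1/ε in total. It follows from 2|V|ε ≤ |V|² + ε².
  have hMε : ‖V x‖ * ε ≤ max ρ (ε ^ 2) := by
    have := le_max_right ρ (ε ^ 2)
    nlinarith [sq_nonneg (‖V x‖ - ε)]
  set M := max ρ (ε ^ 2)
  have hr0 : 0 ≤ ‖V x‖ := norm_nonneg _
  have hκr : κ * ‖V x‖ ≤ 2 * n / ε := by
    calc κ * ‖V x‖ ≤ 2 * n / M * ‖V x‖ := by gcongr
      _ = 2 * n / ε * (‖V x‖ * ε / M) := by field_simp
      _ ≤ 2 * n / ε * 1 := by gcongr; exact (div_le_one hM).2 hMε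
      _ = 2 * n / ε := mul_one _
  have hκr2 : κ * ‖V x‖ ^ 2 ≤ 2 * n := by
    calc κ * ‖V x‖ ^ 2 ≤ 2 * n / M * ‖V x‖ ^ 2 := by gcongr
      _ = 2 * n * (‖V x‖ ^ 2 / M) := by ring
      _ ≤ 2 * n * 1 := by gcongr; exact (div_le_one hM).2 hMρ
      _ = 2 * n := mul_one _
  -- The term with the derivative of f'. It has size |V|³|V'|²/M², which splits into the factors
  -- |V|²/M ≤ 1 and |V|ε/M ≤ 1 with |V'|²/ε left over.
  have hcr : |c| * |2 * i₁| * ‖V x‖ ≤ 4 * (1 + regBumpLip n) / ε * ‖V' x‖ ^ 2 := by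
    have h2i : |2 * i₁| ≤ 2 * (‖V x‖ * ‖V' x‖) := by
      rw [abs_mul, abs_two]
      gcongr
    calc |c| * |2 * i₁| * ‖V x‖
        ≤ (1 + regBumpLip n) * (|2 * i₁| / (M * M)) * |2 * i₁| * ‖V x‖ := by gcongr
      _ ≤ (1 + regBumpLip n) * (2 * (‖V x‖ * ‖V' x‖) / (M * M)) * (2 * (‖V x‖ * ‖V' x‖)) * ‖V x‖ := by
          gcongr
      _ = 4 * (1 + regBumpLip n) / ε * ‖V' x‖ ^ 2 * (‖V x‖ ^ 2 / M) * (‖V x‖ * ε / M) := by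
          field_simp
          ring
      _ ≤ 4 * (1 + regBumpLip n) / ε * ‖V' x‖ ^ 2 * 1 * 1 := by
          gcongr
          · exact (div_le_one hM).2 hMρ
          · exact (div_le_one hM).2 hMε
      _ = _ := by ring
  have hA : ‖((κ * (2 * i₁) : ℝ) : ℂ) * V' x‖ ≤ 4 * n / ε * ‖V' x‖ ^ 2 := by
    rw [norm_mul, Complex.norm_real, Real.norm_eq_abs, abs_mul, abs_of_nonneg hκ0, abs_mul,
      abs_two]
    calc κ * (2 * |i₁|) * ‖V' x‖ ≤ κ * (2 * (‖V x‖ * ‖V' x‖)) * ‖V' x‖ := by gcongr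
      _ = 2 * (κ * ‖V x‖) * ‖V' x‖ ^ 2 := by ring
      _ ≤ 2 * (2 * n / ε) * ‖V' x‖ ^ 2 := by gcongr
      _ = _ := by ring
  have hB : ‖((c * (2 * i₁) + κ * (2 * (i₂ + inner ℝ (V' x) (V' x))) : ℝ) : ℂ) * V x‖
      ≤ 4 * (1 + regBumpLip n) / ε * ‖V' x‖ ^ 2 + (4 * n / ε * ‖V' x‖ ^ 2 + 4 * n * ‖d‖) := by
    rw [norm_mul, Complex.norm_real, Real.norm_eq_abs, hi₃]
    have h1 : |c * (2 * i₁) + κ * (2 * (i₂ + ‖V' x‖ ^ 2))|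
        ≤ |c| * |2 * i₁| + κ * (2 * (‖V x‖ * ‖d‖ + ‖V' x‖ ^ 2)) := by
      refine (abs_add_le _ _).trans (add_le_add (abs_mul _ _).le ?_)
      rw [abs_mul, abs_of_nonneg hκ0, abs_mul, abs_two]
      gcongr
      refine (abs_add_le _ _).trans (add_le_add hi₂ ?_)
      rw [abs_of_nonneg (sq_nonneg _)]
    calc _ ≤ (|c| * |2 * i₁| + κ * (2 * (‖V x‖ * ‖d‖ + ‖V' x‖ ^ 2))) * ‖V x‖ := by gcongr
      _ = |c| * |2 * i₁| * ‖V x‖ + (2 * (κ * ‖V x‖) * ‖V' x‖ ^ 2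
          + 2 * (κ * ‖V x‖ ^ 2) * ‖d‖) := by ring
      _ ≤ 4 * (1 + regBumpLip n) / ε * ‖V' x‖ ^ 2 + (2 * (2 * n / ε) * ‖V' x‖ ^ 2
          + 2 * (2 * n) * ‖d‖) := by gcongr
      _ = _ := by ring
  have hC : ‖(fReg n ε ρ : ℂ) * d‖ = |fReg n ε ρ| * ‖d‖ := by
    rw [norm_mul, Complex.norm_real, Real.norm_eq_abs]
  refine (norm_add_le _ _).trans ((add_le_add (norm_add_le _ _) (norm_add_le _ _)).trans ?_)
  have htot : curvConst n / ε * ‖V' x‖ ^ 2 = 4 * n / ε * ‖V' x‖ ^ 2 + 4 * n / ε * ‖V' x‖ ^ 2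
      + (4 * (1 + regBumpLip n) / ε * ‖V' x‖ ^ 2 + 4 * n / ε * ‖V' x‖ ^ 2) := by
    unfold curvConst
    ring
  change ‖((κ * (2 * i₁) : ℝ) : ℂ) * V' x‖ + ‖(fReg n ε ρ : ℂ) * d‖ +
    (‖((c * (2 * i₁) + κ * (2 * (i₂ + inner ℝ (V' x) (V' x))) : ℝ) : ℂ) * V x‖
      + ‖((κ * (2 * i₁) : ℝ) : ℂ) * V' x‖) ≤ _
  linarith

/-! ### The group generated by a diagonal operator -/

section Modes

variable {H : Type*} [NormedAddCommGroup H] [InnerProductSpace ℂ H] [CompleteSpace H]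
  {ι : Type*} {e : ι → H}

set_option linter.unusedSectionVars false

/-- The phase `e^{-itl}`. -/
def modePhase (t l : ℝ) : ℂ := Complex.exp (-Complex.I * ((t * l : ℝ) : ℂ))

theorem norm_modePhase (t l : ℝ) : ‖modePhase t l‖ = 1 := by
  have : -Complex.I * ((t * l : ℝ) : ℂ) = Complex.I * ((-(t * l) : ℝ) : ℂ) := by push_cast; ring
  rw [modePhase, this, Complex.norm_exp_I_mul_ofReal]

theorem modePhase_ne_zero (t l : ℝ) : modePhase t l ≠ 0 := Complex.exp_ne_zero _

theorem modePhase_add (s t l : ℝ) : modePhase (s + t) l = modePhase s l * modePhase t l := by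
  rw [modePhase, modePhase, modePhase, ← Complex.exp_add]
  congr 1
  push_cast
  ring

theorem hasDerivAt_modePhase (l : ℝ) :
    HasDerivAt (fun t => modePhase t l) (-Complex.I * l) 0 := by
  have h1 : HasDerivAt (fun t : ℝ => -Complex.I * ((t * l : ℝ) : ℂ)) (-Complex.I * l) 0 := by
    have := ((hasDerivAt_id (0 : ℝ)).mul_const l).ofReal_comp.const_mul (-Complex.I)
    simpa using this
  have h2 := h1.cexp
  simpa [modePhase] using h2

theorem orthonormal_modePhase_smul (ho : Orthonormal ℂ e) (l : ι → ℝ) (t : ℝ) :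
    Orthonormal ℂ fun k => modePhase t (l k) • e k := by
  refine ⟨fun k => ?_, fun j k hjk => ?_⟩
  · rw [norm_smul, norm_modePhase, ho.1 k, one_mul]
  · change inner ℂ (modePhase t (l j) • e j) (modePhase t (l k) • e k) = 0
    rw [inner_smul_left, inner_smul_right, ho.2 hjk, mul_zero, mul_zero]

theorem span_modePhase_smul_orthogonal (ht : ∀ v, (∀ k, inner ℂ (e k) v = 0) → v = 0)
    (l : ι → ℝ) (t : ℝ) :
    (Submodule.span ℂ (range fun k => modePhase t (l k) • e k))ᗮ = ⊥ := by
  rw [Submodule.eq_bot_iff]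
  intro v hv
  refine ht v fun k => ?_
  have := (Submodule.mem_orthogonal _ _).1 hv _ (Submodule.subset_span (mem_range_self k))
  rw [inner_smul_left] at this
  exact (mul_eq_zero.1 this).resolve_left
    ((map_ne_zero _).2 (modePhase_ne_zero _ _))

/-- The orthonormal basis `e^{-itλ_k} e_k`. -/
def modeBasis (ho : Orthonormal ℂ e) (ht : ∀ v, (∀ k, inner ℂ (e k) v = 0) → v = 0)
    (l : ι → ℝ) (t : ℝ) : HilbertBasis ι ℂ H :=
  HilbertBasis.mkOfOrthogonalEqBot (orthonormal_modePhase_smul ho l t)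
    (span_modePhase_smul_orthogonal ht l t)

variable (ho : Orthonormal ℂ e) (ht : ∀ v, (∀ k, inner ℂ (e k) v = 0) → v = 0) (l : ι → ℝ)

theorem modeBasis_apply (t : ℝ) (k : ι) :
    modeBasis ho ht l t k = modePhase t (l k) • e k := by
  rw [modeBasis, HilbertBasis.coe_mkOfOrthogonalEqBot]

/-- The isometry that multiplies the `k`-th coefficient by `e^{-itλ_k}`. -/
def modeMap (t : ℝ) : H →ₗᵢ[ℂ] H :=
  -- The coordinates of a vector in the basis at time 0 are reread in the basis at time t, so
  -- isometry comes for free.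
  ((modeBasis ho ht l 0).repr.trans (modeBasis ho ht l t).repr.symm).toLinearIsometry

theorem inner_modeMap (t : ℝ) (v : H) (k : ι) :
    inner ℂ (e k) (modeMap ho ht l t v) = modePhase t (l k) * inner ℂ (e k) v := by
  have h1 : (modeBasis ho ht l t).repr (modeMap ho ht l t v) k
      = (modeBasis ho ht l 0).repr v k := by
    simp [modeMap]
  rw [HilbertBasis.repr_apply_apply, HilbertBasis.repr_apply_apply, modeBasis_apply,
    modeBasis_apply, inner_smul_left, inner_smul_left] at h1
  have h0 : modePhase 0 (l k) = 1 := by simp [modePhase]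
  rw [h0, map_one, one_mul] at h1
  rw [← h1, ← mul_assoc, Complex.mul_conj, Complex.normSq_eq_norm_sq, norm_modePhase]
  simp

theorem modeMap_ext {v w : H} (ht : ∀ v, (∀ k, inner ℂ (e k) v = 0) → v = 0)
    (h : ∀ k, inner ℂ (e k) v = inner ℂ (e k) w) : v = w := by
  rw [← sub_eq_zero]
  refine ht _ fun k => ?_
  rw [inner_sub_right, h k, sub_self]

theorem modeMap_mode (t : ℝ) (k : ι) : modeMap ho ht l t (e k) = modePhase t (l k) • e k := by
  classical
  refine modeMap_ext ht fun j => ?_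
  rw [inner_modeMap, inner_smul_right]
  rcases eq_or_ne j k with rfl | h
  · rfl
  · rw [ho.2 h, mul_zero, mul_zero]

theorem modeMap_eq_tsum (t : ℝ) (v : H) :
    modeMap ho ht l t v = ∑' k, (modePhase t (l k) * inner ℂ (e k) v) • e k := by
  have h := (modeBasis ho ht l 0).hasSum_repr (modeMap ho ht l t v)
  rw [← h.tsum_eq]
  refine tsum_congr fun k => ?_
  have h0 : modePhase 0 (l k) = 1 := by simp [modePhase]
  rw [HilbertBasis.repr_apply_apply, modeBasis_apply, h0, one_smul, inner_modeMap]

/-- The unitary group `e^{itA}` with `A e_k = -λ_k e_k`. -/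
def modeFlow : UnitaryFlow H where
  S := modeMap ho ht l
  map_zero v := modeMap_ext ht fun k => by
    rw [inner_modeMap]
    simp [modePhase]
  map_add s t v := modeMap_ext ht fun k => by
    rw [inner_modeMap, inner_modeMap, inner_modeMap, modePhase_add, mul_assoc]
  core := range fun k => (e k, -(l k : ℂ) • e k)
  core_hasDerivAt := by
    rintro _ ⟨k, rfl⟩
    simp only [modeMap_mode]
    refine ((hasDerivAt_modePhase (l k)).smul_const (e k)).congr_deriv ?_
    rw [smul_smul]
    congr 1
    ring
  core_map := by
    rintro _ ⟨k, rfl⟩ t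
    have : (modeMap ho ht l t (e k), modeMap ho ht l t (-(l k : ℂ) • e k))
        = modePhase t (l k) • (e k, -(l k : ℂ) • e k) := by
      rw [map_smul, modeMap_mode, Prod.smul_mk, smul_comm]
    rw [this]
    exact Submodule.smul_mem _ _ (Submodule.subset_span (mem_range_self k))
  core_dense := by
    have h := span_modePhase_smul_orthogonal (e := e) ht l 0
    have h0 : ∀ k, modePhase 0 (l k) = 1 := fun k => by simp [modePhase]
    simp only [h0, one_smul] at h
    rw [← Submodule.topologicalClosure_eq_top_iff] at h
    have hd : Dense (Submodule.span ℂ (range e) : Set H) := by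
      rw [← Submodule.dense_iff_topologicalClosure_eq_top] at h
      exact h
    refine hd.mono fun v hv => ?_
    have : Submodule.span ℂ (range e) ≤ (Submodule.span ℂ
        (range fun k => (e k, -(l k : ℂ) • e k))).map (LinearMap.fst ℂ H H) := by
      rw [Submodule.map_span]
      refine Submodule.span_mono ?_
      rintro _ ⟨k, rfl⟩
      exact ⟨_, mem_range_self k, rfl⟩
    obtain ⟨p, hp, rfl⟩ := this hv
    exact ⟨p, hp, rfl⟩

end Modes

/-! ### The free group on the line -/

section Line

open scoped SchwartzMap FourierTransform LineDeriv

theorem coeFn_phaseMul {μ : Measure ℝ} (θ : ℝ → ℝ) (hθ : AEStronglyMeasurable θ μ)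
    (w : Lp ℂ 2 μ) :
    phaseMul θ hθ w =ᵐ[μ] fun x => w x * Complex.exp (Complex.I * (θ x : ℂ)) :=
  MemLp.coeFn_toLp _

theorem norm_phaseMul {μ : Measure ℝ} (θ : ℝ → ℝ) (hθ : AEStronglyMeasurable θ μ)
    (w : Lp ℂ 2 μ) : ‖phaseMul θ hθ w‖ = ‖w‖ := by
  rw [Lp.norm_def, Lp.norm_def]
  congr 1
  refine eLpNorm_congr_norm_ae ?_
  filter_upwards [coeFn_phaseMul θ hθ w] with x hx
  rw [hx, norm_mul, Complex.norm_exp_I_mul_ofReal, mul_one]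

/-- Multiplication by `e^{iθ}` as a linear isometry. -/
def phaseMulLI {μ : Measure ℝ} (θ : ℝ → ℝ) (hθ : AEStronglyMeasurable θ μ) :
    Lp ℂ 2 μ →ₗᵢ[ℂ] Lp ℂ 2 μ where
  toFun := phaseMul θ hθ
  map_add' v w := by
    refine Lp.ext ?_
    filter_upwards [coeFn_phaseMul θ hθ (v + w), coeFn_phaseMul θ hθ v, coeFn_phaseMul θ hθ w,
      Lp.coeFn_add v w, Lp.coeFn_add (phaseMul θ hθ v) (phaseMul θ hθ w)] with x h1 h2 h3 h4 h5
    rw [h1, h5, Pi.add_apply, h2, h3, h4, Pi.add_apply, add_mul]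
  map_smul' c v := by
    refine Lp.ext ?_
    filter_upwards [coeFn_phaseMul θ hθ (c • v), coeFn_phaseMul θ hθ v,
      Lp.coeFn_smul c v, Lp.coeFn_smul c (phaseMul θ hθ v)] with x h1 h2 h3 h4
    simp only [RingHom.id_apply]
    rw [h1, h4, Pi.smul_apply, h2, h3, Pi.smul_apply, smul_eq_mul, smul_eq_mul, mul_assoc]
  norm_map' := norm_phaseMul θ hθ

/-- The symbol of the free Schrödinger group on the line. -/
def lineSymbol (t ξ : ℝ) : ℝ := -(t * (2 * Real.pi * ξ) ^ 2)

theorem aestronglyMeasurable_lineSymbol (t : ℝ) :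
    AEStronglyMeasurable (lineSymbol t) (volume : Measure ℝ) :=
  Continuous.aestronglyMeasurable (by unfold lineSymbol; fun_prop)

/-- The free Schrödinger group on the line as a family of linear isometries. -/
def lineMap (t : ℝ) : Lp ℂ 2 (volume : Measure ℝ) →ₗᵢ[ℂ] Lp ℂ 2 (volume : Measure ℝ) :=
  ((Lp.fourierTransformₗᵢ ℝ ℂ).symm.toLinearIsometry.comp
    (phaseMulLI (lineSymbol t) (aestronglyMeasurable_lineSymbol t))).comp
      (Lp.fourierTransformₗᵢ ℝ ℂ).toLinearIsometry

theorem lineMap_apply (t : ℝ) (v : Lp ℂ 2 (volume : Measure ℝ)) :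
    lineMap t v = (Lp.fourierTransformₗᵢ ℝ ℂ).symm
      (phaseMul (lineSymbol t) (aestronglyMeasurable_lineSymbol t)
        (Lp.fourierTransformₗᵢ ℝ ℂ v)) := rfl

theorem phaseMul_lineSymbol_add (s t : ℝ) (v : Lp ℂ 2 (volume : Measure ℝ)) :
    phaseMul (lineSymbol (s + t)) (aestronglyMeasurable_lineSymbol (s + t)) v
      = phaseMul (lineSymbol s) (aestronglyMeasurable_lineSymbol s)
        (phaseMul (lineSymbol t) (aestronglyMeasurable_lineSymbol t) v) := by
  refine Lp.ext ?_
  filter_upwards [coeFn_phaseMul _ (aestronglyMeasurable_lineSymbol (s + t)) v,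
    coeFn_phaseMul _ (aestronglyMeasurable_lineSymbol t) v,
    coeFn_phaseMul _ (aestronglyMeasurable_lineSymbol s)
      (phaseMul (lineSymbol t) (aestronglyMeasurable_lineSymbol t) v)] with x h1 h2 h3
  rw [h1, h3, h2, mul_assoc, ← Complex.exp_add]
  congr 2
  unfold lineSymbol
  push_cast
  ring

/-- All derivatives have modulus one. Composed with the quadratic symbol, this makes the free group
a multiplier on Schwartz space. -/
theorem hasTemperateGrowth_exp_I_mul :
    Function.HasTemperateGrowth fun x : ℝ => Complex.exp (Complex.I * x) := by
  have hc : ContDiff ℝ ∞ fun x : ℝ => Complex.exp (Complex.I * x) :=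
    Complex.contDiff_exp.comp (contDiff_const.mul Complex.ofRealCLM.contDiff)
  have hiter : ∀ n : ℕ, iteratedDeriv n (fun x : ℝ => Complex.exp (Complex.I * x))
      = fun x : ℝ => Complex.I ^ n * Complex.exp (Complex.I * x) := by
    intro n
    induction n with
    | zero => ext x; simp
    | succ n ih =>
      rw [iteratedDeriv_succ, ih]
      ext x
      have h1 : HasDerivAt (fun x : ℝ => Complex.I * (x : ℂ)) Complex.I x := by
        simpa using (Complex.ofRealCLM.hasDerivAt (x := x)).const_mul Complex.I
      rw [(h1.cexp.const_mul (Complex.I ^ n)).deriv]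
      ring
  refine ⟨hc, fun n => ⟨0, 1, fun x => ?_⟩⟩
  rw [norm_iteratedFDeriv_eq_norm_iteratedDeriv, hiter, norm_mul, norm_pow, Complex.norm_I,
    Complex.norm_exp_I_mul_ofReal]
  simp

theorem hasTemperateGrowth_lineSymbol (t : ℝ) :
    Function.HasTemperateGrowth fun ξ : ℝ => Complex.exp (Complex.I * (lineSymbol t ξ : ℂ)) := by
  have h : Function.HasTemperateGrowth (lineSymbol t) := by unfold lineSymbol; fun_prop
  exact hasTemperateGrowth_exp_I_mul.comp h

/-- This identifies the L² group with a Fourier multiplier on Schwartz functions, which shows that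
the core is invariant. -/
theorem lineMap_toLp (t : ℝ) (φ : 𝓢(ℝ, ℂ)) :
    lineMap t (φ.toLp 2) = (SchwartzMap.fourierMultiplierCLM ℂ
      (fun ξ : ℝ => Complex.exp (Complex.I * (lineSymbol t ξ : ℂ))) φ).toLp 2 := by
  rw [SchwartzMap.fourierMultiplierCLM_apply, lineMap_apply]
  rw [← SchwartzMap.toLp_fourierInv_eq]
  change (Lp.fourierTransformₗᵢ ℝ ℂ).symm _ = (Lp.fourierTransformₗᵢ ℝ ℂ).symm _
  congr 1
  have hF : Lp.fourierTransformₗᵢ ℝ ℂ (φ.toLp 2) = (𝓕 φ).toLp 2 := SchwartzMap.toLp_fourier_eq φ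
  rw [hF]
  refine Lp.ext ?_
  filter_upwards [coeFn_phaseMul _ (aestronglyMeasurable_lineSymbol t) ((𝓕 φ).toLp 2),
    (𝓕 φ).coeFn_toLp 2 volume, (SchwartzMap.smulLeftCLM ℂ
      (fun ξ : ℝ => Complex.exp (Complex.I * (lineSymbol t ξ : ℂ))) (𝓕 φ)).coeFn_toLp 2 volume]
    with x h1 h2 h3
  rw [h1, h2, h3, SchwartzMap.smulLeftCLM_apply_apply (hasTemperateGrowth_lineSymbol t),
    smul_eq_mul, mul_comm]

theorem derivCLM_eq_multiplier (φ : 𝓢(ℝ, ℂ)) : SchwartzMap.derivCLM ℂ ℂ φ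
    = (2 * Real.pi * Complex.I) • SchwartzMap.fourierMultiplierCLM ℂ (fun ξ : ℝ => (ξ : ℂ)) φ := by
  have h := SchwartzMap.lineDeriv_eq_fourierMultiplierCLM (F := ℂ) (1 : ℝ) φ
  have h1 : ∂_{(1 : ℝ)} φ = SchwartzMap.derivCLM ℂ ℂ φ := by
    ext x
    rw [SchwartzMap.lineDerivOp_apply_eq_fderiv, SchwartzMap.derivCLM_apply,
      fderiv_apply_one_eq_deriv]
  rw [← h1, h]
  congr 1
  have h2 : (fun ξ : ℝ => (inner ℝ ξ (1 : ℝ) : ℝ)) = fun ξ => ξ := by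
    ext ξ
    simp
  rw [h2]
  exact (SchwartzMap.fourierMultiplierCLM_ofReal ℂ (g := fun ξ : ℝ => ξ) (by fun_prop) φ).symm

/-- The second derivative of a Schwartz function. -/
def schwartzD2 (φ : 𝓢(ℝ, ℂ)) : 𝓢(ℝ, ℂ) := SchwartzMap.derivCLM ℂ ℂ (SchwartzMap.derivCLM ℂ ℂ φ)

theorem fourier_schwartzD2 (φ : 𝓢(ℝ, ℂ)) (ξ : ℝ) :
    (𝓕 (schwartzD2 φ)) ξ = -(((2 * Real.pi * ξ) ^ 2 : ℝ) : ℂ) * (𝓕 φ) ξ := by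
  have hg : Function.HasTemperateGrowth fun ξ : ℝ => (ξ : ℂ) := by fun_prop
  have h1 : ∀ φ : 𝓢(ℝ, ℂ), (𝓕 (SchwartzMap.derivCLM ℂ ℂ φ)) ξ
      = 2 * Real.pi * Complex.I * (ξ * (𝓕 φ) ξ) := by
    intro φ
    rw [derivCLM_eq_multiplier, SchwartzMap.fourierMultiplierCLM_apply,
      FourierTransform.fourier_smul, FourierTransform.fourier_fourierInv_eq,
      smul_apply, SchwartzMap.smulLeftCLM_apply_apply hg, smul_eq_mul, smul_eq_mul]
  rw [schwartzD2, h1, h1]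
  push_cast
  ring_nf
  rw [Complex.I_sq]
  ring

theorem fourierMultiplier_schwartzD2 {g : ℝ → ℂ} (hg : g.HasTemperateGrowth) (φ : 𝓢(ℝ, ℂ)) :
    SchwartzMap.fourierMultiplierCLM ℂ g (schwartzD2 φ)
      = schwartzD2 (SchwartzMap.fourierMultiplierCLM ℂ g φ) := by
  have hξ : Function.HasTemperateGrowth fun ξ : ℝ => (ξ : ℂ) := by fun_prop
  have h1 : ∀ φ : 𝓢(ℝ, ℂ), SchwartzMap.fourierMultiplierCLM ℂ g (SchwartzMap.derivCLM ℂ ℂ φ)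
      = SchwartzMap.derivCLM ℂ ℂ (SchwartzMap.fourierMultiplierCLM ℂ g φ) := by
    intro φ
    rw [derivCLM_eq_multiplier, derivCLM_eq_multiplier, map_smul,
      SchwartzMap.fourierMultiplierCLM_fourierMultiplierCLM_apply hg hξ,
      SchwartzMap.fourierMultiplierCLM_fourierMultiplierCLM_apply hξ hg, mul_comm g]
  rw [schwartzD2, schwartzD2, h1, h1]

theorem hasDerivAt_of_norm_sub_le_sq {E : Type*} [NormedAddCommGroup E] [NormedSpace ℝ E]
    {f : ℝ → E} {f' : E} {C : ℝ} (h : ∀ t, ‖f t - f 0 - t • f'‖ ≤ C * t ^ 2) :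
    HasDerivAt f f' 0 := by
  rw [hasDerivAt_iff_isLittleO]
  have h1 : (fun t : ℝ => f t - f 0 - (t - 0) • f') =O[𝓝 0] fun t : ℝ => t ^ 2 := by
    refine Asymptotics.IsBigO.of_bound C (Eventually.of_forall fun t => ?_)
    rw [sub_zero, Real.norm_of_nonneg (sq_nonneg t)]
    exact h t
  refine h1.trans_isLittleO ?_
  simpa using Asymptotics.isLittleO_pow_id (𝕜 := ℝ) one_lt_two

/-- On the Fourier side the remainder is at most 2(tθ)²|𝓕φ| with θ = (2πξ)², and θ²𝓕φ is the
transform of the fourth derivative of φ, hence square integrable. -/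
theorem hasDerivAt_lineMap_toLp (φ : 𝓢(ℝ, ℂ)) :
    HasDerivAt (fun t => lineMap t (φ.toLp 2 volume))
      (Complex.I • (schwartzD2 φ).toLp 2 volume) 0 := by
  have hF : ∀ φ : 𝓢(ℝ, ℂ), Lp.fourierTransformₗᵢ ℝ ℂ (φ.toLp 2) = (𝓕 φ).toLp 2 :=
    SchwartzMap.toLp_fourier_eq
  refine hasDerivAt_of_norm_sub_le_sq (C := 2 * ‖(𝓕 (schwartzD2 (schwartzD2 φ))).toLp 2 volume‖)
    fun t => ?_
  change ‖lineMap t (φ.toLp 2 volume) - lineMap 0 (φ.toLp 2 volume)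
    - (t : ℂ) • Complex.I • (schwartzD2 φ).toLp 2 volume‖ ≤ _
  rw [← (Lp.fourierTransformₗᵢ ℝ ℂ).norm_map, map_sub, map_sub, lineMap_apply, lineMap_apply,
    LinearIsometryEquiv.apply_symm_apply, LinearIsometryEquiv.apply_symm_apply,
    map_smul, map_smul, hF, hF]
  have hnorm : 2 * ‖(𝓕 (schwartzD2 (schwartzD2 φ))).toLp 2‖ * t ^ 2
      = ‖((2 * t ^ 2 : ℝ) : ℂ) • (𝓕 (schwartzD2 (schwartzD2 φ))).toLp 2‖ := by
    rw [norm_smul, Complex.norm_real, Real.norm_of_nonneg (by positivity)]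
    ring
  rw [hnorm]
  refine Lp.norm_le_norm_of_ae_le ?_
  set a := phaseMul (lineSymbol t) (aestronglyMeasurable_lineSymbol t) ((𝓕 φ).toLp 2)
  set b := phaseMul (lineSymbol 0) (aestronglyMeasurable_lineSymbol 0) ((𝓕 φ).toLp 2)
  filter_upwards [coeFn_phaseMul _ (aestronglyMeasurable_lineSymbol t) ((𝓕 φ).toLp 2),
    coeFn_phaseMul _ (aestronglyMeasurable_lineSymbol 0) ((𝓕 φ).toLp 2),
    (𝓕 φ).coeFn_toLp 2 volume, (𝓕 (schwartzD2 φ)).coeFn_toLp 2 volume,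
    (𝓕 (schwartzD2 (schwartzD2 φ))).coeFn_toLp 2 volume,
    Lp.coeFn_sub (a - b) ((t : ℂ) • Complex.I • (𝓕 (schwartzD2 φ)).toLp 2),
    Lp.coeFn_sub a b, Lp.coeFn_smul (t : ℂ) (Complex.I • (𝓕 (schwartzD2 φ)).toLp 2),
    Lp.coeFn_smul Complex.I ((𝓕 (schwartzD2 φ)).toLp 2),
    Lp.coeFn_smul ((2 * t ^ 2 : ℝ) : ℂ) ((𝓕 (schwartzD2 (schwartzD2 φ))).toLp 2)]
    with ξ h1 h2 h3 h4 h5 h6 h7 h8 h9 h10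
  rw [h6, h10, Pi.sub_apply, Pi.smul_apply, h7, h8, Pi.sub_apply, Pi.smul_apply, h9,
    Pi.smul_apply, h4, h5, h1, h2, h3, fourier_schwartzD2, fourier_schwartzD2, fourier_schwartzD2]
  set θ : ℝ := (2 * Real.pi * ξ) ^ 2
  have hθ : lineSymbol t ξ = -(t * θ) := rfl
  have hθ0 : lineSymbol 0 ξ = 0 := by simp [lineSymbol]
  rw [hθ, hθ0, Complex.ofReal_zero, mul_zero, Complex.exp_zero, mul_one]
  have hsplit : (𝓕 φ) ξ * Complex.exp (Complex.I * ((-(t * θ) : ℝ) : ℂ)) - (𝓕 φ) ξ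
      - (t : ℂ) • Complex.I • (-(θ : ℂ) * (𝓕 φ) ξ)
      = (Complex.exp (Complex.I * ((-(t * θ) : ℝ) : ℂ)) - 1
        + Complex.I * ((t * θ : ℝ) : ℂ)) * (𝓕 φ) ξ := by
    simp only [smul_eq_mul]
    push_cast
    ring
  rw [hsplit, norm_mul]
  refine (mul_le_mul_of_nonneg_right (norm_exp_I_mul_sub_one_add_le (t * θ))
    (norm_nonneg _)).trans (le_of_eq ?_)
  simp only [smul_eq_mul, norm_mul, norm_neg, Complex.norm_real, Real.norm_eq_abs,
    abs_of_nonneg (show (0 : ℝ) ≤ θ from sq_nonneg _),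
    Complex.ofReal_mul, Complex.ofReal_pow, norm_pow, sq_abs, Complex.ofReal_ofNat,
    Complex.norm_ofNat]
  ring

/-- The free Schrödinger group on the line, with the Schwartz functions as core. -/
def lineFlow : UnitaryFlow (Lp ℂ 2 (volume : Measure ℝ)) where
  S := lineMap
  map_zero v := by
    have h : phaseMul (lineSymbol 0) (aestronglyMeasurable_lineSymbol 0)
        (Lp.fourierTransformₗᵢ ℝ ℂ v) = Lp.fourierTransformₗᵢ ℝ ℂ v := by
      refine Lp.ext ?_
      filter_upwards [coeFn_phaseMul _ (aestronglyMeasurable_lineSymbol 0)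
        (Lp.fourierTransformₗᵢ ℝ ℂ v)] with x hx
      rw [hx]
      simp [lineSymbol]
    rw [lineMap_apply, h, LinearIsometryEquiv.symm_apply_apply]
  map_add s t v := by
    rw [lineMap_apply, lineMap_apply, lineMap_apply, LinearIsometryEquiv.apply_symm_apply,
      phaseMul_lineSymbol_add]
  core := range fun φ : 𝓢(ℝ, ℂ) => (φ.toLp 2, (schwartzD2 φ).toLp 2)
  core_hasDerivAt := by
    rintro _ ⟨φ, rfl⟩
    exact hasDerivAt_lineMap_toLp φ
  core_map := by
    rintro _ ⟨φ, rfl⟩ t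
    refine Submodule.subset_span ⟨SchwartzMap.fourierMultiplierCLM ℂ
      (fun ξ : ℝ => Complex.exp (Complex.I * (lineSymbol t ξ : ℂ))) φ, ?_⟩
    simp only [lineMap_toLp, fourierMultiplier_schwartzD2 (hasTemperateGrowth_lineSymbol t)]
  core_dense := by
    refine (SchwartzMap.denseRange_toLpCLM (E := ℝ) (F := ℂ) (p := 2) (μ := volume)
      ENNReal.ofNat_ne_top).mono ?_
    rintro _ ⟨φ, rfl⟩
    exact ⟨_, Submodule.subset_span (mem_range_self φ), rfl⟩

end Line

/-! ### Orthonormality and totality of the modes -/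

theorem inner_toLp_left {μ : Measure ℝ} {φ : ℝ → ℂ} (hφ : MemLp φ 2 μ) (v : Lp ℂ 2 μ) :
    inner ℂ (hφ.toLp φ) v = ∫ x, (starRingEnd ℂ) (φ x) * v x ∂μ := by
  rw [L2.inner_def]
  refine integral_congr_ae ?_
  filter_upwards [hφ.coeFn_toLp] with x hx
  rw [hx, RCLike.inner_apply']

theorem inner_toLp_toLp {μ : Measure ℝ} {φ ψ : ℝ → ℂ} (hφ : MemLp φ 2 μ) (hψ : MemLp ψ 2 μ) :
    inner ℂ (hφ.toLp φ) (hψ.toLp ψ) = ∫ x, (starRingEnd ℂ) (φ x) * ψ x ∂μ := by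
  rw [inner_toLp_left]
  refine integral_congr_ae ?_
  filter_upwards [hψ.coeFn_toLp] with x hx
  rw [hx]

theorem orthonormal_of_inner_eq_ite {H ι : Type*} [NormedAddCommGroup H] [InnerProductSpace ℂ H]
    [DecidableEq ι] {e : ι → H} (h : ∀ j k, inner ℂ (e j) (e k) = if j = k then (1 : ℂ) else 0) :
    Orthonormal ℂ e :=
  orthonormal_iff_ite.2 h

/-- All Fourier coefficients vanish, so the L² norm does by Parseval's identity. -/
theorem ae_eq_zero_of_forall_integral_exp {a b : ℝ} {f : ℝ → ℂ} (hab : a < b)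
    (hf : MemLp f 2 (volume.restrict (Ioc a b)))
    (h : ∀ n : ℤ, ∫ x in a..b,
      Complex.exp (-(2 * Real.pi * Complex.I * n * x / ((b - a : ℝ) : ℂ))) * f x = 0) :
    f =ᵐ[volume.restrict (Ioc a b)] 0 := by
  have hcoef : ∀ n : ℤ, fourierCoeffOn hab f n = 0 := by
    intro n
    rw [fourierCoeffOn_eq_integral]
    have : ∫ x in a..b, fourier (-n) (x : AddCircle (b - a)) • f x = 0 := by
      rw [← h n]
      refine intervalIntegral.integral_congr fun x _ => ?_
      simp only [smul_eq_mul]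
      rw [fourier_coe_apply]
      congr 2
      push_cast
      ring
    rw [this, smul_zero]
  have hsum := hasSum_sq_fourierCoeffOn hab hf
  simp only [hcoef, norm_zero, ne_eq, OfNat.ofNat_ne_zero, not_false_eq_true, zero_pow] at hsum
  have hzero := hsum.unique hasSum_zero
  rw [smul_eq_mul, mul_eq_zero, intervalIntegral.integral_of_le hab.le] at hzero
  have hint := hzero.resolve_left (inv_ne_zero (sub_pos.2 hab).ne')
  rw [integral_eq_zero_iff_of_nonneg (fun x => sq_nonneg _) hf.integrable_norm_pow'] at hint
  filter_upwards [hint] with x hx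
  simpa using hx

section Periodic

variable {a b : ℝ}

theorem inner_periodicMode_left (k : ℤ) (v : Lp ℂ 2 (volume.restrict (Ioo a b))) :
    inner ℂ ((memLp_periodicMode a b k).toLp _) v
      = ((Real.sqrt (1 / (b - a)) : ℝ) : ℂ) * ∫ x in Ioo a b,
        Complex.exp (-(((2 * Real.pi * k * (x - a) / (b - a) : ℝ) : ℂ) * Complex.I)) * v x := by
  rw [inner_toLp_left, ← integral_const_mul]
  refine integral_congr_ae (ae_of_all _ fun x => ?_)
  simp only [periodicMode, map_mul, Complex.conj_ofReal, ← Complex.exp_conj, Complex.conj_I,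
    mul_neg, mul_assoc]

theorem orthonormal_periodicMode (hab : a < b) :
    Orthonormal ℂ fun k : ℤ => (memLp_periodicMode a b k).toLp _ := by
  have hL : 0 < b - a := sub_pos.2 hab
  refine orthonormal_of_inner_eq_ite fun j k => ?_
  rw [inner_toLp_toLp]
  have hprod : ∀ x : ℝ, (starRingEnd ℂ) (periodicMode a b j x) * periodicMode a b k x
      = ((1 / (b - a) : ℝ) : ℂ) *
        Complex.exp ((2 * Real.pi * ((k - j : ℤ) : ℂ) * Complex.I / (b - a)) * (x - a : ℝ)) := by
    intro x
    have hs : ((Real.sqrt (1 / (b - a)) : ℝ) : ℂ) * ((Real.sqrt (1 / (b - a)) : ℝ) : ℂ)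
        = ((1 / (b - a) : ℝ) : ℂ) := by
      rw [← Complex.ofReal_mul, Real.mul_self_sqrt (by positivity)]
    simp only [periodicMode, map_mul, Complex.conj_ofReal, ← Complex.exp_conj, Complex.conj_I]
    rw [mul_mul_mul_comm, hs, ← Complex.exp_add]
    congr 2
    push_cast
    ring
  simp_rw [hprod]
  rw [integral_const_mul, ← integral_Ioc_eq_integral_Ioo, ← intervalIntegral.integral_of_le hab.le,
    intervalIntegral.integral_comp_sub_right (fun x : ℝ =>
      Complex.exp ((2 * Real.pi * ((k - j : ℤ) : ℂ) * Complex.I / (b - a)) * (x : ℂ))) a, sub_self]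
  have hLc : ((b : ℂ) - a) ≠ 0 := by
    rw [← Complex.ofReal_sub]
    exact_mod_cast hL.ne'
  by_cases hjk : j = k
  · subst hjk
    simp [hLc]
  · rw [if_neg hjk]
    have hm : ((k - j : ℤ) : ℂ) ≠ 0 := by
      exact_mod_cast sub_ne_zero.2 (Ne.symm hjk)
    have hc : 2 * Real.pi * ((k - j : ℤ) : ℂ) * Complex.I / (b - a) ≠ 0 := by
      refine div_ne_zero (mul_ne_zero (mul_ne_zero (by simp [Real.pi_ne_zero]) hm)
        Complex.I_ne_zero) hLc
    rw [integral_exp_mul_complex hc]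
    have h1 : 2 * Real.pi * ((k - j : ℤ) : ℂ) * Complex.I / (b - a) * ((b - a : ℝ) : ℂ)
        = ((k - j : ℤ) : ℂ) * (2 * Real.pi * Complex.I) := by
      push_cast
      field_simp
    rw [h1, Complex.exp_int_mul_two_pi_mul_I]
    simp

theorem total_periodicMode (hab : a < b) (v : Lp ℂ 2 (volume.restrict (Ioo a b)))
    (h : ∀ k : ℤ, inner ℂ ((memLp_periodicMode a b k).toLp _) v = 0) : v = 0 := by
  have hL : 0 < b - a := sub_pos.2 hab
  have hIoc : (volume.restrict (Ioc a b) : Measure ℝ) = volume.restrict (Ioo a b) :=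
    (restrict_Ioo_eq_restrict_Ioc).symm
  have hv : MemLp v 2 (volume.restrict (Ioc a b)) := by rw [hIoc]; exact Lp.memLp v
  have hz := ae_eq_zero_of_forall_integral_exp hab hv fun n => ?_
  · rw [hIoc] at hz
    exact Lp.ext (hz.trans (Lp.coeFn_zero _ _ _).symm)
  have hn := h n
  rw [inner_periodicMode_left, mul_eq_zero] at hn
  have hn' := hn.resolve_left (Complex.ofReal_ne_zero.2 (Real.sqrt_pos.2 (by positivity)).ne')
  rw [intervalIntegral.integral_of_le hab.le, hIoc]
  -- The modes are based at a and the Fourier basis at 0; they differ by a constant phase.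
  have hfac : ∀ x : ℝ, Complex.exp (-(2 * Real.pi * Complex.I * n * x / ((b - a : ℝ) : ℂ))) * v x
      = Complex.exp (-(2 * Real.pi * Complex.I * n * a / ((b - a : ℝ) : ℂ))) *
        (Complex.exp (-(((2 * Real.pi * n * (x - a) / (b - a) : ℝ) : ℂ) * Complex.I)) * v x) := by
    intro x
    rw [← mul_assoc, ← Complex.exp_add]
    congr 2
    push_cast
    ring
  simp_rw [hfac]
  rw [integral_const_mul, hn', mul_zero]

end Periodic

section Dirichlet

variable {a b : ℝ}

theorem integral_cos_mode (hab : a < b) (m : ℤ) :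
    ∫ x in a..b, Real.cos (m * Real.pi * (x - a) / (b - a)) = if m = 0 then b - a else 0 := by
  have hL : 0 < b - a := sub_pos.2 hab
  by_cases hm : m = 0
  · subst hm
    simp
  · rw [if_neg hm]
    have hc : (m : ℝ) * Real.pi / (b - a) ≠ 0 :=
      div_ne_zero (mul_ne_zero (Int.cast_ne_zero.2 hm) Real.pi_ne_zero) hL.ne'
    have hder : ∀ x ∈ uIcc a b, HasDerivAt
        (fun x => Real.sin (m * Real.pi * (x - a) / (b - a)) / (m * Real.pi / (b - a)))
        (Real.cos (m * Real.pi * (x - a) / (b - a))) x := by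
      intro x _
      have h1 : HasDerivAt (fun x => (m : ℝ) * Real.pi * (x - a) / (b - a))
          (m * Real.pi / (b - a)) x := by
        simpa using (((hasDerivAt_id x).sub_const a).const_mul ((m : ℝ) * Real.pi)).div_const (b - a)
      refine (h1.sin.div_const _).congr_deriv ?_
      field_simp
    rw [intervalIntegral.integral_eq_sub_of_hasDerivAt hder
      (Continuous.intervalIntegrable (by fun_prop) _ _), mul_div_assoc, div_self hL.ne', mul_one,
      Real.sin_int_mul_pi]
    simp

theorem orthonormal_dirichletMode (hab : a < b) :
    Orthonormal ℂ fun k : ℕ => (memLp_dirichletMode a b k).toLp _ := by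
  have hL : 0 < b - a := sub_pos.2 hab
  refine orthonormal_of_inner_eq_ite fun j k => ?_
  rw [inner_toLp_toLp]
  have hprod : ∀ x : ℝ, (starRingEnd ℂ) (dirichletMode a b j x) * dirichletMode a b k x
      = ((1 / (b - a) * (Real.cos (((j - k : ℤ) : ℝ) * Real.pi * (x - a) / (b - a))
        - Real.cos (((j + k + 2 : ℤ) : ℝ) * Real.pi * (x - a) / (b - a))) : ℝ) : ℂ) := by
    intro x
    rw [dirichletMode, dirichletMode, Complex.conj_ofReal, ← Complex.ofReal_mul]
    congr 1
    have hs : Real.sqrt (2 / (b - a)) * Real.sqrt (2 / (b - a)) = 2 / (b - a) :=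
      Real.mul_self_sqrt (by positivity)
    rw [mul_mul_mul_comm, hs]
    have h1 : ((j - k : ℤ) : ℝ) * Real.pi * (x - a) / (b - a)
        = ((j : ℝ) + 1) * Real.pi * (x - a) / (b - a)
          - ((k : ℝ) + 1) * Real.pi * (x - a) / (b - a) := by
      push_cast; ring
    have h2 : ((j + k + 2 : ℤ) : ℝ) * Real.pi * (x - a) / (b - a)
        = ((j : ℝ) + 1) * Real.pi * (x - a) / (b - a)
          + ((k : ℝ) + 1) * Real.pi * (x - a) / (b - a) := by
      push_cast; ring
    rw [h1, h2, Real.cos_sub, Real.cos_add]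
    ring
  simp_rw [hprod]
  rw [integral_complex_ofReal, ← integral_Ioc_eq_integral_Ioo, ← intervalIntegral.integral_of_le hab.le,
    intervalIntegral.integral_const_mul, intervalIntegral.integral_sub
      (Continuous.intervalIntegrable (by fun_prop) _ _)
      (Continuous.intervalIntegrable (by fun_prop) _ _), integral_cos_mode hab,
    integral_cos_mode hab, if_neg (by omega : ¬((j : ℤ) + k + 2 = 0))]
  by_cases hjk : j = k
  · subst hjk
    rw [if_pos (by omega), if_pos rfl, sub_zero, one_div, inv_mul_cancel₀ hL.ne']
    simp
  · rw [if_neg (by omega), if_neg hjk]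
    simp

/-- The modes have frequencies k + 1 ≥ 1, while the Fourier argument needs every integer; oddness of
the sine and sin 0 = 0 supply the rest. -/
theorem integral_sin_mul_eq_zero (hab : a < b) {v : Lp ℂ 2 (volume.restrict (Ioo a b))}
    (h : ∀ k : ℕ, inner ℂ ((memLp_dirichletMode a b k).toLp _) v = 0) (m : ℤ) :
    ∫ x in Ioo a b, ((Real.sin (m * Real.pi * (x - a) / (b - a)) : ℝ) : ℂ) * v x = 0 := by
  have hL : 0 < b - a := sub_pos.2 hab
  have hpos : ∀ k : ℕ, ∫ x in Ioo a b,
      ((Real.sin (((k : ℝ) + 1) * Real.pi * (x - a) / (b - a)) : ℝ) : ℂ) * v x = 0 := by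
    intro k
    have hk := h k
    rw [inner_toLp_left] at hk
    have hfac : ∀ x : ℝ, (starRingEnd ℂ) (dirichletMode a b k x) * v x
        = ((Real.sqrt (2 / (b - a)) : ℝ) : ℂ) *
          (((Real.sin (((k : ℝ) + 1) * Real.pi * (x - a) / (b - a)) : ℝ) : ℂ) * v x) := by
      intro x
      rw [dirichletMode, Complex.conj_ofReal, Complex.ofReal_mul, mul_assoc]
    simp_rw [hfac] at hk
    rw [integral_const_mul, mul_eq_zero] at hk
    exact hk.resolve_left (Complex.ofReal_ne_zero.2 (Real.sqrt_pos.2 (by positivity)).ne')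
  rcases lt_trichotomy m 0 with hm | hm | hm
  · obtain ⟨k, hk⟩ : ∃ k : ℕ, m = -((k : ℤ) + 1) := ⟨(-m - 1).toNat, by omega⟩
    have hneg : ∀ x : ℝ, ((Real.sin (m * Real.pi * (x - a) / (b - a)) : ℝ) : ℂ) * v x
        = -(((Real.sin (((k : ℝ) + 1) * Real.pi * (x - a) / (b - a)) : ℝ) : ℂ) * v x) := by
      intro x
      have : (m : ℝ) * Real.pi * (x - a) / (b - a)
          = -(((k : ℝ) + 1) * Real.pi * (x - a) / (b - a)) := by
        rw [hk]; push_cast; ring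
      rw [this, Real.sin_neg]
      push_cast
      ring
    simp_rw [hneg]
    rw [integral_neg, hpos, neg_zero]
  · subst hm
    simp
  · obtain ⟨k, hk⟩ : ∃ k : ℕ, m = (k : ℤ) + 1 := ⟨(m - 1).toNat, by omega⟩
    have := hpos k
    rw [hk]
    push_cast
    exact_mod_cast this

/-- Extend v oddly about a to the doubled interval (2a - b, b). Its Fourier coefficients there are
sine coefficients of v, which vanish, so uniqueness of Fourier series applies to the extension. -/
theorem total_dirichletMode (hab : a < b) (v : Lp ℂ 2 (volume.restrict (Ioo a b)))
    (h : ∀ k : ℕ, inner ℂ ((memLp_dirichletMode a b k).toLp _) v = 0) : v = 0 := by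
  have hL : 0 < b - a := sub_pos.2 hab
  set w : ℝ → ℂ := (Ioo a b).indicator v with hw
  have hwL : MemLp w 2 volume := (memLp_indicator_iff_restrict measurableSet_Ioo).2 (Lp.memLp v)
  have hmp : MeasurePreserving (fun x : ℝ => 2 * a - x) volume volume :=
    Measure.measurePreserving_sub_left volume (2 * a)
  have hwr : MemLp (fun x => w (2 * a - x)) 2 volume := hwL.comp_measurePreserving hmp
  set V : ℝ → ℂ := fun x => w x - w (2 * a - x) with hV
  have hVL : MemLp V 2 volume := hwL.sub hwr
  have hab' : 2 * a - b < b := by linarith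
  have hsupp : ∀ x, x ∉ Ioc (2 * a - b) b → V x = 0 := by
    intro x hx
    have h1 : x ∉ Ioo a b := fun hx' => hx ⟨by linarith [hx'.1, hx'.2], hx'.2.le⟩
    have h2 : 2 * a - x ∉ Ioo a b := fun hx' => hx ⟨by linarith [hx'.2], by linarith [hx'.1]⟩
    simp only [hV, hw, indicator_of_notMem h1, indicator_of_notMem h2, sub_zero]
  have hz := ae_eq_zero_of_forall_integral_exp hab' (hVL.restrict _) fun n => ?_
  · have hz' : ∀ᵐ x ∂(volume.restrict (Ioo a b)), V x = 0 :=
      ae_restrict_of_ae_restrict_of_subset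
        (show Ioo a b ⊆ Ioc (2 * a - b) b from fun x hx => ⟨by linarith [hx.1, hx.2], hx.2.le⟩) hz
    refine Lp.ext ?_
    filter_upwards [hz', ae_restrict_mem measurableSet_Ioo, Lp.coeFn_zero ℂ 2
      (volume.restrict (Ioo a b))] with x h1 h2 h3
    have h4 : 2 * a - x ∉ Ioo a b := fun hx' => by linarith [hx'.1, h2.1]
    simp only [hV, hw, indicator_of_mem h2, indicator_of_notMem h4, sub_zero] at h1
    rw [h1, h3, Pi.zero_apply]
  set E : ℝ → ℂ := fun x =>
    Complex.exp (-(2 * Real.pi * Complex.I * n * x / ((b - (2 * a - b) : ℝ) : ℂ))) with hE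
  have hEc : Continuous E := by rw [hE]; fun_prop
  rw [intervalIntegral.integral_of_le hab'.le]
  change ∫ x in Ioc (2 * a - b) b, E x * V x = 0
  rw [setIntegral_eq_integral_of_forall_compl_eq_zero
    (fun x hx => by rw [hsupp x hx, mul_zero])]
  have hwi : Integrable w volume := by
    rw [hw, integrable_indicator_iff measurableSet_Ioo]
    exact (Lp.memLp v).integrable one_le_two
  have hEb : ∀ x, ‖E x‖ ≤ 1 := by
    intro x
    have : -(2 * Real.pi * Complex.I * n * x / ((b - (2 * a - b) : ℝ) : ℂ))
        = ((-(2 * Real.pi * n * x / (b - (2 * a - b))) : ℝ) : ℂ) * Complex.I := by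
      push_cast; ring
    simp only [hE]
    rw [this, Complex.norm_exp_ofReal_mul_I]
  have hint : ∀ {g : ℝ → ℂ}, Integrable g volume → Integrable (fun x => E x * g x) volume :=
    fun hg => hg.bdd_mul hEc.aestronglyMeasurable (ae_of_all _ hEb)
  have hsplit : ∀ x, E x * V x = E x * w x - E x * w (2 * a - x) := fun x => mul_sub _ _ _
  simp_rw [hsplit]
  rw [integral_sub (hint hwi) (hint (g := fun x => w (2 * a - x)) (hmp.integrable_comp_of_integrable hwi)),
    ← integral_sub_left_eq_self (fun x => E x * w (2 * a - x)) volume (2 * a)]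
  simp only [sub_sub_cancel]
  rw [← integral_sub (hint hwi)]
  -- After reflecting the second integral, the difference of the two exponentials is a sine up to a
  -- constant phase.
  · have hsin : ∀ x, E x * w x - E (2 * a - x) * w x = (Ioo a b).indicator (fun x =>
        (-2 * Complex.I * Complex.exp (-(Real.pi * Complex.I * n * a / ((b - a : ℝ) : ℂ)))) *
          (((Real.sin (n * Real.pi * (x - a) / (b - a)) : ℝ) : ℂ) * v x)) x := by
      intro x
      by_cases hx : x ∈ Ioo a b
      · rw [indicator_of_mem hx, hw, indicator_of_mem hx, ← sub_mul, ← mul_assoc]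
        congr 1
        rw [Complex.ofReal_sin, Complex.sin]
        have hLc : ((b : ℂ) - a) ≠ 0 := by
          rw [← Complex.ofReal_sub]
          exact_mod_cast hL.ne'
        have e1 : E x = Complex.exp (-(Real.pi * Complex.I * n * a / ((b - a : ℝ) : ℂ))) *
            Complex.exp (-((n * Real.pi * (x - a) / (b - a) : ℝ) : ℂ) * Complex.I) := by
          simp only [hE]
          rw [← Complex.exp_add]
          congr 1
          push_cast
          have : ((b : ℂ) - (2 * a - b)) = 2 * (b - a) := by ring
          rw [this]
          field_simp
          ring
        have e2 : E (2 * a - x) = Complex.exp (-(Real.pi * Complex.I * n * a / ((b - a : ℝ) : ℂ))) *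
            Complex.exp (((n * Real.pi * (x - a) / (b - a) : ℝ) : ℂ) * Complex.I) := by
          simp only [hE]
          rw [← Complex.exp_add]
          congr 1
          push_cast
          have : ((b : ℂ) - (2 * a - b)) = 2 * (b - a) := by ring
          rw [this]
          field_simp
          ring
        rw [e1, e2]
        ring_nf
        rw [Complex.I_sq]
        ring
      · rw [indicator_of_notMem hx, hw, indicator_of_notMem hx, mul_zero, mul_zero, sub_zero]
    simp_rw [hsin]
    rw [integral_indicator measurableSet_Ioo, integral_const_mul, integral_sin_mul_eq_zero hab h n,
      mul_zero]
  · have := (hEc.comp (continuous_const.sub continuous_id : Continuous fun x : ℝ => 2 * a - x))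
    exact hwi.bdd_mul this.aestronglyMeasurable (ae_of_all _ fun x => hEb _)

end Dirichlet

/-! ### The free group on each domain -/

/-- The free Schrödinger group on the domain. -/
def Domain.flow : (Ω : Domain) → UnitaryFlow Ω.L2
  | .line => lineFlow
  | .dirichlet a b hab => modeFlow (orthonormal_dirichletMode hab) (total_dirichletMode hab)
      fun k => ((k + 1) * Real.pi / (b - a)) ^ 2
  | .periodic a b hab => modeFlow (orthonormal_periodicMode hab) (total_periodicMode hab)
      fun k => (2 * Real.pi * k / (b - a)) ^ 2

theorem flowA_eq (Ω : Domain) (t : ℝ) (v : Ω.L2) : flowA Ω t v = Ω.flow.S t v := by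
  match Ω, v with
  | .line, v => rfl
  | .dirichlet a b hab, v =>
    exact (modeMap_eq_tsum (orthonormal_dirichletMode hab) (total_dirichletMode hab) _ t v).symm
  | .periodic a b hab, v =>
    exact (modeMap_eq_tsum (orthonormal_periodicMode hab) (total_periodicMode hab) _ t v).symm

/-! ### Boundary conditions and the domain of the generator -/

/-- The open set underlying the domain. -/
def Domain.carrier : Domain → Set ℝ
  | .line => univ
  | .dirichlet a b _ => Ioo a b
  | .periodic a b _ => Ioo a b

theorem Domain.measure_eq (Ω : Domain) : Ω.measure = volume.restrict Ω.carrier := by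
  cases Ω <;> simp [Domain.measure, Domain.carrier]

theorem Domain.isOpen_carrier (Ω : Domain) : IsOpen Ω.carrier := by
  cases Ω <;> simp [Domain.carrier, isOpen_Ioo]

theorem Domain.ordConnected_carrier (Ω : Domain) : Ω.carrier.OrdConnected := by
  cases Ω <;> simp only [Domain.carrier] <;> infer_instance

theorem Domain.nonempty_carrier (Ω : Domain) : Ω.carrier.Nonempty := by
  cases Ω with
  | line => exact univ_nonempty
  | dirichlet a b hab => exact nonempty_Ioo.2 hab
  | periodic a b hab => exact nonempty_Ioo.2 hab

theorem Domain.ae_measure_of_ae (Ω : Domain) {p : ℝ → Prop} (h : ∀ᵐ x : ℝ, p x) :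
    ∀ᵐ x ∂Ω.measure, p x := by
  rw [Ω.measure_eq]
  exact ae_restrict_of_ae h

/-- The boundary condition of the domain for a regular function with derivative `V'`; on the line,
boundedness. -/
def Domain.BoundaryCondition : Domain → (ℝ → ℂ) → (ℝ → ℂ) → Prop
  | .line, V, V' => ∃ B, ∀ x, ‖V x‖ ≤ B ∧ ‖V' x‖ ≤ B
  | .dirichlet a b _, V, _ => V a = 0 ∧ V b = 0
  | .periodic a b _, V, V' => V a = V b ∧ V' a = V' b

/-! ### Derivatives and boundary values of the modes -/

section Modes

variable {a b : ℝ}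

theorem contDiff_dirichletMode (a b : ℝ) (k : ℕ) : ContDiff ℝ ∞ (dirichletMode a b k) := by
  have h : ContDiff ℝ ∞ fun x : ℝ =>
      Real.sqrt (2 / (b - a)) * Real.sin ((k + 1) * Real.pi * (x - a) / (b - a)) := by fun_prop
  exact Complex.ofRealCLM.contDiff.comp h

theorem deriv_dirichletMode (a b : ℝ) (k : ℕ) : deriv (dirichletMode a b k) = fun x =>
    ((Real.sqrt (2 / (b - a)) * ((k + 1) * Real.pi / (b - a) *
      Real.cos ((k + 1) * Real.pi * (x - a) / (b - a))) : ℝ) : ℂ) := by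
  funext x
  have h1 : HasDerivAt (fun x => ((k : ℝ) + 1) * Real.pi * (x - a) / (b - a))
      ((k + 1) * Real.pi / (b - a)) x := by
    simpa using (((hasDerivAt_id x).sub_const a).const_mul (((k : ℝ) + 1) * Real.pi)).div_const
      (b - a)
  have h2 := (h1.sin.const_mul (Real.sqrt (2 / (b - a)))).ofReal_comp
  refine (h2.congr_deriv ?_).deriv
  push_cast
  ring

theorem deriv_deriv_dirichletMode (a b : ℝ) (k : ℕ) (x : ℝ) :
    deriv (deriv (dirichletMode a b k)) x
      = -((((k + 1) * Real.pi / (b - a)) ^ 2 : ℝ) : ℂ) * dirichletMode a b k x := by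
  rw [deriv_dirichletMode]
  have h1 : HasDerivAt (fun x => ((k : ℝ) + 1) * Real.pi * (x - a) / (b - a))
      ((k + 1) * Real.pi / (b - a)) x := by
    simpa using (((hasDerivAt_id x).sub_const a).const_mul (((k : ℝ) + 1) * Real.pi)).div_const
      (b - a)
  have h2 := ((h1.cos.const_mul ((k + 1) * Real.pi / (b - a))).const_mul
    (Real.sqrt (2 / (b - a)))).ofReal_comp
  refine (h2.congr_deriv ?_).deriv
  rw [dirichletMode]
  push_cast
  ring

theorem dirichletMode_left (a b : ℝ) (k : ℕ) : dirichletMode a b k a = 0 := by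
  simp [dirichletMode]

theorem dirichletMode_right (hab : a < b) (k : ℕ) : dirichletMode a b k b = 0 := by
  have h : ((k : ℝ) + 1) * Real.pi * (b - a) / (b - a) = ((k + 1 : ℕ) : ℝ) * Real.pi := by
    rw [mul_div_assoc, div_self (sub_pos.2 hab).ne', mul_one]
    push_cast
    ring
  rw [dirichletMode, h, Real.sin_nat_mul_pi]
  simp

theorem contDiff_periodicMode (a b : ℝ) (k : ℤ) : ContDiff ℝ ∞ (periodicMode a b k) := by
  have h : ContDiff ℝ ∞ fun x : ℝ => 2 * Real.pi * k * (x - a) / (b - a) := by fun_prop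
  exact contDiff_const.mul (((Complex.ofRealCLM.contDiff.comp h).mul contDiff_const).cexp)

theorem deriv_periodicMode (a b : ℝ) (k : ℤ) : deriv (periodicMode a b k) = fun x =>
    ((2 * Real.pi * k / (b - a) : ℝ) : ℂ) * Complex.I * periodicMode a b k x := by
  funext x
  have h1 : HasDerivAt (fun x => 2 * Real.pi * (k : ℝ) * (x - a) / (b - a))
      (2 * Real.pi * k / (b - a)) x := by
    simpa using (((hasDerivAt_id x).sub_const a).const_mul (2 * Real.pi * (k : ℝ))).div_const
      (b - a)
  have h2 := ((h1.ofReal_comp.mul_const Complex.I).cexp).const_mul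
    ((Real.sqrt (1 / (b - a)) : ℝ) : ℂ)
  refine (h2.congr_deriv ?_).deriv
  rw [periodicMode]
  ring

theorem deriv_deriv_periodicMode (a b : ℝ) (k : ℤ) (x : ℝ) :
    deriv (deriv (periodicMode a b k)) x
      = -(((2 * Real.pi * k / (b - a)) ^ 2 : ℝ) : ℂ) * periodicMode a b k x := by
  rw [deriv_periodicMode, deriv_const_mul _ ((contDiff_periodicMode a b k).differentiable
    (by simp) x), deriv_periodicMode]
  push_cast
  ring_nf
  rw [Complex.I_sq]
  ring

theorem periodic_periodicMode (hab : a < b) (k : ℤ) :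
    Function.Periodic (periodicMode a b k) (b - a) := by
  intro x
  have hL : (b - a) ≠ 0 := (sub_pos.2 hab).ne'
  rw [periodicMode, periodicMode]
  congr 1
  have : ((2 * Real.pi * k * (x + (b - a) - a) / (b - a) : ℝ) : ℂ) * Complex.I
      = ((2 * Real.pi * k * (x - a) / (b - a) : ℝ) : ℂ) * Complex.I
        + k * (2 * Real.pi * Complex.I) := by
    have h : 2 * Real.pi * k * (x + (b - a) - a) / (b - a)
        = 2 * Real.pi * k * (x - a) / (b - a) + k * (2 * Real.pi) := by
      field_simp
      ring
    rw [h]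
    push_cast
    ring
  rw [this, Complex.exp_add, Complex.exp_int_mul_two_pi_mul_I, mul_one]

theorem periodicMode_left_eq_right (hab : a < b) (k : ℤ) :
    periodicMode a b k b = periodicMode a b k a := by
  have := periodic_periodicMode hab k a
  rwa [add_sub_cancel] at this

theorem conj_periodicMode (a b : ℝ) (k : ℤ) (x : ℝ) :
    (starRingEnd ℂ) (periodicMode a b k x) = periodicMode a b (-k) x := by
  simp only [periodicMode, map_mul, Complex.conj_ofReal, ← Complex.exp_conj, Complex.conj_I]
  congr 2
  push_cast
  ring

theorem periodicMode_ne_zero (hab : a < b) (k : ℤ) (x : ℝ) : periodicMode a b k x ≠ 0 := by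
  have hL : 0 < b - a := sub_pos.2 hab
  exact mul_ne_zero (Complex.ofReal_ne_zero.2 (Real.sqrt_pos.2 (by positivity)).ne')
    (Complex.exp_ne_zero _)

end Modes

theorem IsRegular.setIntegral_deriv_deriv_mul {V V' : ℝ → ℂ} (h : IsRegular V V') {a b : ℝ}
    (hab : a < b) {ψ v G : ℝ → ℂ} (hψ : ContDiff ℝ ∞ ψ)
    (hv : v =ᵐ[volume.restrict (Ioo a b)] V) (hG : G =ᵐ[volume.restrict (Ioo a b)] deriv V') :
    ∫ x in Ioo a b, deriv (deriv ψ) x * v x = (V b * deriv ψ b - V' b * ψ b)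
      - (V a * deriv ψ a - V' a * ψ a) + ∫ x in Ioo a b, ψ x * G x := by
  have h1 : ∫ x in Ioo a b, deriv (deriv ψ) x * v x = ∫ x in a..b, V x * deriv (deriv ψ) x := by
    rw [intervalIntegral.integral_of_le hab.le, integral_Ioc_eq_integral_Ioo]
    refine integral_congr_ae ?_
    filter_upwards [hv] with x hx
    rw [hx, mul_comm]
  have h2 : ∫ x in Ioo a b, ψ x * G x = ∫ x in a..b, deriv V' x * ψ x := by
    rw [intervalIntegral.integral_of_le hab.le, integral_Ioc_eq_integral_Ioo]
    refine integral_congr_ae ?_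
    filter_upwards [hG] with x hx
    rw [hx, mul_comm]
  rw [h1, h2, h.integral_mul_deriv_deriv hψ]

theorem inner_smul_dirichletMode {a b : ℝ} (k : ℕ) (v : Lp ℂ 2 (volume.restrict (Ioo a b))) :
    inner ℂ (-((((k + 1) * Real.pi / (b - a)) ^ 2 : ℝ) : ℂ) • (memLp_dirichletMode a b k).toLp _) v
      = ∫ x in Ioo a b, deriv (deriv (dirichletMode a b k)) x * v x := by
  rw [inner_smul_left, inner_toLp_left, ← integral_const_mul]
  refine integral_congr_ae (ae_of_all _ fun x => ?_)
  simp only [deriv_deriv_dirichletMode, map_neg, Complex.conj_ofReal]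
  rw [mul_assoc]
  simp only [dirichletMode, Complex.conj_ofReal]

theorem inner_smul_periodicMode {a b : ℝ} (k : ℤ) (v : Lp ℂ 2 (volume.restrict (Ioo a b))) :
    inner ℂ (-(((2 * Real.pi * k / (b - a)) ^ 2 : ℝ) : ℂ) • (memLp_periodicMode a b k).toLp _) v
      = ∫ x in Ioo a b, deriv (deriv (periodicMode a b (-k))) x * v x := by
  rw [inner_smul_left, inner_toLp_left, ← integral_const_mul]
  refine integral_congr_ae (ae_of_all _ fun x => ?_)
  simp only [deriv_deriv_periodicMode, map_neg, Complex.conj_ofReal, conj_periodicMode]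
  rw [mul_assoc]
  push_cast
  ring

theorem inner_dirichletMode {a b : ℝ} (k : ℕ) (v : Lp ℂ 2 (volume.restrict (Ioo a b))) :
    inner ℂ ((memLp_dirichletMode a b k).toLp _) v = ∫ x in Ioo a b, dirichletMode a b k x * v x := by
  rw [inner_toLp_left]
  refine integral_congr_ae (ae_of_all _ fun x => ?_)
  simp only [dirichletMode, Complex.conj_ofReal]

theorem inner_periodicMode {a b : ℝ} (k : ℤ) (v : Lp ℂ 2 (volume.restrict (Ioo a b))) :
    inner ℂ ((memLp_periodicMode a b k).toLp _) v
      = ∫ x in Ioo a b, periodicMode a b (-k) x * v x := by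
  rw [inner_toLp_left]
  simp only [conj_periodicMode]

theorem deriv_conj_comp {φ : ℝ → ℂ} (hφ : Differentiable ℝ φ) :
    deriv (fun x => (starRingEnd ℂ) (φ x)) = fun x => (starRingEnd ℂ) (deriv φ x) := by
  funext x
  exact (Complex.conjCLE.toContinuousLinearMap.hasFDerivAt.comp_hasDerivAt x
    (hφ x).hasDerivAt).deriv

/-- Integrate by parts twice on [-r, r] and let r tend to infinity. Boundedness of V and V' is
enough to kill the boundary terms, since the test function and its derivative decay. -/
theorem inner_schwartz_eq {V V' : ℝ → ℂ} (h : IsRegular V V')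
    (hB : ∃ B, ∀ x, ‖V x‖ ≤ B ∧ ‖V' x‖ ≤ B) {v G : Lp ℂ 2 (volume : Measure ℝ)}
    (hv : v =ᵐ[volume] V) (hG : G =ᵐ[volume] deriv V') (φ : SchwartzMap ℝ ℂ) :
    inner ℂ ((schwartzD2 φ).toLp 2 volume) v = inner ℂ (φ.toLp 2 volume) G := by
  obtain ⟨B, hB⟩ := hB
  set ψ : ℝ → ℂ := fun x => (starRingEnd ℂ) (φ x) with hψdef
  have hψ : ContDiff ℝ ∞ ψ := Complex.conjCLE.contDiff.comp (φ.smooth ⊤)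
  have hd1 : deriv ψ = fun x => (starRingEnd ℂ) (SchwartzMap.derivCLM ℂ ℂ φ x) := by
    rw [hψdef, deriv_conj_comp φ.differentiable]
    rfl
  have hd2 : deriv (deriv ψ) = fun x => (starRingEnd ℂ) (schwartzD2 φ x) := by
    rw [hd1, deriv_conj_comp (SchwartzMap.derivCLM ℂ ℂ φ).differentiable]
    rfl
  have hlhs : inner ℂ ((schwartzD2 φ).toLp 2 volume) v = ∫ x, V x * deriv (deriv ψ) x := by
    rw [SchwartzMap.toLp, inner_toLp_left, hd2]
    refine integral_congr_ae ?_
    filter_upwards [hv] with x hx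
    rw [hx, mul_comm]
  have hrhs : inner ℂ (φ.toLp 2 volume) G = ∫ x, deriv V' x * ψ x := by
    rw [SchwartzMap.toLp, inner_toLp_left]
    refine integral_congr_ae ?_
    filter_upwards [hG] with x hx
    rw [hx, mul_comm]
  have hconj : ∀ χ : SchwartzMap ℝ ℂ, MemLp (fun x => (starRingEnd ℂ) (χ x)) 2 volume := fun χ =>
    (χ.memLp 2 volume).congr_norm
      (Complex.continuous_conj.comp χ.continuous).aestronglyMeasurable
      (ae_of_all _ fun x => (RCLike.norm_conj _).symm)
  have hi1 : Integrable (fun x => V x * deriv (deriv ψ) x) volume := by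
    rw [hd2]
    exact MemLp.integrable_mul (p := 2) (q := 2) ((memLp_congr_ae hv).1 (Lp.memLp v)) (hconj _)
  have hi2 : Integrable (fun x => deriv V' x * ψ x) volume :=
    MemLp.integrable_mul (p := 2) (q := 2) ((memLp_congr_ae hG).1 (Lp.memLp G)) (hconj _)
  have hzero : ∀ (χ : SchwartzMap ℝ ℂ) (g : ℝ → ℂ), (∀ x, ‖g x‖ ≤ B) →
      Tendsto (fun x => g x * (starRingEnd ℂ) (χ x)) (cocompact ℝ) (𝓝 0) := by
    intro χ g hg
    have h0 : Tendsto χ (cocompact ℝ) (𝓝 0) := χ.toZeroAtInfty.zero_at_infty'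
    refine squeeze_zero_norm (a := fun x => B * ‖χ x‖) (fun x => ?_) ?_
    · rw [norm_mul, RCLike.norm_conj]
      gcongr
      exact hg x
    · simpa using h0.norm.const_mul B
  have hbd : Tendsto (fun x => V x * deriv ψ x - V' x * ψ x) (cocompact ℝ) (𝓝 0) := by
    rw [hd1]
    have := (hzero (SchwartzMap.derivCLM ℂ ℂ φ) V fun x => (hB x).1).sub
      (hzero φ V' fun x => (hB x).2)
    rwa [sub_zero] at this
  rw [hlhs, hrhs]
  have l1 := intervalIntegral_tendsto_integral hi1 tendsto_neg_atTop_atBot tendsto_id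
  have l2 := intervalIntegral_tendsto_integral hi2 tendsto_neg_atTop_atBot tendsto_id
  have l3 := ((hbd.comp ((tendsto_id (α := ℝ)).mono_right atTop_le_cocompact)).sub
    (hbd.comp (tendsto_neg_atTop_atBot.mono_right atBot_le_cocompact))).add l2
  rw [sub_zero, zero_add] at l3
  refine tendsto_nhds_unique l1 (l3.congr fun r => ?_)
  exact (h.integral_mul_deriv_deriv hψ (-r) r).symm

/-- Regular functions satisfying the boundary condition are in the domain of the generator. -/
theorem gen_of_isRegular (Ω : Domain) {V V' : ℝ → ℂ} (h : IsRegular V V')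
    (hbc : Ω.BoundaryCondition V V') {v G : Ω.L2} (hv : v =ᵐ[Ω.measure] V)
    (hG : G =ᵐ[Ω.measure] deriv V') : Ω.flow.Gen v G := by
  match Ω, v, G with
  | .line, v, G =>
    refine UnitaryFlow.gen_of_core ?_
    rintro _ ⟨φ, rfl⟩
    exact inner_schwartz_eq h hbc hv hG φ
  | .dirichlet a b hab, v, G =>
    refine UnitaryFlow.gen_of_core ?_
    rintro _ ⟨k, rfl⟩
    refine (inner_smul_dirichletMode k v).trans (.trans ?_ (inner_dirichletMode k G).symm)
    refine (h.setIntegral_deriv_deriv_mul hab (contDiff_dirichletMode a b k) hv hG).trans ?_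
    rw [hbc.1, hbc.2, dirichletMode_left, dirichletMode_right hab]
    simp only [mul_zero, zero_mul, sub_self, zero_add]
    rfl
  | .periodic a b hab, v, G =>
    refine UnitaryFlow.gen_of_core ?_
    rintro _ ⟨k, rfl⟩
    refine (inner_smul_periodicMode k v).trans (.trans ?_ (inner_periodicMode k G).symm)
    refine (h.setIntegral_deriv_deriv_mul hab (contDiff_periodicMode a b (-k)) hv hG).trans ?_
    rw [hbc.1, hbc.2, deriv_periodicMode]
    simp only [periodicMode_left_eq_right hab, sub_self, zero_add]
    rfl

/-! ### Regular representatives -/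

theorem Domain.ae_measure_iff (Ω : Domain) {p : ℝ → Prop} :
    (∀ᵐ x ∂Ω.measure, p x) ↔ ∀ᵐ x : ℝ, x ∈ Ω.carrier → p x := by
  rw [Ω.measure_eq, ae_restrict_iff' Ω.isOpen_carrier.measurableSet]

theorem Domain.integral_measure (Ω : Domain) (f : ℝ → ℂ) :
    ∫ x, f x ∂Ω.measure = ∫ x in Ω.carrier, f x := by
  rw [Ω.measure_eq]

theorem Domain.setIntegral_norm_le (Ω : Domain) {p q : ℝ} (hpq : p < q)
    (hsub : Ioo p q ⊆ Ω.carrier) (v : Ω.L2) :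
    ∫ x in Ioo p q, ‖v x‖ ≤ Real.sqrt (q - p) * ‖v‖ := by
  have hle : volume.restrict (Ioo p q) ≤ Ω.measure := by
    rw [Ω.measure_eq]
    exact Measure.restrict_mono hsub le_rfl
  have hmem : MemLp v 2 (volume.restrict (Ioo p q)) := (Lp.memLp v).mono_measure hle
  have h1 := eLpNorm_le_eLpNorm_mul_rpow_measure_univ (p := 1) (q := 2) one_le_two
    hmem.aestronglyMeasurable
  have h2 : eLpNorm v 2 (volume.restrict (Ioo p q)) ≤ eLpNorm v 2 Ω.measure :=
    eLpNorm_mono_measure _ hle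
  have hfin : eLpNorm v 2 Ω.measure ≠ ⊤ := (Lp.memLp v).eLpNorm_ne_top
  have hvol : (volume.restrict (Ioo p q)) univ = ENNReal.ofReal (q - p) := by simp
  have h3 : eLpNorm v 1 (volume.restrict (Ioo p q))
      ≤ eLpNorm v 2 Ω.measure * ENNReal.ofReal (Real.sqrt (q - p)) := by
    refine h1.trans ?_
    have he : 1 / ENNReal.toReal 1 - 1 / ENNReal.toReal 2 = (1 / 2 : ℝ) := by norm_num
    rw [hvol, Real.sqrt_eq_rpow, ← ENNReal.ofReal_rpow_of_pos (sub_pos.2 hpq), he]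
    gcongr
  rw [integral_norm_eq_lintegral_enorm hmem.aestronglyMeasurable, ← eLpNorm_one_eq_lintegral_enorm,
    Lp.norm_def, mul_comm]
  refine (ENNReal.toReal_mono (ENNReal.mul_ne_top hfin ENNReal.ofReal_ne_top) h3).trans ?_
  rw [ENNReal.toReal_mul, ENNReal.toReal_ofReal (Real.sqrt_nonneg _)]

/-- The length of an interval adjacent to every point of the domain. -/
def Domain.scale : Domain → ℝ
  | .line => 1
  | .dirichlet a b _ => b - a
  | .periodic a b _ => b - a

theorem Domain.scale_pos (Ω : Domain) : 0 < Ω.scale := by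
  cases Ω with
  | line => exact one_pos
  | dirichlet a b hab => exact sub_pos.2 hab
  | periodic a b hab => exact sub_pos.2 hab

theorem Domain.exists_interval (Ω : Domain) {x : ℝ} (hx : x ∈ closure Ω.carrier) :
    ∃ p, x ∈ Icc p (p + Ω.scale) ∧ Ioo p (p + Ω.scale) ⊆ Ω.carrier := by
  cases Ω with
  | line => exact ⟨x, ⟨le_rfl, by simp [Domain.scale]⟩, subset_univ _⟩
  | dirichlet a b hab =>
    refine ⟨a, ?_, ?_⟩
    · simpa [Domain.carrier, Domain.scale, closure_Ioo hab.ne] using hx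
    · simp [Domain.carrier, Domain.scale]
  | periodic a b hab =>
    refine ⟨a, ?_, ?_⟩
    · simpa [Domain.carrier, Domain.scale, closure_Ioo hab.ne] using hx
    · simp [Domain.carrier, Domain.scale]

/-- A constant of the Sobolev embedding. -/
def Domain.sobolevConst (Ω : Domain) : ℝ :=
  (6 / Ω.scale ^ 2 + 7) * Real.sqrt Ω.scale + Real.sqrt Ω.scale / Ω.scale
    + Ω.scale * ((6 / Ω.scale ^ 2 + 7) * Real.sqrt Ω.scale)

theorem Domain.sobolevConst_nonneg (Ω : Domain) : 0 ≤ Ω.sobolevConst := by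
  have := Ω.scale_pos
  unfold Domain.sobolevConst
  positivity

theorem memLp_indicator_carrier (Ω : Domain) (v : Ω.L2) :
    MemLp (Ω.carrier.indicator v) 2 volume := by
  rw [memLp_indicator_iff_restrict Ω.isOpen_carrier.measurableSet, ← Ω.measure_eq]
  exact Lp.memLp v

theorem integral_smul_indicator_carrier (Ω : Domain) (v : Ω.L2) (φ : ℝ → ℝ) :
    ∫ x, φ x • Ω.carrier.indicator v x = ∫ x, φ x • v x ∂Ω.measure := by
  rw [Ω.integral_measure, ← integral_indicator Ω.isOpen_carrier.measurableSet]
  congr 1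
  funext x
  by_cases hx : x ∈ Ω.carrier <;> simp [hx]

theorem exists_isRegular_of_weak_domain (Ω : Domain) {v w : Ω.L2}
    (h : ∀ φ, IsBump Ω.carrier φ →
      ∫ x, deriv (deriv φ) x • v x ∂Ω.measure = ∫ x, φ x • w x ∂Ω.measure) :
    ∃ V V' : ℝ → ℂ, IsRegular V V' ∧ v =ᵐ[Ω.measure] V ∧ w =ᵐ[Ω.measure] deriv V' ∧
      ∀ x ∈ closure Ω.carrier, ‖V x‖ ≤ Ω.sobolevConst * (‖v‖ + ‖w‖) ∧
        ‖V' x‖ ≤ Ω.sobolevConst * (‖v‖ + ‖w‖) := by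
  have hv : LocallyIntegrable (Ω.carrier.indicator v) volume :=
    (memLp_indicator_carrier Ω v).locallyIntegrable one_le_two
  have hw : LocallyIntegrable (Ω.carrier.indicator w) volume :=
    (memLp_indicator_carrier Ω w).locallyIntegrable one_le_two
  obtain ⟨V, V', hreg, hint, hdd, hvV⟩ := exists_isRegular_of_weak Ω.isOpen_carrier
    Ω.ordConnected_carrier Ω.nonempty_carrier hv hw fun φ hφ => by
      rw [integral_smul_indicator_carrier, integral_smul_indicator_carrier, h φ hφ]
  have hvV' : ∀ᵐ x : ℝ, x ∈ Ω.carrier → v x = V x := by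
    filter_upwards [hvV] with x hx hxU
    rw [← hx hxU, indicator_of_mem hxU]
  have hae : v =ᵐ[Ω.measure] V := by
    exact Ω.ae_measure_iff.2 hvV'
  have hwe : w =ᵐ[Ω.measure] deriv V' := by
    refine Ω.ae_measure_iff.2 ?_
    filter_upwards [hdd] with x hx hxU
    rw [hx, indicator_of_mem hxU]
  refine ⟨V, V', hreg, hae, hwe, fun x hx => ?_⟩
  -- Every point has an interval of one fixed length inside the domain next to it, so the interval
  -- estimates give a constant independent of the point.
  obtain ⟨p, hp, hsub⟩ := Ω.exists_interval hx
  have hℓ := Ω.scale_pos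
  set ℓ := Ω.scale with hℓdef
  have hpq : p < p + ℓ := by linarith
  have hqp : p + ℓ - p = ℓ := by ring
  have hN : ∫ y in p..(p + ℓ), ‖V y‖ ≤ Real.sqrt ℓ * ‖v‖ := by
    rw [intervalIntegral.integral_of_le hpq.le, integral_Ioc_eq_integral_Ioo]
    have := Ω.setIntegral_norm_le hpq hsub v
    rw [hqp] at this
    refine le_of_eq_of_le (setIntegral_congr_ae measurableSet_Ioo ?_) this
    filter_upwards [hvV'] with y hy hyI
    rw [hy (hsub hyI)]
  have hW : ∫ y in p..(p + ℓ), ‖Ω.carrier.indicator w y‖ ≤ Real.sqrt ℓ * ‖w‖ := by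
    rw [intervalIntegral.integral_of_le hpq.le, integral_Ioc_eq_integral_Ioo]
    have := Ω.setIntegral_norm_le hpq hsub w
    rw [hqp] at this
    refine le_of_eq_of_le (setIntegral_congr_fun measurableSet_Ioo fun y hy => ?_) this
    simp only [indicator_of_mem (hsub hy)]
  have hW0 : 0 ≤ ∫ y in p..(p + ℓ), ‖Ω.carrier.indicator w y‖ :=
    intervalIntegral.integral_nonneg hpq.le fun _ _ => norm_nonneg _
  have hs := Real.sqrt_nonneg ℓ
  have hB : ∀ y ∈ Icc p (p + ℓ),
      ‖V' y‖ ≤ (6 / ℓ ^ 2 + 7) * Real.sqrt ℓ * (‖v‖ + ‖w‖) := by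
    intro y hy
    have h1 := hreg.norm_deriv_le hw hint hpq hy
    rw [hqp] at h1
    refine h1.trans ?_
    calc 6 / ℓ ^ 2 * ((∫ y in p..(p + ℓ), ‖V y‖)
            + ℓ ^ 2 * ∫ y in p..(p + ℓ), ‖Ω.carrier.indicator w y‖)
          + ∫ y in p..(p + ℓ), ‖Ω.carrier.indicator w y‖
        ≤ 6 / ℓ ^ 2 * (Real.sqrt ℓ * ‖v‖ + ℓ ^ 2 * (Real.sqrt ℓ * ‖w‖)) + Real.sqrt ℓ * ‖w‖ := by
          gcongr
      _ = 6 / ℓ ^ 2 * (Real.sqrt ℓ * ‖v‖) + 7 * (Real.sqrt ℓ * ‖w‖) := by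
          field_simp
          ring
      _ ≤ (6 / ℓ ^ 2 + 7) * Real.sqrt ℓ * (‖v‖ + ‖w‖) := by
          have e1 : 0 ≤ 7 * (Real.sqrt ℓ * ‖v‖) := by positivity
          have e2 : 0 ≤ 6 / ℓ ^ 2 * (Real.sqrt ℓ * ‖w‖) := by positivity
          linarith [e1, e2]
  have hnn : 0 ≤ ‖v‖ + ‖w‖ := by positivity
  constructor
  · have h1 := hreg.norm_le hpq hB hp
    rw [hqp] at h1
    refine h1.trans ?_
    calc (∫ y in p..(p + ℓ), ‖V y‖) / ℓ + ℓ * ((6 / ℓ ^ 2 + 7) * Real.sqrt ℓ * (‖v‖ + ‖w‖))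
        ≤ (Real.sqrt ℓ * (‖v‖ + ‖w‖)) / ℓ
          + ℓ * ((6 / ℓ ^ 2 + 7) * Real.sqrt ℓ * (‖v‖ + ‖w‖)) := by
          gcongr
          refine hN.trans ?_
          gcongr
          linarith [norm_nonneg w]
      _ = (Real.sqrt ℓ / ℓ + ℓ * ((6 / ℓ ^ 2 + 7) * Real.sqrt ℓ)) * (‖v‖ + ‖w‖) := by ring
      _ ≤ Ω.sobolevConst * (‖v‖ + ‖w‖) := by
          gcongr
          unfold Domain.sobolevConst
          rw [← hℓdef]
          have : 0 ≤ (6 / ℓ ^ 2 + 7) * Real.sqrt ℓ := by positivity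
          linarith
  · refine (hB x hp).trans ?_
    gcongr
    unfold Domain.sobolevConst
    rw [← hℓdef]
    have : 0 ≤ Real.sqrt ℓ / ℓ + ℓ * ((6 / ℓ ^ 2 + 7) * Real.sqrt ℓ) := by positivity
    linarith

theorem IsBump.isRegular {U : Set ℝ} {φ : ℝ → ℝ} (hφ : IsBump U φ) :
    IsRegular (fun x => (φ x : ℂ)) (fun x => ((_root_.deriv φ x : ℝ) : ℂ)) := by
  refine ⟨fun x => ?_, fun p q => ?_⟩
  · exact ((hφ.contDiff.differentiable (by simp)) x).hasDerivAt.ofReal_comp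
  · exact ((hφ.deriv.contDiff_ofReal.of_le (by simp)).contDiffOn
      (s := uIcc p q)).absolutelyContinuousOnInterval

theorem IsBump.boundaryCondition {Ω : Domain} {φ : ℝ → ℝ} (hφ : IsBump Ω.carrier φ) :
    Ω.BoundaryCondition (fun x => (φ x : ℂ)) (fun x => ((_root_.deriv φ x : ℝ) : ℂ)) := by
  have hz : ∀ {g : ℝ → ℝ}, IsBump Ω.carrier g → ∀ x, x ∉ Ω.carrier → (g x : ℂ) = 0 := by
    intro g hg x hx
    rw [image_eq_zero_of_notMem_tsupport fun h => hx (hg.subset h), Complex.ofReal_zero]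
  cases Ω with
  | line =>
    obtain ⟨B₁, h₁⟩ := hφ.compact.exists_bound_of_continuous hφ.contDiff.continuous
    obtain ⟨B₂, h₂⟩ := hφ.deriv.compact.exists_bound_of_continuous hφ.deriv.contDiff.continuous
    refine ⟨max B₁ B₂, fun x => ⟨?_, ?_⟩⟩
    · rw [Complex.norm_real]
      exact (h₁ x).trans (le_max_left _ _)
    · rw [Complex.norm_real]
      exact (h₂ x).trans (le_max_right _ _)
  | dirichlet a b hab =>
    exact ⟨hz hφ a (by simp [Domain.carrier]), hz hφ b (by simp [Domain.carrier])⟩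
  | periodic a b hab =>
    have ha : a ∉ (Domain.periodic a b hab).carrier := by simp [Domain.carrier]
    have hb : b ∉ (Domain.periodic a b hab).carrier := by simp [Domain.carrier]
    exact ⟨(hz hφ a ha).trans (hz hφ b hb).symm, (hz hφ.deriv a ha).trans (hz hφ.deriv b hb).symm⟩

theorem IsBump.memLp {U : Set ℝ} {φ : ℝ → ℝ} (hφ : IsBump U φ) (Ω : Domain) :
    MemLp (fun x => (φ x : ℂ)) 2 Ω.measure := by
  have h : MemLp (fun x => (φ x : ℂ)) 2 volume :=
    (Complex.continuous_ofReal.comp hφ.contDiff.continuous).memLp_of_hasCompactSupport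
      (hφ.compact.comp_left Complex.ofReal_zero)
  rw [Ω.measure_eq]
  exact h.restrict _

theorem IsBump.gen {Ω : Domain} {φ : ℝ → ℝ} (hφ : IsBump Ω.carrier φ) :
    Ω.flow.Gen ((hφ.memLp Ω).toLp _) ((hφ.deriv.deriv.memLp Ω).toLp _) := by
  refine gen_of_isRegular Ω hφ.isRegular hφ.boundaryCondition (MemLp.coeFn_toLp _) ?_
  rw [hφ.deriv.deriv_ofReal]
  exact MemLp.coeFn_toLp _

/-- Symmetry of the generator against a mode, compared with Green's formula, forces the boundary
terms to cancel. The first two Dirichlet modes, or the periodic modes 0 and 1, already determine the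
boundary condition; on the line it is the assumed bound. -/
theorem boundaryCondition_of_gen {Ω : Domain} {v w : Ω.L2} (h : Ω.flow.Gen v w) {V V' : ℝ → ℂ}
    (hreg : IsRegular V V') (hv : v =ᵐ[Ω.measure] V) (hw : w =ᵐ[Ω.measure] deriv V')
    (hB : ∃ B, ∀ x ∈ closure Ω.carrier, ‖V x‖ ≤ B ∧ ‖V' x‖ ≤ B) : Ω.BoundaryCondition V V' := by
  match Ω, v, w with
  | .line, v, w =>
    obtain ⟨B, hB⟩ := hB
    exact ⟨B, fun x => hB x (by simp [Domain.carrier])⟩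
  | .dirichlet a b hab, v, w =>
    have hL : 0 < b - a := sub_pos.2 hab
    have key : ∀ k : ℕ, V b * deriv (dirichletMode a b k) b = V a * deriv (dirichletMode a b k) a := by
      intro k
      have hc : (Domain.dirichlet a b hab).flow.Gen ((memLp_dirichletMode a b k).toLp _)
          (-((((k + 1) * Real.pi / (b - a)) ^ 2 : ℝ) : ℂ) • (memLp_dirichletMode a b k).toLp _) :=
        UnitaryFlow.core_hasDerivAt _ (_, _) (mem_range_self k)
      have h1 := hc.inner_eq h
      have h2 := (inner_smul_dirichletMode k v).symm.trans (h1.trans (inner_dirichletMode k w))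
      have h3 := add_eq_right.1 ((hreg.setIntegral_deriv_deriv_mul hab
        (contDiff_dirichletMode a b k) hv hw).symm.trans h2)
      rw [dirichletMode_left, dirichletMode_right hab, mul_zero, mul_zero, sub_zero,
        sub_zero, sub_eq_zero] at h3
      exact h3
    have hs : Real.sqrt (2 / (b - a)) ≠ 0 := (Real.sqrt_pos.2 (by positivity)).ne'
    -- The factors cos π = -1 and cos 2π = 1 give -V b = V a from the first mode and V b = V a from
    -- the second.
    have h0 := key 0
    have h1 := key 1
    have c1 : (((0 : ℕ) : ℝ) + 1) * Real.pi * (b - a) / (b - a) = Real.pi := by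
      field_simp; simp
    have c2 : (((1 : ℕ) : ℝ) + 1) * Real.pi * (b - a) / (b - a) = 2 * Real.pi := by
      field_simp; norm_num
    simp only [deriv_dirichletMode, c1, c2, sub_self, mul_zero, zero_div, Real.cos_zero,
      Real.cos_pi, Real.cos_two_pi, mul_one] at h0 h1
    have e0 : ((Real.sqrt (2 / (b - a)) * ((((0 : ℕ) : ℝ) + 1) * Real.pi / (b - a)) : ℝ) : ℂ) ≠ 0 := by
      refine Complex.ofReal_ne_zero.2 (mul_ne_zero hs (div_ne_zero (mul_ne_zero ?_
        Real.pi_ne_zero) hL.ne'))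
      norm_num
    have e1 : ((Real.sqrt (2 / (b - a)) * ((((1 : ℕ) : ℝ) + 1) * Real.pi / (b - a)) : ℝ) : ℂ) ≠ 0 := by
      refine Complex.ofReal_ne_zero.2 (mul_ne_zero hs (div_ne_zero (mul_ne_zero ?_
        Real.pi_ne_zero) hL.ne'))
      norm_num
    have f1 := mul_right_cancel₀ e1 h1
    rw [f1, mul_neg, mul_neg, mul_one, Complex.ofReal_neg, mul_neg, neg_eq_iff_add_eq_zero,
      ← two_mul, mul_eq_zero, mul_eq_zero] at h0
    have f0 : V a = 0 := by
      rcases h0 with h | h | h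
      · norm_num at h
      · exact h
      · exact absurd h e0
    exact ⟨f0, f1.trans f0⟩
  | .periodic a b hab, v, w =>
    have hL : 0 < b - a := sub_pos.2 hab
    have key : ∀ k : ℤ, V b * deriv (periodicMode a b k) b - V' b * periodicMode a b k b
        = V a * deriv (periodicMode a b k) a - V' a * periodicMode a b k a := by
      intro k
      have hc : (Domain.periodic a b hab).flow.Gen ((memLp_periodicMode a b (-k)).toLp _)
          (-(((2 * Real.pi * (-k : ℤ) / (b - a)) ^ 2 : ℝ) : ℂ) •
            (memLp_periodicMode a b (-k)).toLp _) :=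
        UnitaryFlow.core_hasDerivAt _ (_, _) (mem_range_self (-k))
      have h1 := hc.inner_eq h
      have h2 := (inner_smul_periodicMode (-k) v).symm.trans
        (h1.trans (inner_periodicMode (-k) w))
      have h3 := add_eq_right.1 ((hreg.setIntegral_deriv_deriv_mul hab
        (contDiff_periodicMode a b (- -k)) hv hw).symm.trans h2)
      rw [neg_neg, sub_eq_zero] at h3
      exact h3
    -- The constant mode matches V' at the endpoints; the mode with k = 1 then matches V.
    have h0 := key 0
    have h1 := key 1
    simp only [deriv_periodicMode, periodicMode_left_eq_right hab] at h0 h1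
    have n0 := periodicMode_ne_zero hab 0 a
    have n1 := periodicMode_ne_zero hab 1 a
    have e0 : V' b = V' a := by
      have : V' b * periodicMode a b 0 a = V' a * periodicMode a b 0 a := by simpa using h0
      exact mul_right_cancel₀ n0 this
    have hd : ((2 * Real.pi * (1 : ℤ) / (b - a) : ℝ) : ℂ) * Complex.I * periodicMode a b 1 a ≠ 0 := by
      refine mul_ne_zero (mul_ne_zero (Complex.ofReal_ne_zero.2 (div_ne_zero ?_ hL.ne'))
        Complex.I_ne_zero) n1
      simp [Real.pi_ne_zero]
    rw [e0, sub_left_inj] at h1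
    exact ⟨(mul_right_cancel₀ hd h1).symm, e0.symm⟩

/-- Elements of the domain of the generator have regular representatives, with the boundary
condition and a Sobolev bound. -/
theorem exists_isRegular_of_gen {Ω : Domain} {v w : Ω.L2} (h : Ω.flow.Gen v w) :
    ∃ V V' : ℝ → ℂ, IsRegular V V' ∧ v =ᵐ[Ω.measure] V ∧ w =ᵐ[Ω.measure] deriv V' ∧
      Ω.BoundaryCondition V V' ∧
      ∀ x ∈ closure Ω.carrier, ‖V x‖ ≤ Ω.sobolevConst * (‖v‖ + ‖w‖) ∧
        ‖V' x‖ ≤ Ω.sobolevConst * (‖v‖ + ‖w‖) := by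
  obtain ⟨V, V', hreg, hv, hw, hB⟩ := exists_isRegular_of_weak_domain Ω fun φ hφ => by
    have h1 := (hφ.gen (Ω := Ω)).inner_eq h
    rw [inner_toLp_left, inner_toLp_left] at h1
    simpa only [Complex.conj_ofReal, ← Complex.real_smul] using h1
  exact ⟨V, V', hreg, hv, hw, boundaryCondition_of_gen h hreg hv hw ⟨_, hB⟩, hB⟩

/-! ### Weak derivatives and the generator -/

theorem IsRegular.integral_deriv_smul {V V' : ℝ → ℂ} (h : IsRegular V V') {U : Set ℝ} {φ : ℝ → ℝ}
    (hφ : IsBump U φ) : ∫ x, deriv φ x • V x = -∫ x, φ x • V' x := by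
  have hc := h.continuous
  have hc' := h.continuous_deriv
  have := integral_mul_deriv_eq_deriv_mul_of_integrable (u := V) (u' := V')
    (v := fun x => (φ x : ℂ)) (v' := fun x => ((deriv φ x : ℝ) : ℂ))
    (fun x _ => h.hasDerivAt x) (fun x _ => hφ.isRegular.hasDerivAt x) ?_ ?_ ?_
  · simpa only [Complex.real_smul, mul_comm] using this
  · simpa only [Complex.real_smul, mul_comm] using! hφ.deriv.integrable_smul hc.locallyIntegrable
  · simpa only [Complex.real_smul, mul_comm] using! hφ.integrable_smul hc'.locallyIntegrable
  · simpa only [Complex.real_smul, mul_comm] using! hφ.integrable_smul hc.locallyIntegrable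

/-- A weak first derivative agrees with the derivative of a regular representative. -/
theorem ae_eq_deriv_of_weak (Ω : Domain) {V V' : ℝ → ℂ} (h : IsRegular V V') {v g : Ω.L2}
    (hv : v =ᵐ[Ω.measure] V)
    (hw : ∀ φ, IsBump Ω.carrier φ →
      ∫ x, deriv φ x • v x ∂Ω.measure = -∫ x, φ x • g x ∂Ω.measure) :
    g =ᵐ[Ω.measure] V' := by
  have hg : LocallyIntegrable (Ω.carrier.indicator g) volume :=
    (memLp_indicator_carrier Ω g).locallyIntegrable one_le_two
  have hV' : LocallyIntegrable V' volume := h.continuous_deriv.locallyIntegrable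
  have hz := Ω.isOpen_carrier.ae_eq_zero_of_integral_contDiff_smul_eq_zero
    ((hg.sub hV').locallyIntegrableOn _) fun φ h1 h2 h3 => by
      have hφ : IsBump Ω.carrier φ := ⟨h1, h2, h3⟩
      simp only [Pi.sub_apply, smul_sub]
      rw [integral_sub (hφ.integrable_smul hg) (hφ.integrable_smul hV'),
        integral_smul_indicator_carrier, sub_eq_zero, ← neg_inj, ← hw φ hφ,
        ← h.integral_deriv_smul hφ, ← integral_smul_indicator_carrier]
      refine integral_congr_ae ?_
      filter_upwards [Ω.ae_measure_iff.1 hv] with x hx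
      by_cases hxU : x ∈ Ω.carrier
      · rw [indicator_of_mem hxU, hx hxU]
      · have : deriv φ x = 0 := image_eq_zero_of_notMem_tsupport fun h => hxU (hφ.deriv.subset h)
        rw [this, zero_smul, zero_smul]
  refine Ω.ae_measure_iff.2 ?_
  filter_upwards [hz] with x hx hxU
  have := hx hxU
  rw [Pi.sub_apply, indicator_of_mem hxU, sub_eq_zero] at this
  exact this

theorem Domain.IsTest.contDiff {Ω : Domain} {φ : ℝ → ℂ} (h : Ω.IsTest φ) : ContDiff ℝ ∞ φ := by
  cases Ω <;> exact h.1

theorem Domain.IsTest.deriv {Ω : Domain} {φ : ℝ → ℂ} (h : Ω.IsTest φ) : Ω.IsTest (deriv φ) := by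
  have hd : ContDiff ℝ ∞ (_root_.deriv φ) := (contDiff_infty_iff_deriv.1 h.contDiff).2
  cases Ω with
  | line => exact ⟨hd, h.2.deriv⟩
  | dirichlet a b hab => exact ⟨hd, h.2.1.deriv, (tsupport_deriv_subset (𝕜 := ℝ)).trans h.2.2⟩
  | periodic a b hab =>
    refine ⟨hd, fun x => ?_⟩
    have : (fun y => φ (y + (b - a))) = φ := funext h.2
    rw [← deriv_comp_add_const, this]

theorem Domain.HasWeakDeriv.integral_deriv_deriv {Ω : Domain} {v g₁ g₂ : Ω.L2}
    (h₁ : Ω.HasWeakDeriv v g₁) (h₂ : Ω.HasWeakDeriv g₁ g₂) {φ : ℝ → ℂ} (hφ : Ω.IsTest φ) :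
    ∫ x, v x * _root_.deriv (_root_.deriv φ) x ∂Ω.measure = ∫ x, g₂ x * φ x ∂Ω.measure := by
  rw [h₁ _ hφ.deriv, h₂ _ hφ, neg_neg]

/-- The hypothesis `ht` is stated separately because it holds on the line and in the Dirichlet case
only: a nonzero bump is not periodic as a function on ℝ. -/
theorem weak_of_isTest {Ω : Domain} (ht : ∀ φ, IsBump Ω.carrier φ → Ω.IsTest fun x => (φ x : ℂ))
    {v g₁ g₂ : Ω.L2} (h₁ : Ω.HasWeakDeriv v g₁) (h₂ : Ω.HasWeakDeriv g₁ g₂) {φ : ℝ → ℝ}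
    (hφ : IsBump Ω.carrier φ) :
    ∫ x, deriv (deriv φ) x • v x ∂Ω.measure = ∫ x, φ x • g₂ x ∂Ω.measure := by
  have := h₁.integral_deriv_deriv h₂ (ht φ hφ)
  rw [hφ.deriv_ofReal, hφ.deriv.deriv_ofReal] at this
  simpa only [Complex.real_smul, mul_comm] using this

theorem weak_one_of_isTest {Ω : Domain}
    (ht : ∀ φ, IsBump Ω.carrier φ → Ω.IsTest fun x => (φ x : ℂ))
    {v g : Ω.L2} (h : Ω.HasWeakDeriv v g) {φ : ℝ → ℝ} (hφ : IsBump Ω.carrier φ) :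
    ∫ x, deriv φ x • v x ∂Ω.measure = -∫ x, φ x • g x ∂Ω.measure := by
  have := h _ (ht φ hφ)
  rw [hφ.deriv_ofReal] at this
  simpa only [Complex.real_smul, mul_comm] using this

theorem IsBump.isTest_line {φ : ℝ → ℝ} (hφ : IsBump Domain.line.carrier φ) :
    Domain.line.IsTest fun x => (φ x : ℂ) :=
  ⟨hφ.contDiff_ofReal, hφ.compact.comp_left Complex.ofReal_zero⟩

theorem IsBump.isTest_dirichlet {a b : ℝ} {hab : a < b} {φ : ℝ → ℝ}
    (hφ : IsBump (Domain.dirichlet a b hab).carrier φ) :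
    (Domain.dirichlet a b hab).IsTest fun x => (φ x : ℂ) :=
  ⟨hφ.contDiff_ofReal, hφ.compact.comp_left Complex.ofReal_zero,
    (closure_mono fun x hx => by simpa using hx).trans hφ.subset⟩

theorem tendsto_integral_mul_of_eLpNorm {μ : Measure ℝ} {F : ℕ → ℝ → ℂ} {f χ : ℝ → ℂ}
    (hF : ∀ j, MemLp (F j) 2 μ) (hf : MemLp f 2 μ) (hχ : MemLp χ 2 μ)
    (h : Tendsto (fun j => eLpNorm (fun x => F j x - f x) 2 μ) atTop (𝓝 0)) :
    Tendsto (fun j => ∫ x, F j x * χ x ∂μ) atTop (𝓝 (∫ x, f x * χ x ∂μ)) := by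
  refine tendsto_integral_of_L1' _ (hf.aestronglyMeasurable.mul hχ.aestronglyMeasurable)
    (Eventually.of_forall fun j => MemLp.integrable_mul (p := 2) (q := 2) (hF j) hχ) ?_
  have hlim : Tendsto (fun j => eLpNorm (fun x => F j x - f x) 2 μ * eLpNorm χ 2 μ) atTop (𝓝 0) := by
    have := ENNReal.Tendsto.mul_const h (Or.inr hχ.eLpNorm_ne_top)
    rwa [zero_mul] at this
  refine tendsto_of_tendsto_of_tendsto_of_le_of_le tendsto_const_nhds hlim
    (fun _ => zero_le) fun j => ?_
  have := eLpNorm_smul_le_mul_eLpNorm (p := 2) (q := 2) (r := 1) hχ.aestronglyMeasurable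
    ((hF j).sub hf).aestronglyMeasurable
  refine le_of_eq_of_le ?_ this
  congr 1
  funext x
  simp [sub_mul]

theorem memLp_Ioo_of_continuous {a b : ℝ} {f : ℝ → ℂ} (hf : Continuous f) :
    MemLp f 2 (volume.restrict (Ioo a b)) := by
  obtain ⟨C, hC⟩ := (isCompact_Icc (a := a) (b := b)).exists_bound_of_continuousOn hf.continuousOn
  refine MemLp.of_bound hf.aestronglyMeasurable C ?_
  filter_upwards [ae_restrict_mem measurableSet_Ioo] with x hx
  exact hC x (Ioo_subset_Icc_self hx)

/-- In the Dirichlet case the functions of the energy space may be integrated by parts against all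
smooth functions. -/
theorem exists_integral_mul_deriv_of_energy {a b : ℝ} (hab : a < b)
    {v : (Domain.dirichlet a b hab).L2} (h : (Domain.dirichlet a b hab).MemEnergySpace v) :
    ∃ g : (Domain.dirichlet a b hab).L2, ∀ χ : ℝ → ℂ, ContDiff ℝ ∞ χ →
      ∫ x, v x * deriv χ x ∂(Domain.dirichlet a b hab).measure
        = -∫ x, g x * χ x ∂(Domain.dirichlet a b hab).measure := by
  obtain ⟨g, φ, htest, h0, h1⟩ := h
  refine ⟨g, fun χ hχ => ?_⟩
  have hχ' : Continuous (deriv χ) := hχ.continuous_deriv (by simp)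
  have l0 := tendsto_integral_mul_of_eLpNorm
    (fun j => memLp_Ioo_of_continuous (htest j).contDiff.continuous) (Lp.memLp v)
    (memLp_Ioo_of_continuous hχ') h0
  have l1 := (tendsto_integral_mul_of_eLpNorm
    (fun j => memLp_Ioo_of_continuous (htest j).deriv.contDiff.continuous) (Lp.memLp g)
    (memLp_Ioo_of_continuous hχ.continuous) h1).neg
  -- The approximating test functions vanish at both endpoints, so no boundary term appears although
  -- χ is arbitrary there.
  refine tendsto_nhds_unique l0 (l1.congr fun j => ?_)
  have hac : AbsolutelyContinuousOnInterval (φ j) a b :=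
    (((htest j).contDiff.of_le (by simp)).contDiffOn (s := uIcc a b)).absolutelyContinuousOnInterval
  have hparts := hac.integral_mul_deriv_eq_sub hχ
  have hz : ∀ x, x ∉ Ioo a b → φ j x = 0 := fun x hx =>
    image_eq_zero_of_notMem_tsupport fun h => hx ((htest j).2.2 h)
  rw [hz a (by simp), hz b (by simp), zero_mul, zero_mul, sub_zero, zero_sub,
    intervalIntegral.integral_of_le hab.le, intervalIntegral.integral_of_le hab.le,
    integral_Ioc_eq_integral_Ioo, integral_Ioc_eq_integral_Ioo] at hparts
  exact hparts.symm

/-- Integration by parts without boundary terms, compared with the classical formula for V, gives V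
b χ(b) = V a χ(a) for every smooth χ. Taking χ = x - a and χ = x - b isolates the two endpoints. -/
theorem boundary_zero_of_energy {a b : ℝ} (hab : a < b)
    {v : (Domain.dirichlet a b hab).L2} (h : (Domain.dirichlet a b hab).MemEnergySpace v)
    {V V' : ℝ → ℂ} (hreg : IsRegular V V') (hv : v =ᵐ[(Domain.dirichlet a b hab).measure] V) :
    V a = 0 ∧ V b = 0 := by
  obtain ⟨g, hg⟩ := exists_integral_mul_deriv_of_energy hab h
  have hgV : g =ᵐ[(Domain.dirichlet a b hab).measure] V' := by
    refine ae_eq_deriv_of_weak _ hreg hv fun φ hφ => ?_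
    have := hg _ hφ.contDiff_ofReal
    rw [hφ.deriv_ofReal] at this
    simpa only [Complex.real_smul, mul_comm] using this
  have hd : deriv V = V' := funext fun x => (hreg.hasDerivAt x).deriv
  have key : ∀ χ : ℝ → ℂ, ContDiff ℝ ∞ χ → V b * χ b = V a * χ a := by
    intro χ hχ
    have h1 := (hreg.ac_self a b).integral_mul_deriv_eq_sub hχ
    rw [intervalIntegral.integral_of_le hab.le, intervalIntegral.integral_of_le hab.le,
      integral_Ioc_eq_integral_Ioo, integral_Ioc_eq_integral_Ioo, hd] at h1
    have h2 : ∫ x in Ioo a b, V x * deriv χ x = -∫ x in Ioo a b, V' x * χ x := by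
      refine .trans (integral_congr_ae ?_) ((hg χ hχ).trans (congrArg _ (integral_congr_ae ?_)))
      · filter_upwards [hv] with x hx
        rw [hx]
      · filter_upwards [hgV] with x hx
        rw [hx]
    rw [h2] at h1
    linear_combination -h1
  have hne : ((b - a : ℝ) : ℂ) ≠ 0 := Complex.ofReal_ne_zero.2 (sub_pos.2 hab).ne'
  have hsm : ∀ c : ℝ, ContDiff ℝ ∞ fun x : ℝ => ((x - c : ℝ) : ℂ) := fun c =>
    Complex.ofRealCLM.contDiff.comp (contDiff_id.sub contDiff_const)
  have k1 := key _ (hsm a)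
  have k2 := key _ (hsm b)
  simp only [sub_self, Complex.ofReal_zero, mul_zero] at k1 k2
  have hne' : ((a - b : ℝ) : ℂ) ≠ 0 := Complex.ofReal_ne_zero.2 (sub_neg.2 hab).ne
  exact ⟨(mul_eq_zero.1 k2.symm).resolve_right hne', (mul_eq_zero.1 k1).resolve_right hne⟩

/-- A function of the energy space with two weak derivatives is in the domain of the generator. -/
theorem gen_of_hasWeakDeriv {Ω : Domain} {v g₁ g₂ : Ω.L2} (he : Ω.MemEnergySpace v)
    (h₁ : Ω.HasWeakDeriv v g₁) (h₂ : Ω.HasWeakDeriv g₁ g₂) : Ω.flow.Gen v g₂ := by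
  match Ω, v, g₁, g₂ with
  | .line, v, g₁, g₂ =>
    obtain ⟨V, V', hreg, hv, hw, hB⟩ := exists_isRegular_of_weak_domain Domain.line
      fun φ hφ => weak_of_isTest (fun _ h => h.isTest_line) h₁ h₂ hφ
    exact gen_of_isRegular Domain.line hreg ⟨_, fun x => hB x (by simp [Domain.carrier])⟩ hv hw
  | .dirichlet a b hab, v, g₁, g₂ =>
    obtain ⟨V, V', hreg, hv, hw, hB⟩ := exists_isRegular_of_weak_domain (Domain.dirichlet a b hab)
      fun φ hφ => weak_of_isTest (fun _ h => h.isTest_dirichlet) h₁ h₂ hφ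
    exact gen_of_isRegular (Domain.dirichlet a b hab) hreg (boundary_zero_of_energy hab he hreg hv) hv hw
  | .periodic a b hab, v, g₁, g₂ =>
    refine UnitaryFlow.gen_of_core ?_
    rintro _ ⟨k, rfl⟩
    -- Periodic modes are themselves admissible test functions, so the core can be tested directly.
    -- Dirichlet modes are not compactly supported, which is why that case passes through a
    -- representative and its boundary values.
    have := h₁.integral_deriv_deriv h₂ (φ := periodicMode a b (-k))
      ⟨contDiff_periodicMode a b (-k), periodic_periodicMode hab (-k)⟩
    simp only [mul_comm (v _), mul_comm (g₂ _)] at this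
    exact (inner_smul_periodicMode k v).trans (this.trans (inner_periodicMode k g₂).symm)

theorem norm_le_of_ae_bound_interval {a b : ℝ} (hab : a < b) {f : ℝ → ℂ}
    (hf : MemLp f 2 (volume.restrict (Ioo a b))) {B : ℝ} (hB : ∀ x ∈ Ioo a b, ‖f x‖ ≤ B) :
    ‖hf.toLp f‖ ≤ Real.sqrt (b - a) * B := by
  have hL : 0 < b - a := sub_pos.2 hab
  have hB0 : 0 ≤ B := (norm_nonneg _).trans (hB ((a + b) / 2) ⟨by linarith, by linarith⟩)
  have h1 := eLpNorm_le_of_ae_bound (p := 2) (μ := volume.restrict (Ioo a b)) (f := f) (C := B)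
    (by filter_upwards [ae_restrict_mem measurableSet_Ioo] with x hx using hB x hx)
  rw [Lp.norm_toLp]
  refine (ENNReal.toReal_mono ?_ h1).trans (le_of_eq ?_)
  · refine ENNReal.mul_ne_top (ENNReal.rpow_ne_top_of_nonneg (by positivity) ?_)
      ENNReal.ofReal_ne_top
    simp
  · rw [ENNReal.toReal_mul, ENNReal.toReal_ofReal hB0, ← ENNReal.toReal_rpow]
    simp only [MeasurableSet.univ, Measure.restrict_apply, univ_inter, Real.volume_Ioo,
      ENNReal.toReal_ofReal hL.le, ENNReal.toReal_ofNat]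
    rw [Real.sqrt_eq_rpow, one_div]

/-- The derivative of the regular representative is square integrable. -/
theorem exists_Lp_deriv {Ω : Domain} {v g : Ω.L2} (hg : Ω.HasWeakDeriv v g) {V V' : ℝ → ℂ}
    (hreg : IsRegular V V') (hv : v =ᵐ[Ω.measure] V) {B : ℝ} (hB0 : 0 ≤ B)
    (hB : ∀ x ∈ closure Ω.carrier, ‖V' x‖ ≤ B) :
    ∃ D : Ω.L2, D =ᵐ[Ω.measure] V' ∧ ‖D‖ ≤ ‖g‖ + Real.sqrt Ω.scale * B := by
  match Ω, v, g with
  | .line, v, g =>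
    -- On the line a sup bound gives no L² bound, so the weak derivative itself is used; on bounded
    -- intervals the sup bound on V' suffices.
    refine ⟨g, ae_eq_deriv_of_weak _ hreg hv fun φ hφ =>
      weak_one_of_isTest (fun _ h => h.isTest_line) hg hφ, ?_⟩
    have := Real.sqrt_nonneg Domain.line.scale
    nlinarith
  | .dirichlet a b hab, v, g =>
    have hm := memLp_Ioo_of_continuous (a := a) (b := b) hreg.continuous_deriv
    refine ⟨hm.toLp _, hm.coeFn_toLp, ?_⟩
    refine (norm_le_of_ae_bound_interval hab hm fun x hx => hB x (subset_closure hx)).trans ?_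
    exact le_add_of_nonneg_left (norm_nonneg g)
  | .periodic a b hab, v, g =>
    have hm := memLp_Ioo_of_continuous (a := a) (b := b) hreg.continuous_deriv
    refine ⟨hm.toLp _, hm.coeFn_toLp, ?_⟩
    refine (norm_le_of_ae_bound_interval hab hm fun x hx => hB x (subset_closure hx)).trans ?_
    exact le_add_of_nonneg_left (norm_nonneg g)

/-! ### The nonlinearity in the domain of the generator -/

/-- The nonlinearity and its derivative at a point depend only on V and V' there, and the
nonlinearity has V as a factor. On the line any bound will do, so its dependence on ε is harmless.
-/
theorem boundaryCondition_nonlin {Ω : Domain} {n : ℕ} (hn : 2 ≤ n) {ε : ℝ} (hε : 0 < ε)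
    (hε1 : ε ≤ 1) {V V' : ℝ → ℂ} (h : Ω.BoundaryCondition V V') :
    Ω.BoundaryCondition (fun x => V x * (fReg n ε (‖V x‖ ^ 2) : ℂ)) (nonlinDeriv n ε V V') := by
  cases Ω with
  | line =>
    obtain ⟨B, hB⟩ := h
    have hB0 : 0 ≤ B := (norm_nonneg _).trans (hB 0).1
    set A := growthConst n (max 1 B) / √ε
    have hf : ∀ x, ‖((fReg n ε (‖V x‖ ^ 2) : ℝ) : ℂ)‖ ≤ A := by
      intro x
      rw [Complex.norm_real]
      refine abs_fReg_le hn hε hε1 (le_max_left _ _) (sq_nonneg _) ?_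
      gcongr
      exact (hB x).1.trans (le_max_right _ _)
    have hA0 : 0 ≤ A := (norm_nonneg _).trans (hf 0)
    have hd : ∀ x, fRegDeriv n ε (‖V x‖ ^ 2) ≤ 2 * n / ε ^ 2 := fun x =>
      (fRegDeriv_le hn hε (sq_nonneg _)).trans (by gcongr; exact le_max_right _ _)
    refine ⟨max (B * A) (A * B + 2 * n / ε ^ 2 * (2 * (B * B)) * B), fun x => ⟨?_, ?_⟩⟩
    · refine le_trans ?_ (le_max_left _ _)
      rw [norm_mul]
      exact mul_le_mul (hB x).1 (hf x) (norm_nonneg _) hB0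
    · refine le_trans ?_ (le_max_right _ _)
      unfold nonlinDeriv
      refine (norm_add_le _ _).trans (add_le_add ?_ ?_)
      · rw [norm_mul]
        exact mul_le_mul (hf x) (hB x).2 (norm_nonneg _) hA0
      · rw [norm_mul, Complex.norm_real, norm_mul, norm_mul, Real.norm_of_nonneg
          (fRegDeriv_nonneg n ε (sq_nonneg _)), Real.norm_of_nonneg (zero_le_two (α := ℝ))]
        have hin : ‖inner ℝ (V x) (V' x)‖ ≤ B * B :=
          (norm_inner_le_norm _ _).trans (mul_le_mul (hB x).1 (hB x).2 (norm_nonneg _) hB0)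
        have h0 := fRegDeriv_nonneg n ε (sq_nonneg ‖V x‖)
        gcongr
        · exact hd x
        · exact (hB x).1
  | dirichlet a b hab =>
    refine ⟨?_, ?_⟩
    · simp only [h.1, zero_mul]
    · simp only [h.2, zero_mul]
  | periodic a b hab =>
    refine ⟨?_, ?_⟩
    · simp only [h.1]
    · simp only [nonlinDeriv, h.1, h.2]

/-- The bound for the generator applied to the nonlinearity. -/
def Domain.nonlinConst (Ω : Domain) (n : ℕ) (K M : ℝ) : ℝ :=
  curvConst n * K * (M + Real.sqrt Ω.scale * K) + (growthConst n K + 4 * n) * M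

/-- The choice of K puts the Sobolev bound of v below the truncation level, so the truncated
nonlinearity is the true one on the representative. In the pointwise estimate of its second
derivative, |V'|² is split into one factor in L^∞, bounded by K, and one in L². This produces the
single power 1/ε of the theorem. -/
theorem exists_gen_nonlin {Ω : Domain} {n : ℕ} (hn : 2 ≤ n) {ε : ℝ} (hε : 0 < ε) (hε1 : ε ≤ 1)
    {M K : ℝ} (hK : 1 ≤ K) (hMK : Ω.sobolevConst * (2 * M) ≤ K) {v g w : Ω.L2}
    (hgen : Ω.flow.Gen v w) (hg : Ω.HasWeakDeriv v g) (hvM : ‖v‖ ≤ M) (hgM : ‖g‖ ≤ M)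
    (hwM : ‖w‖ ≤ M) {F : Ω.L2} (hF : F =ᵐ[Ω.measure] fun x => nonlin n ε K (v x)) :
    ∃ G : Ω.L2, Ω.flow.Gen F G ∧ ‖G‖ ≤ Ω.nonlinConst n K M / ε := by
  obtain ⟨V, V', hreg, hv, hw, hbc, hB⟩ := exists_isRegular_of_gen hgen
  have hK0 : 0 ≤ K := zero_le_one.trans hK
  have hM : 0 ≤ M := (norm_nonneg v).trans hvM
  have hBK : Ω.sobolevConst * (‖v‖ + ‖w‖) ≤ K := by
    refine le_trans ?_ hMK
    have := Ω.sobolevConst_nonneg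
    gcongr
    linarith
  have hVK : ∀ x ∈ closure Ω.carrier, ‖V x‖ ≤ K := fun x hx => (hB x hx).1.trans hBK
  have hV'K : ∀ x ∈ closure Ω.carrier, ‖V' x‖ ≤ K := fun x hx => (hB x hx).2.trans hBK
  obtain ⟨D, hD, hDn⟩ := exists_Lp_deriv hg hreg hv hK0 hV'K
  have hmem : ∀ᵐ x ∂Ω.measure, x ∈ Ω.carrier := Ω.ae_measure_iff.2 (ae_of_all _ fun _ h => h)
  have hA : 0 ≤ growthConst n K / √ε + 4 * n := by
    have := one_le_growthConst n hK
    positivity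
  have hc := curvConst_nonneg n
  have hbound : ∀ᵐ x ∂Ω.measure, ‖deriv (nonlinDeriv n ε V V') x‖
      ≤ curvConst n / ε * K * ‖D x‖ + (growthConst n K / √ε + 4 * n) * ‖w x‖ := by
    filter_upwards [Ω.ae_measure_of_ae (hreg.ae_norm_deriv_nonlinDeriv_le hn hε), hD, hw,
      hmem] with x h1 h2 h3 h4
    rw [h2, h3]
    refine h1.trans (add_le_add ?_ ?_)
    · rw [mul_assoc, sq]
      gcongr
      exact hV'K x (subset_closure h4)
    · gcongr
      refine abs_fReg_le hn hε hε1 hK (sq_nonneg _) ?_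
      gcongr
      exact hVK x (subset_closure h4)
  have hmemD : MemLp (fun x => curvConst n / ε * K * ‖D x‖) 2 Ω.measure :=
    (Lp.memLp D).norm.const_mul _
  have hmemw : MemLp (fun x => (growthConst n K / √ε + 4 * n) * ‖w x‖) 2 Ω.measure :=
    (Lp.memLp w).norm.const_mul _
  have hmeas : AEStronglyMeasurable (deriv (nonlinDeriv n ε V V')) Ω.measure :=
    (measurable_deriv _).aestronglyMeasurable
  have hG : MemLp (deriv (nonlinDeriv n ε V V')) 2 Ω.measure := by
    refine (hmemD.add hmemw).mono hmeas ?_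
    filter_upwards [hbound] with x hx
    exact hx.trans (le_abs_self _)
  refine ⟨hG.toLp _, ?_, ?_⟩
  · refine gen_of_isRegular Ω (hreg.nonlin hn hε) (boundaryCondition_nonlin hn hε hε1 hbc) ?_
      hG.coeFn_toLp
    filter_upwards [hF, hv, hmem] with x h1 h2 h3
    rw [h1, h2, nonlin_of_norm_le (hVK x (subset_closure h3))]
  · have e1 : eLpNorm (deriv (nonlinDeriv n ε V V')) 2 Ω.measure
        ≤ ENNReal.ofReal (curvConst n / ε * K) * eLpNorm D 2 Ω.measure
          + ENNReal.ofReal (growthConst n K / √ε + 4 * n) * eLpNorm w 2 Ω.measure := by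
      calc eLpNorm (deriv (nonlinDeriv n ε V V')) 2 Ω.measure
          ≤ eLpNorm ((fun x => curvConst n / ε * K * ‖D x‖)
              + fun x => (growthConst n K / √ε + 4 * n) * ‖w x‖) 2 Ω.measure :=
            eLpNorm_mono_ae_real hbound
        _ ≤ eLpNorm (fun x => curvConst n / ε * K * ‖D x‖) 2 Ω.measure
            + eLpNorm (fun x => (growthConst n K / √ε + 4 * n) * ‖w x‖) 2 Ω.measure :=
            eLpNorm_add_le hmemD.aestronglyMeasurable hmemw.aestronglyMeasurable (by norm_num)
        _ ≤ _ := by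
            refine add_le_add ?_ ?_
            · refine eLpNorm_le_mul_eLpNorm_of_ae_le_mul (ae_of_all _ fun x => ?_) 2
              rw [norm_mul, norm_norm, Real.norm_of_nonneg (by positivity)]
            · refine eLpNorm_le_mul_eLpNorm_of_ae_le_mul (ae_of_all _ fun x => ?_) 2
              rw [norm_mul, norm_norm, Real.norm_of_nonneg hA]
    have e2 : ‖hG.toLp _‖ ≤ curvConst n / ε * K * ‖D‖ + (growthConst n K / √ε + 4 * n) * ‖w‖ := by
      rw [Lp.norm_toLp, Lp.norm_def, Lp.norm_def]
      have f1 : eLpNorm D 2 Ω.measure ≠ ⊤ := (Lp.memLp D).eLpNorm_ne_top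
      have f2 : eLpNorm w 2 Ω.measure ≠ ⊤ := (Lp.memLp w).eLpNorm_ne_top
      have t1 := ENNReal.mul_ne_top (ENNReal.ofReal_ne_top (r := curvConst n / ε * K)) f1
      have t2 := ENNReal.mul_ne_top
        (ENNReal.ofReal_ne_top (r := growthConst n K / √ε + 4 * n)) f2
      refine (ENNReal.toReal_mono (ENNReal.add_ne_top.2 ⟨t1, t2⟩) e1).trans (le_of_eq ?_)
      rw [ENNReal.toReal_add t1 t2, ENNReal.toReal_mul, ENNReal.toReal_mul,
        ENNReal.toReal_ofReal (by positivity), ENNReal.toReal_ofReal hA]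
    have hsq : ε ≤ √ε := by
      rw [Real.le_sqrt' hε]
      nlinarith
    have hg1 := one_le_growthConst n hK
    have hA2 : growthConst n K / √ε + 4 * n ≤ (growthConst n K + 4 * n) / ε := by
      rw [add_div]
      have hn0 : (0 : ℝ) ≤ 4 * n := by positivity
      refine add_le_add (by gcongr) ?_
      rw [le_div_iff₀ hε]
      nlinarith
    have hDM : ‖D‖ ≤ M + Real.sqrt Ω.scale * K := hDn.trans (by linarith)
    refine e2.trans ?_
    calc curvConst n / ε * K * ‖D‖ + (growthConst n K / √ε + 4 * n) * ‖w‖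
        ≤ curvConst n / ε * K * (M + Real.sqrt Ω.scale * K)
          + (growthConst n K + 4 * n) / ε * M := by gcongr
      _ = Ω.nonlinConst n K M / ε := by
          unfold Domain.nonlinConst
          ring

/-! ### Duhamel estimates for weak solutions of `i u' = -A u + F(u)` -/

/-- The bound passes to the closure, where v itself may be used as test vector. -/
theorem norm_le_of_dense_inner_le {H : Type*} [NormedAddCommGroup H] [InnerProductSpace ℂ H]
    {s : Set H} (hs : Dense s) {v : H} {c : ℝ} (hc : 0 ≤ c)
    (h : ∀ φ ∈ s, ‖inner ℂ φ v‖ ≤ c * ‖φ‖) : ‖v‖ ≤ c := by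
  have hcl : IsClosed {φ : H | ‖inner ℂ φ v‖ ≤ c * ‖φ‖} :=
    isClosed_le (by fun_prop) (by fun_prop)
  have hall : ∀ φ, ‖inner ℂ φ v‖ ≤ c * ‖φ‖ := fun φ =>
    closure_minimal h hcl (hs.closure_eq ▸ mem_univ φ)
  rcases eq_or_ne v 0 with rfl | hv
  · simpa using hc
  · have := hall v
    rw [inner_self_eq_norm_sq_to_K, norm_pow, RCLike.norm_ofReal, abs_norm, sq] at this
    exact le_of_mul_le_mul_right this (norm_pos_iff.2 hv)

namespace UnitaryFlow

variable {H : Type*} [NormedAddCommGroup H] [InnerProductSpace ℂ H] {P : UnitaryFlow H}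

/-- `U` solves `i U' = -A U + F(U)` on `[0, T]` against the domain of the generator. -/
structure IsWeakEvolution (P : UnitaryFlow H) (F : H → H) (T : ℝ) (U : ℝ → H) : Prop where
  continuous : Continuous U
  continuous_nonlin : Continuous F
  equation : ∀ φ ψ, P.Gen φ ψ → ∀ t ∈ Icc 0 T, Complex.I * inner ℂ φ (U t - U 0)
    = ∫ s in (0 : ℝ)..t, (-inner ℂ ψ (U s) + inner ℂ φ (F (U s)))

namespace IsWeakEvolution

variable {F : H → H} {T : ℝ} {U : ℝ → H} {φ ψ : H}

theorem hasDerivWithinAt_inner (h : P.IsWeakEvolution F T U) (hg : P.Gen φ ψ) {s : ℝ}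
    (hs : s ∈ Icc 0 T) :
    HasDerivWithinAt (fun s => inner ℂ φ (U s))
      (Complex.I * inner ℂ ψ (U s) - Complex.I * inner ℂ φ (F (U s))) (Icc 0 T) s := by
  have hU := h.continuous
  have hF := h.continuous_nonlin
  have hk : Continuous fun s => -inner ℂ ψ (U s) + inner ℂ φ (F (U s)) := by fun_prop
  have h1 := ((hk.integral_hasStrictDerivAt 0 s).hasDerivAt.const_mul (-Complex.I)).const_add
    (inner ℂ φ (U 0))
  refine (h1.hasDerivWithinAt.congr_deriv ?_).congr (fun t ht => ?_) ?_
  · ring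
  · rw [← h.equation φ ψ hg t ht, inner_sub_right, ← mul_assoc, neg_mul, Complex.I_mul_I]
    ring
  · rw [← h.equation φ ψ hg s hs, inner_sub_right, ← mul_assoc, neg_mul, Complex.I_mul_I]
    ring

/-- A product rule in which one factor is differentiable only weakly. The group is moved to φ, and
the generator terms from the two factors cancel. -/
theorem hasDerivWithinAt_duhamel (h : P.IsWeakEvolution F T U) (hg : P.Gen φ ψ) {t τ σ : ℝ}
    (ht : 0 ≤ t) (htT : t + τ ≤ T) (hσ : σ ∈ Icc 0 τ) :
    HasDerivWithinAt (fun σ => inner ℂ φ (P.S (τ - σ) (U (t + σ))))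
      (-Complex.I * inner ℂ φ (P.S (τ - σ) (F (U (t + σ))))) (Icc 0 τ) σ := by
  have hmove : ∀ (σ : ℝ) (χ v : H), inner ℂ χ (P.S (τ - σ) v) = inner ℂ (P.S (σ - τ) χ) v := by
    intro σ χ v
    rw [P.inner_map_left, neg_sub]
  simp only [hmove]
  set A : ℝ → H := fun σ => P.S (σ - τ) φ with hA
  have hA' : HasDerivAt A (Complex.I • P.S (σ - τ) ψ) σ := (hg.hasDerivAt (σ - τ)).comp_sub_const σ τ
  have hmaps : MapsTo (fun σ => t + σ) (Icc 0 τ) (Icc 0 T) := fun x hx =>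
    ⟨add_nonneg ht hx.1, by linarith [hx.2]⟩
  have hU : HasDerivWithinAt (fun x => inner ℂ (A σ) (U (t + x)))
      (Complex.I * inner ℂ (P.S (σ - τ) ψ) (U (t + σ)) - Complex.I * inner ℂ (A σ) (F (U (t + σ))))
      (Icc 0 τ) σ := by
    have h1 := h.hasDerivWithinAt_inner (hg.map (σ - τ)) (hmaps hσ)
    have h2 : HasDerivWithinAt (fun x => t + x) 1 (Icc 0 τ) σ :=
      ((hasDerivAt_id σ).const_add t).hasDerivWithinAt
    have := h1.scomp σ h2 hmaps
    rwa [one_smul] at this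
  -- The increment of the strongly differentiable factor needs only continuity of U; the other part
  -- has a fixed vector of the domain on the left and is covered by the weak equation.
  have hfirst : HasDerivWithinAt (fun x => inner ℂ (A x - A σ) (U (t + x)))
      (inner ℂ (Complex.I • P.S (σ - τ) ψ) (U (t + σ))) (Icc 0 τ) σ := by
    rw [hasDerivWithinAt_iff_tendsto_slope]
    have hs := (hasDerivWithinAt_iff_tendsto_slope.1 (hA'.hasDerivWithinAt (s := Icc 0 τ)))
    have hUc : Tendsto (fun x => U (t + x)) (𝓝[Icc 0 τ \ {σ}] σ) (𝓝 (U (t + σ))) :=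
      ((h.continuous.comp (continuous_const.add continuous_id)).tendsto σ).mono_left
        nhdsWithin_le_nhds
    refine (hs.inner hUc).congr fun x => ?_
    simp only [slope_def_module, sub_self, inner_zero_left, sub_zero]
    rw [inner_smul_left_eq_star_smul, Complex.real_smul]
    simp [inner_sub_left]
  have hsum := hfirst.add hU
  refine (hsum.congr_deriv ?_).congr (fun x _ => ?_) ?_
  · rw [inner_smul_left, Complex.conj_I]
    ring
  · simp only [Pi.add_apply]
    rw [inner_sub_left, sub_add_cancel]
  · simp only [Pi.add_apply]
    rw [inner_sub_left, sub_add_cancel]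

/-- The local error of the Duhamel formula when its integrand is replaced by a constant `f`. -/
theorem norm_sub_map_add_le (h : P.IsWeakEvolution F T U) {t τ δ : ℝ} (ht : 0 ≤ t) (hτ : 0 ≤ τ)
    (htT : t + τ ≤ T) {f : H}
    (hδ : ∀ σ ∈ Icc 0 τ, ‖P.S (τ - σ) (F (U (t + σ))) - f‖ ≤ δ) :
    ‖U (t + τ) - P.S τ (U t) + (Complex.I * τ) • f‖ ≤ δ * τ := by
  have hδ0 : 0 ≤ δ := (norm_nonneg _).trans (hδ 0 ⟨le_rfl, hτ⟩)
  refine norm_le_of_dense_inner_le P.dense_gen (by positivity) ?_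
  rintro φ ⟨ψ, hg⟩
  have hder : ∀ σ ∈ Icc 0 τ, HasDerivWithinAt
      (fun σ : ℝ => inner ℂ φ (P.S (τ - σ) (U (t + σ))) + Complex.I * σ * inner ℂ φ f)
      (-Complex.I * inner ℂ φ (P.S (τ - σ) (F (U (t + σ))) - f)) (Icc 0 τ) σ := by
    intro σ hσ
    have h1 : HasDerivAt (fun σ : ℝ => Complex.I * (σ : ℂ) * inner ℂ φ f)
        (Complex.I * 1 * inner ℂ φ f) σ :=
      ((Complex.ofRealCLM.hasDerivAt (x := σ)).const_mul Complex.I).mul_const _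
    refine ((h.hasDerivWithinAt_duhamel hg ht htT hσ).add h1.hasDerivWithinAt).congr_deriv ?_
    rw [inner_sub_right]
    ring
  have hbd : ∀ σ ∈ Icc 0 τ, ‖-Complex.I * inner ℂ φ (P.S (τ - σ) (F (U (t + σ))) - f)‖
      ≤ ‖φ‖ * δ := by
    intro σ hσ
    rw [norm_mul, norm_neg, Complex.norm_I, one_mul]
    exact (norm_inner_le_norm _ _).trans (by gcongr; exact hδ σ hσ)
  have hmv := (convex_Icc 0 τ).norm_image_sub_le_of_norm_hasDerivWithin_le hder hbd
    (left_mem_Icc.2 hτ) (right_mem_Icc.2 hτ)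
  simp only [sub_self, sub_zero, P.map_zero, add_zero, Complex.ofReal_zero, mul_zero,
    zero_mul, Real.norm_of_nonneg hτ] at hmv
  rw [inner_add_right, inner_sub_right, inner_smul_right]
  calc _ = ‖inner ℂ φ (U (t + τ)) + Complex.I * τ * inner ℂ φ f - inner ℂ φ (P.S τ (U t))‖ := by
        congr 1
        ring
    _ ≤ ‖φ‖ * δ * τ := hmv
    _ = δ * τ * ‖φ‖ := by ring

/-- The local error of one splitting step, up to the expansion of the nonlinear flow. -/
theorem norm_sub_map_add_nonlin_le (h : P.IsWeakEvolution F T U) {Λ M B : ℝ} (hΛ : 0 ≤ Λ)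
    (hFL : ∀ v w, ‖F v - F w‖ ≤ Λ * ‖v - w‖)
    (hFM : ∀ t ∈ Icc 0 T, ‖F (U t)‖ ≤ Λ * M)
    (hUS : ∀ t ∈ Icc 0 T, ∀ r, ‖P.S r (U t) - U t‖ ≤ |r| * M)
    (hFS : ∀ t ∈ Icc 0 T, ∀ r, ‖P.S r (F (U t)) - F (U t)‖ ≤ |r| * B) {t τ : ℝ}
    (ht : 0 ≤ t) (hτ : 0 ≤ τ) (htT : t + τ ≤ T) :
    ‖U (t + τ) - P.S τ (U t) + (Complex.I * τ) • F (P.S τ (U t))‖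
      ≤ (B + 2 * Λ * M + Λ ^ 2 * M) * τ ^ 2 := by
  have htI : t ∈ Icc 0 T := ⟨ht, by linarith⟩
  have hM : 0 ≤ M := by
    have := (norm_nonneg _).trans (hUS t htI 1)
    simpa using this
  have hB : 0 ≤ B := by
    have := (norm_nonneg _).trans (hFS t htI 1)
    simpa using this
  have hlip : ∀ σ ∈ Icc 0 τ, ‖U (t + σ) - U t‖ ≤ τ * (Λ * M + M) := by
    intro σ hσ
    have hσT : t + σ ≤ T := by linarith [hσ.2]
    -- With f = 0 the same lemma gives the crude first-order bound, from which U is Lipschitz in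
    -- time.
    have h1 := h.norm_sub_map_add_le (f := 0) (δ := Λ * M) ht hσ.1 hσT fun r hr => by
      rw [sub_zero, (P.S _).norm_map]
      exact hFM _ ⟨add_nonneg ht hr.1, by linarith [hr.2]⟩
    rw [smul_zero, add_zero] at h1
    have h2 := hUS t htI σ
    rw [abs_of_nonneg hσ.1] at h2
    calc ‖U (t + σ) - U t‖ = ‖(U (t + σ) - P.S σ (U t)) + (P.S σ (U t) - U t)‖ := by
          rw [sub_add_sub_cancel]
      _ ≤ Λ * M * σ + σ * M := (norm_add_le _ _).trans (add_le_add h1 h2)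
      _ = σ * (Λ * M + M) := by ring
      _ ≤ τ * (Λ * M + M) := by
          have : 0 ≤ Λ * M + M := by positivity
          gcongr
          exact hσ.2
  refine (h.norm_sub_map_add_le (δ := (B + 2 * Λ * M + Λ ^ 2 * M) * τ) ht hτ htT
    fun σ hσ => ?_).trans (le_of_eq (by ring))
  have hσI : t + σ ∈ Icc 0 T := ⟨add_nonneg ht hσ.1, by linarith [hσ.2]⟩
  have e1 := hFS _ hσI (τ - σ)
  rw [abs_of_nonneg (sub_nonneg.2 hσ.2)] at e1
  have e2 := hFL (U (t + σ)) (U t)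
  have e3 := hFL (U t) (P.S τ (U t))
  have e4 := hUS t htI τ
  rw [abs_of_nonneg hτ, norm_sub_rev] at e4
  -- Three replacements inside the Duhamel integrand: the group in front of F is dropped, U (t + σ)
  -- becomes U t, and U t becomes its free evolution.
  calc ‖P.S (τ - σ) (F (U (t + σ))) - F (P.S τ (U t))‖
      = ‖(P.S (τ - σ) (F (U (t + σ))) - F (U (t + σ))) + (F (U (t + σ)) - F (U t))
          + (F (U t) - F (P.S τ (U t)))‖ := by
        congr 1
        abel
    _ ≤ (τ - σ) * B + Λ * (τ * (Λ * M + M)) + Λ * (τ * M) := by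
        refine (norm_add₃_le).trans (add_le_add (add_le_add e1 (e2.trans ?_)) (e3.trans ?_))
        · gcongr
          exact hlip σ hσ
        · gcongr
    _ ≤ τ * B + Λ * (τ * (Λ * M + M)) + Λ * (τ * M) := by
        gcongr
        linarith [hσ.1]
    _ = (B + 2 * Λ * M + Λ ^ 2 * M) * τ := by ring

end IsWeakEvolution

end UnitaryFlow

/-! ### Test functions -/

theorem Domain.IsTest.add_mul {Ω : Domain} {φ χ : ℝ → ℂ} (hφ : Ω.IsTest φ) (hχ : Ω.IsTest χ)
    (c : ℂ) : Ω.IsTest fun x => φ x + c * χ x := by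
  have hsm : ContDiff ℝ ∞ fun x => φ x + c * χ x :=
    hφ.contDiff.add (contDiff_const.mul hχ.contDiff)
  have hsupp : tsupport (fun x => φ x + c * χ x) ⊆ tsupport φ ∪ tsupport χ := by
    refine closure_minimal (fun x hx => ?_) ((isClosed_tsupport φ).union (isClosed_tsupport χ))
    by_contra hx'
    rw [mem_union, not_or] at hx'
    exact hx (by simp [image_eq_zero_of_notMem_tsupport hx'.1,
      image_eq_zero_of_notMem_tsupport hx'.2])
  cases Ω with
  | line =>
    exact ⟨hsm, (IsCompact.union hφ.2 hχ.2).of_isClosed_subset (isClosed_tsupport _) hsupp⟩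
  | dirichlet a b hab =>
    exact ⟨hsm, (IsCompact.union hφ.2.1 hχ.2.1).of_isClosed_subset (isClosed_tsupport _) hsupp,
      hsupp.trans (union_subset hφ.2.2 hχ.2.2)⟩
  | periodic a b hab =>
    refine ⟨hsm, fun x => ?_⟩
    simp only [hφ.2 x, hχ.2 x]

theorem Domain.isTest_zero (Ω : Domain) : Ω.IsTest fun _ => 0 := by
  have h0 : HasCompactSupport fun _ : ℝ => (0 : ℂ) := HasCompactSupport.zero
  cases Ω with
  | line => exact ⟨contDiff_const, h0⟩
  | dirichlet a b hab =>
    refine ⟨contDiff_const, h0, ?_⟩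
    have : tsupport (fun _ : ℝ => (0 : ℂ)) = ∅ := tsupport_eq_empty_iff.2 rfl
    rw [this]
    exact empty_subset _
  | periodic a b hab => exact ⟨contDiff_const, fun x => rfl⟩

theorem Domain.IsTest.conj {Ω : Domain} {φ : ℝ → ℂ} (hφ : Ω.IsTest φ) :
    Ω.IsTest fun x => (starRingEnd ℂ) (φ x) := by
  have hsm : ContDiff ℝ ∞ fun x => (starRingEnd ℂ) (φ x) :=
    Complex.conjCLE.contDiff.comp hφ.contDiff
  cases Ω with
  | line => exact ⟨hsm, hφ.2.comp_left (map_zero _)⟩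
  | dirichlet a b hab =>
    exact ⟨hsm, hφ.2.1.comp_left (map_zero _),
      (closure_mono fun x hx => by simpa using hx).trans hφ.2.2⟩
  | periodic a b hab =>
    refine ⟨hsm, fun x => ?_⟩
    simp only [hφ.2 x]

theorem Domain.IsTest.memLp {Ω : Domain} {φ : ℝ → ℂ} (hφ : Ω.IsTest φ) : MemLp φ 2 Ω.measure := by
  cases Ω with
  | line =>
    have h : MemLp φ 2 (volume : Measure ℝ) :=
      hφ.contDiff.continuous.memLp_of_hasCompactSupport hφ.2
    exact h
  | dirichlet a b hab => exact memLp_Ioo_of_continuous hφ.contDiff.continuous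
  | periodic a b hab => exact memLp_Ioo_of_continuous hφ.contDiff.continuous

/-- The subspace of test functions in `L²`. -/
def Domain.testSubmodule (Ω : Domain) : Submodule ℂ Ω.L2 where
  carrier := {Φ | ∃ χ, Ω.IsTest χ ∧ Φ =ᵐ[Ω.measure] χ}
  add_mem' := by
    rintro Φ Ψ ⟨χ, h, e⟩ ⟨χ', h', e'⟩
    refine ⟨_, h.add_mul h' 1, ?_⟩
    filter_upwards [e, e', Lp.coeFn_add Φ Ψ] with x h1 h2 h3
    rw [h3, Pi.add_apply, h1, h2, one_mul]
  zero_mem' := ⟨_, Ω.isTest_zero, Lp.coeFn_zero _ _ _⟩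
  smul_mem' := by
    rintro c Φ ⟨χ, h, e⟩
    refine ⟨_, Ω.isTest_zero.add_mul h c, ?_⟩
    filter_upwards [e, Lp.coeFn_smul c Φ] with x h1 h2
    rw [h2, Pi.smul_apply, h1, zero_add, smul_eq_mul]

theorem Lp_eq_zero_of_bump (Ω : Domain) {v : Ω.L2}
    (h : ∀ φ, IsBump Ω.carrier φ → ∫ x, φ x • v x ∂Ω.measure = 0) : v = 0 := by
  have hv : LocallyIntegrable (Ω.carrier.indicator v) volume :=
    (memLp_indicator_carrier Ω v).locallyIntegrable one_le_two
  have hz := Ω.isOpen_carrier.ae_eq_zero_of_integral_contDiff_smul_eq_zero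
    (hv.locallyIntegrableOn _) fun φ h1 h2 h3 => by
      rw [integral_smul_indicator_carrier, h φ ⟨h1, h2, h3⟩]
  refine Lp.ext ?_
  have hz' : ∀ᵐ x ∂Ω.measure, v x = 0 := by
    refine Ω.ae_measure_iff.2 ?_
    filter_upwards [hz] with x hx hxU
    simpa [indicator_of_mem hxU] using hx hxU
  filter_upwards [hz', Lp.coeFn_zero ℂ 2 Ω.measure] with x h1 h2
  rw [h1, h2, Pi.zero_apply]

theorem eq_zero_of_inner_bump {Ω : Domain}
    (ht : ∀ φ, IsBump Ω.carrier φ → Ω.IsTest fun x => (φ x : ℂ)) {v : Ω.L2}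
    (h : ∀ Φ ∈ Ω.testSubmodule, inner ℂ Φ v = 0) : v = 0 := by
  refine Lp_eq_zero_of_bump Ω fun φ hφ => ?_
  have := h ((hφ.memLp Ω).toLp _) ⟨_, ht φ hφ, MemLp.coeFn_toLp _⟩
  rw [inner_toLp_left] at this
  simpa only [Complex.conj_ofReal, Complex.real_smul] using this

theorem Domain.dense_testSubmodule (Ω : Domain) : Dense (Ω.testSubmodule : Set Ω.L2) := by
  rw [Submodule.dense_iff_topologicalClosure_eq_top, Submodule.topologicalClosure_eq_top_iff,
    Submodule.eq_bot_iff]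
  intro v hv
  rw [Submodule.mem_orthogonal] at hv
  match Ω, v with
  | .line, v => exact eq_zero_of_inner_bump (fun _ h => h.isTest_line) hv
  | .dirichlet a b hab, v => exact eq_zero_of_inner_bump (fun _ h => h.isTest_dirichlet) hv
  | .periodic a b hab, v =>
    exact total_periodicMode hab v fun k => hv _
      ⟨_, ⟨contDiff_periodicMode a b k, periodic_periodicMode hab k⟩, MemLp.coeFn_toLp _⟩

/-! ### Regularity of weak solutions -/

/-- `v` is in the domain of the generator with an `H²` bound. -/
def Domain.IsRegularData (Ω : Domain) (M : ℝ) (v : Ω.L2) : Prop :=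
  ∃ g w : Ω.L2, Ω.MemEnergySpace v ∧ Ω.HasWeakDeriv v g ∧ Ω.HasWeakDeriv g w ∧
    ‖v‖ ≤ M ∧ ‖g‖ ≤ M ∧ ‖w‖ ≤ M

/-- The Sobolev norm is an infimum; the slack of 1 provides an actual family of weak derivatives
strictly below the bound. -/
theorem isRegularData_of_sobolevNorm {Ω : Domain} {M : ℝ≥0} {v : Ω.L2}
    (he : Ω.MemEnergySpace v) (h : Ω.sobolevNorm 2 v ≤ M) : Ω.IsRegularData (M + 1) v := by
  have hlt : Ω.sobolevNorm 2 v < ((M + 1 : ℝ≥0) : ℝ≥0∞) :=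
    h.trans_lt (by exact_mod_cast lt_add_one M)
  simp only [Domain.sobolevNorm, iInf_lt_iff] at hlt
  obtain ⟨g, ⟨hg0, hg⟩, hlt⟩ := hlt
  have hb : ∀ j ∈ Finset.range 3, ‖g j‖ ≤ M + 1 := by
    intro j hj
    have h1 : ‖g j‖ ≤ Real.sqrt (∑ j ∈ Finset.range (2 + 1), ‖g j‖ ^ 2) := by
      refine Real.le_sqrt_of_sq_le ?_
      exact Finset.single_le_sum (f := fun j => ‖g j‖ ^ 2) (fun _ _ => sq_nonneg _) hj
    have h2 : Real.sqrt (∑ j ∈ Finset.range (2 + 1), ‖g j‖ ^ 2) < ((M + 1 : ℝ≥0) : ℝ) := by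
      rw [← ENNReal.ofReal_coe_nnreal] at hlt
      exact (ENNReal.ofReal_lt_ofReal_iff_of_nonneg (Real.sqrt_nonneg _)).1 hlt
    push_cast at h2
    exact h1.trans h2.le
  refine ⟨g 1, g 2, he, ?_, hg 1 (by norm_num), ?_, hb 1 (by simp), hb 2 (by simp)⟩
  · rw [← hg0]
    exact hg 0 (by norm_num)
  · rw [← hg0]
    exact hb 0 (by simp)

theorem ae_isRegularData {Ω : Domain} {n : ℕ} {ε T : ℝ} {u₀ : Ω.L2} {u : ℝ → Ω.L2} {M : ℝ≥0}
    (hu : IsWeakSolution Ω n ε T u₀ u) (hM : Ω.LinftySobolevNorm 2 T u ≤ M) :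
    ∀ᵐ t ∂(volume.restrict (Icc 0 T)), Ω.IsRegularData (M + 1) (u t) := by
  filter_upwards [hu.energySpace, ae_le_essSup (f := fun t => Ω.sobolevNorm 2 (u t))
    (μ := volume.restrict (Icc 0 T))] with t h1 h2
  exact isRegularData_of_sobolevNorm h1 (h2.trans hM)

/-- The distance to Q along the curve is continuous and vanishes almost everywhere, hence
everywhere. -/
theorem forall_mem_of_ae_mem {H : Type*} [NormedAddCommGroup H] {T : ℝ} (hT : 0 < T) {u : ℝ → H}
    (hu : ContinuousOn u (Icc 0 T)) {Q : Set H} (hQ : IsClosed Q) (h0 : (0 : H) ∈ Q)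
    (h : ∀ᵐ t ∂(volume.restrict (Icc 0 T)), u t ∈ Q) : ∀ t ∈ Icc 0 T, u t ∈ Q := by
  have hne : Q.Nonempty := ⟨0, h0⟩
  have h1 : (fun t => Metric.infDist (u t) Q) =ᵐ[volume.restrict (Icc 0 T)] fun _ => (0 : ℝ) := by
    filter_upwards [h] with t ht
    exact (hQ.mem_iff_infDist_zero hne).1 ht
  have h2 := Measure.eqOn_Icc_of_ae_eq volume hT.ne h1
    ((Metric.continuous_infDist_pt Q).comp_continuousOn hu) continuousOn_const
  intro t ht
  exact (hQ.mem_iff_infDist_zero hne).2 (h2 ht)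

theorem lipschitzWith_excess (K : ℝ) : LipschitzWith 1 fun z : ℂ => max (‖z‖ - K) 0 := by
  refine LipschitzWith.of_dist_le_mul fun z w => ?_
  rw [NNReal.coe_one, one_mul, Real.dist_eq, dist_eq_norm]
  refine (abs_max_sub_max_le_abs _ _ _).trans ?_
  rw [sub_sub_sub_cancel_right]
  exact abs_norm_sub_norm_le z w

/-- The excess of the modulus over K is a Lipschitz function vanishing at 0, so it acts continuously
on L², and the set is the zero set of this action. -/
theorem isClosed_ae_norm_le {μ : Measure ℝ} {K : ℝ} (hK : 0 ≤ K) :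
    IsClosed {v : Lp ℂ 2 μ | ∀ᵐ x ∂μ, ‖v x‖ ≤ K} := by
  have h0 : (fun z : ℂ => max (‖z‖ - K) 0) 0 = 0 := by simpa using hK
  have hset : {v : Lp ℂ 2 μ | ∀ᵐ x ∂μ, ‖v x‖ ≤ K}
      = {v : Lp ℂ 2 μ | (lipschitzWith_excess K).compLp h0 v = 0} := by
    ext v
    rw [mem_ofPred_eq, mem_ofPred_eq, Lp.eq_zero_iff_ae_eq_zero]
    have hc := (lipschitzWith_excess K).coeFn_compLp h0 v
    constructor
    · intro h
      filter_upwards [h, hc] with x h1 h2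
      rw [h2]
      simpa using h1
    · intro h
      filter_upwards [h, hc] with x h1 h2
      rw [h2] at h1
      simpa using h1
  rw [hset]
  exact isClosed_eq ((lipschitzWith_excess K).continuous_compLp h0) continuous_const

section Evolution

variable {Ω : Domain} {n : ℕ} {ε K M T : ℝ}

theorem lipschitzWith_nonlin (hn : 2 ≤ n) (hε : 0 < ε) (hε1 : ε ≤ 1) (hK : 1 ≤ K) :
    LipschitzWith (lipConst n K / √ε).toNNReal (nonlin n ε K) := by
  refine LipschitzWith.of_dist_le_mul fun z w => ?_
  rw [Real.coe_toNNReal _ (div_nonneg (lipConst_nonneg n hK) (Real.sqrt_nonneg _)), dist_eq_norm,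
    dist_eq_norm]
  exact norm_nonlin_sub_le hn hε hε1 hK z w

/-- The truncated nonlinearity on `L²`. -/
def nonlinLp (Ω : Domain) (hn : 2 ≤ n) (hε : 0 < ε) (hε1 : ε ≤ 1) (hK : 1 ≤ K) (v : Ω.L2) : Ω.L2 :=
  (lipschitzWith_nonlin hn hε hε1 hK).compLp (nonlin_zero n ε K) v

variable (hn : 2 ≤ n) (hε : 0 < ε) (hε1 : ε ≤ 1) (hK : 1 ≤ K)

theorem coeFn_nonlinLp (v : Ω.L2) :
    nonlinLp Ω hn hε hε1 hK v =ᵐ[Ω.measure] fun x => nonlin n ε K (v x) :=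
  LipschitzWith.coeFn_compLp _ _ v

theorem continuous_nonlinLp : Continuous (nonlinLp Ω hn hε hε1 hK) :=
  (lipschitzWith_nonlin hn hε hε1 hK).continuous_compLp (nonlin_zero n ε K)

theorem nonlinLp_zero : nonlinLp Ω hn hε hε1 hK 0 = 0 := LipschitzWith.compLp_zero _ _

theorem norm_nonlinLp_sub_le (v w : Ω.L2) :
    ‖nonlinLp Ω hn hε hε1 hK v - nonlinLp Ω hn hε hε1 hK w‖ ≤ lipConst n K / √ε * ‖v - w‖ := by
  have := (lipschitzWith_nonlin hn hε hε1 hK).norm_compLp_sub_le (nonlin_zero n ε K) v w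
  rwa [Real.coe_toNNReal _ (div_nonneg (lipConst_nonneg n hK) (Real.sqrt_nonneg _))] at this

theorem norm_nonlinLp_le (v : Ω.L2) :
    ‖nonlinLp Ω hn hε hε1 hK v‖ ≤ lipConst n K / √ε * ‖v‖ := by
  have := norm_nonlinLp_sub_le hn hε hε1 hK v 0
  rwa [nonlinLp_zero, sub_zero, sub_zero] at this

/-- The closed conditions on the solution used in the error analysis. -/
structure IsTame (Ω : Domain) (hn : 2 ≤ n) (hε : 0 < ε) (hε1 : ε ≤ 1) (hK : 1 ≤ K) (M : ℝ)
    (v : Ω.L2) : Prop where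
  norm_le : ‖v‖ ≤ M
  ae_norm_map_le : ∀ r, ∀ᵐ x ∂Ω.measure, ‖Ω.flow.S r v x‖ ≤ K
  norm_map_sub_le : ∀ r, ‖Ω.flow.S r v - v‖ ≤ |r| * M
  norm_map_nonlin_sub_le : ∀ r, ‖Ω.flow.S r (nonlinLp Ω hn hε hε1 hK v) - nonlinLp Ω hn hε hε1 hK v‖
    ≤ |r| * (Ω.nonlinConst n K M / ε)

theorem ae_norm_le_of_gen {v w : Ω.L2} (h : Ω.flow.Gen v w)
    (hMK : Ω.sobolevConst * (‖v‖ + ‖w‖) ≤ K) : ∀ᵐ x ∂Ω.measure, ‖v x‖ ≤ K := by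
  obtain ⟨V, V', -, hv, -, -, hB⟩ := exists_isRegular_of_gen h
  have hmem : ∀ᵐ x ∂Ω.measure, x ∈ Ω.carrier := Ω.ae_measure_iff.2 (ae_of_all _ fun _ h => h)
  filter_upwards [hv, hmem] with x h1 h2
  rw [h1]
  exact (hB x (subset_closure h2)).1.trans hMK

/-- The group preserves the domain and the graph norm, so the Sobolev bound holds along the whole
free orbit. The last two properties are speed bounds for the orbits of v and of its nonlinearity. -/
theorem Domain.IsRegularData.isTame (hMK : Ω.sobolevConst * (2 * M) ≤ K) {v : Ω.L2}
    (h : Ω.IsRegularData M v) : IsTame Ω hn hε hε1 hK M v := by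
  obtain ⟨g, w, he, hg, hw, hvM, hgM, hwM⟩ := h
  have hgen := gen_of_hasWeakDeriv he hg hw
  refine ⟨hvM, fun r => ?_, fun r => ?_, fun r => ?_⟩
  · refine ae_norm_le_of_gen (hgen.map r) (le_trans ?_ hMK)
    rw [(Ω.flow.S r).norm_map, (Ω.flow.S r).norm_map]
    have := Ω.sobolevConst_nonneg
    gcongr
    linarith
  · exact (hgen.norm_map_sub_le r).trans (by gcongr)
  · obtain ⟨G, hG, hGn⟩ := exists_gen_nonlin hn hε hε1 hK hMK hgen hg hvM hgM hwM
      (coeFn_nonlinLp hn hε hε1 hK v)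
    exact (hG.norm_map_sub_le r).trans (by gcongr)

/-- Each defining inequality is a closed condition in L², because the group and the truncated
nonlinearity are continuous there. Membership in the domain itself would be less convenient to pass
to limits. -/
theorem isClosed_isTame : IsClosed {v : Ω.L2 | IsTame Ω hn hε hε1 hK M v} := by
  have hF := continuous_nonlinLp (Ω := Ω) hn hε hε1 hK
  have hS : ∀ r, Continuous (Ω.flow.S r) := fun r => (Ω.flow.S r).continuous
  have hset : {v : Ω.L2 | IsTame Ω hn hε hε1 hK M v} = {v : Ω.L2 | ‖v‖ ≤ M}
      ∩ (⋂ r, (Ω.flow.S r) ⁻¹' {v | ∀ᵐ x ∂Ω.measure, ‖v x‖ ≤ K})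
      ∩ (⋂ r, {v | ‖Ω.flow.S r v - v‖ ≤ |r| * M})
      ∩ (⋂ r, {v | ‖Ω.flow.S r (nonlinLp Ω hn hε hε1 hK v) - nonlinLp Ω hn hε hε1 hK v‖
        ≤ |r| * (Ω.nonlinConst n K M / ε)}) := by
    ext v
    simp only [mem_inter_iff, mem_iInter, mem_preimage, mem_ofPred_eq]
    exact ⟨fun h => ⟨⟨⟨h.1, h.2⟩, h.3⟩, h.4⟩, fun h => ⟨h.1.1.1, h.1.1.2, h.1.2, h.2⟩⟩
  rw [hset]
  refine (((isClosed_le continuous_norm continuous_const).inter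
    (isClosed_iInter fun r => ?_)).inter (isClosed_iInter fun r => ?_)).inter
    (isClosed_iInter fun r => ?_)
  · exact (isClosed_ae_norm_le (zero_le_one.trans hK)).preimage (hS r)
  · exact isClosed_le (((hS r).sub continuous_id).norm) continuous_const
  · exact isClosed_le ((((hS r).comp hF).sub hF).norm) continuous_const

theorem nonlinConst_nonneg (Ω : Domain) (n : ℕ) (hK : 1 ≤ K) (hM : 0 ≤ M) :
    0 ≤ Ω.nonlinConst n K M := by
  have h1 := curvConst_nonneg n
  have h2 := one_le_growthConst n hK
  have h3 := Ω.scale_pos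
  unfold Domain.nonlinConst
  positivity

theorem isTame_zero (hM : 0 ≤ M) : IsTame Ω hn hε hε1 hK M 0 := by
  have hB := nonlinConst_nonneg Ω n hK hM
  refine ⟨by simpa using hM, fun r => ?_, fun r => ?_, fun r => ?_⟩
  · rw [map_zero]
    filter_upwards [Lp.coeFn_zero ℂ 2 Ω.measure] with x hx
    rw [hx, Pi.zero_apply, norm_zero]
    exact zero_le_one.trans hK
  · rw [map_zero, sub_zero, norm_zero]
    positivity
  · rw [nonlinLp_zero, map_zero, sub_zero, norm_zero]
    positivity

theorem inner_eq_integral_mul {Φ v : Ω.L2} {χ : ℝ → ℂ} (h : Φ =ᵐ[Ω.measure] χ) :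
    inner ℂ Φ v = ∫ x, v x * (starRingEnd ℂ) (χ x) ∂Ω.measure := by
  rw [L2.inner_def]
  refine integral_congr_ae ?_
  filter_upwards [h] with x hx
  rw [hx, RCLike.inner_apply', mul_comm]

/-- The weak equation against a test function, as an identity between inner products. -/
theorem IsWeakSolution.inner_test {u₀ : Ω.L2} {u : ℝ → Ω.L2} (hu : IsWeakSolution Ω n ε T u₀ u)
    (htame : ∀ t ∈ Icc 0 T, IsTame Ω hn hε hε1 hK M (u t)) {Φ Ψ : Ω.L2} {χ : ℝ → ℂ}
    (hχ : Ω.IsTest χ) (hΦ : Φ =ᵐ[Ω.measure] χ) (hΨ : Ψ =ᵐ[Ω.measure] deriv (deriv χ)) {t : ℝ}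
    (ht : t ∈ Icc 0 T) :
    Complex.I * inner ℂ Φ (u t - u 0)
      = ∫ s in (0 : ℝ)..t, (-inner ℂ Ψ (u s) + inner ℂ Φ (nonlinLp Ω hn hε hε1 hK (u s))) := by
  have hd : deriv (deriv fun x => (starRingEnd ℂ) (χ x))
      = fun x => (starRingEnd ℂ) (deriv (deriv χ) x) := by
    rw [deriv_conj_comp (hχ.contDiff.differentiable (by simp)),
      deriv_conj_comp (hχ.deriv.contDiff.differentiable (by simp))]
  have heq := hu.equation _ hχ.conj t ht
  rw [inner_sub_right, hu.initial, inner_eq_integral_mul hΦ, inner_eq_integral_mul hΦ, heq]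
  refine intervalIntegral.integral_congr fun s hs => ?_
  rw [uIcc_of_le ht.1] at hs
  have hsT : s ∈ Icc 0 T := ⟨hs.1, hs.2.trans ht.2⟩
  simp only [hd]
  rw [inner_eq_integral_mul hΨ, inner_eq_integral_mul hΦ]
  congr 1
  refine integral_congr_ae ?_
  have hsup := (htame s hsT).ae_norm_map_le 0
  rw [Ω.flow.map_zero] at hsup
  filter_upwards [coeFn_nonlinLp hn hε hε1 hK (u s), hsup] with x h1 h2
  rw [h1, nonlin_of_norm_le h2]

theorem Domain.HasWeakDeriv.inner_test {v g w : Ω.L2} (hg : Ω.HasWeakDeriv v g)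
    (hw : Ω.HasWeakDeriv g w) {Φ Ψ : Ω.L2} {χ : ℝ → ℂ} (hχ : Ω.IsTest χ)
    (hΦ : Φ =ᵐ[Ω.measure] χ) (hΨ : Ψ =ᵐ[Ω.measure] deriv (deriv χ)) :
    inner ℂ Ψ v = inner ℂ Φ w := by
  have hd : deriv (deriv fun x => (starRingEnd ℂ) (χ x))
      = fun x => (starRingEnd ℂ) (deriv (deriv χ) x) := by
    rw [deriv_conj_comp (hχ.contDiff.differentiable (by simp)),
      deriv_conj_comp (hχ.deriv.contDiff.differentiable (by simp))]
  have := hg.integral_deriv_deriv hw hχ.conj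
  rw [hd] at this
  rw [inner_eq_integral_mul hΨ, inner_eq_integral_mul hΦ, this]

/-- A weak solution with `H²` bound solves the equation against the whole domain of the
generator. -/
theorem IsWeakSolution.isWeakEvolution (hT : 0 < T) {u₀ : Ω.L2} {u : ℝ → Ω.L2}
    (hu : IsWeakSolution Ω n ε T u₀ u)
    (hdata : ∀ᵐ t ∂(volume.restrict (Icc 0 T)), Ω.IsRegularData M (u t))
    (htame : ∀ t ∈ Icc 0 T, IsTame Ω hn hε hε1 hK M (u t)) :
    Ω.flow.IsWeakEvolution (nonlinLp Ω hn hε hε1 hK) T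
      (IccExtend hT.le ((Icc 0 T).domRestrict u)) := by
  -- The constant extension beyond [0, T] makes U continuous on all of ℝ, so integrals along it can
  -- be differentiated from both sides at the endpoints.
  set U := IccExtend hT.le ((Icc 0 T).domRestrict u) with hUdef
  have hUu : ∀ s ∈ Icc 0 T, U s = u s := fun s hs => by
    rw [hUdef, IccExtend_of_mem _ _ hs, domRestrict_apply]
  have hUc : Continuous U := hu.continuousOn.domRestrict.Icc_extend'
  have hFc := continuous_nonlinLp (Ω := Ω) hn hε hε1 hK
  refine ⟨hUc, hFc, fun φ ψ hg t ht => ?_⟩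
  set F := nonlinLp Ω hn hε hε1 hK with hF
  have h0T : (0 : ℝ) ∈ Icc 0 T := ⟨le_rfl, hT.le⟩
  set c := M + lipConst n K / √ε * M
  set X := Complex.I * inner ℂ φ (U t - U 0)
    - ∫ s in (0 : ℝ)..t, (-inner ℂ ψ (U s) + inner ℂ φ (F (U s))) with hX
  have hΛ : 0 ≤ lipConst n K / √ε := div_nonneg (lipConst_nonneg n hK) (Real.sqrt_nonneg _)
  have hcont : ∀ φ ψ : Ω.L2, Continuous fun s => -inner ℂ ψ (U s) + inner ℂ φ (F (U s)) := by
    intro φ ψ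
    fun_prop
  have hdata' : ∀ᵐ s : ℝ, s ∈ uIoc 0 t → Ω.IsRegularData M (U s) := by
    filter_upwards [(ae_restrict_iff' measurableSet_Icc).1 hdata] with s hs hst
    rw [uIoc_of_le ht.1] at hst
    have hsT : s ∈ Icc 0 T := ⟨hst.1.le, hst.2.trans ht.2⟩
    rw [hUu s hsT]
    exact hs hsT
  -- X is the defect of the equation for φ. For almost every s the value U s is in the domain, so
  -- the second derivative can be moved from both φ and Φ onto it, and the defect depends on φ - Φ
  -- only in L². Density in the graph norm, which fails in the Dirichlet case, is thus not needed.
  have key : ∀ Φ ∈ Ω.testSubmodule, ‖X‖ ≤ ‖φ - Φ‖ * (‖U t - U 0‖ + c * |t - 0|) := by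
    rintro Φ ⟨χ, hχ, hΦ⟩
    set Ψ : Ω.L2 := hχ.deriv.deriv.memLp.toLp _
    have hΨ : Ψ =ᵐ[Ω.measure] deriv (deriv χ) := MemLp.coeFn_toLp _
    have heq : Complex.I * inner ℂ Φ (U t - U 0)
        = ∫ s in (0 : ℝ)..t, (-inner ℂ Ψ (U s) + inner ℂ Φ (F (U s))) := by
      rw [hUu t ht, hUu 0 h0T, hu.inner_test hn hε hε1 hK htame hχ hΦ hΨ ht]
      refine intervalIntegral.integral_congr fun s hs => ?_
      rw [uIcc_of_le ht.1] at hs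
      simp only [hUu s ⟨hs.1, hs.2.trans ht.2⟩, hF]
    have hXeq : X = Complex.I * inner ℂ (φ - Φ) (U t - U 0)
        - ∫ s in (0 : ℝ)..t, ((-inner ℂ ψ (U s) + inner ℂ φ (F (U s)))
          - (-inner ℂ Ψ (U s) + inner ℂ Φ (F (U s)))) := by
      rw [intervalIntegral.integral_sub ((hcont φ ψ).intervalIntegrable _ _)
        ((hcont Φ Ψ).intervalIntegrable _ _), ← heq, inner_sub_left, hX]
      ring
    rw [hXeq, mul_add]
    refine (norm_sub_le _ _).trans (add_le_add ?_ ?_)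
    · rw [norm_mul, Complex.norm_I, one_mul]
      exact norm_inner_le_norm _ _
    · rw [← mul_assoc]
      refine intervalIntegral.norm_integral_le_of_norm_le_const_ae ?_
      filter_upwards [hdata'] with s hs hst
      obtain ⟨g, w, he, hgw, hw, hvM, -, hwM⟩ := hs hst
      have e1 := hg.inner_eq (gen_of_hasWeakDeriv he hgw hw)
      have e2 := hgw.inner_test hw hχ hΦ hΨ
      rw [e1, e2]
      have e3 : -inner ℂ φ w + inner ℂ φ (F (U s)) - (-inner ℂ Φ w + inner ℂ Φ (F (U s)))
          = inner ℂ (φ - Φ) (F (U s) - w) := by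
        rw [inner_sub_left, inner_sub_right, inner_sub_right]
        ring
      rw [e3]
      refine (norm_inner_le_norm _ _).trans ?_
      gcongr
      have e4 := norm_nonlinLp_le hn hε hε1 hK (U s)
      calc ‖F (U s) - w‖ ≤ ‖F (U s)‖ + ‖w‖ := norm_sub_le _ _
        _ ≤ lipConst n K / √ε * M + M := by
            refine add_le_add (e4.trans ?_) hwM
            gcongr
        _ = c := add_comm _ _
  have hcl : IsClosed {Φ : Ω.L2 | ‖X‖ ≤ ‖φ - Φ‖ * (‖U t - U 0‖ + c * |t - 0|)} :=
    isClosed_le continuous_const (by fun_prop)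
  have hφ : ‖X‖ ≤ ‖φ - φ‖ * (‖U t - U 0‖ + c * |t - 0|) :=
    closure_minimal key hcl (Ω.dense_testSubmodule.closure_eq ▸ mem_univ φ)
  rw [sub_self, norm_zero, zero_mul] at hφ
  exact sub_eq_zero.1 (norm_le_zero_iff.1 hφ)

end Evolution

/-! ### The nonlinear flow -/

section Splitting

variable {Ω : Domain} {n : ℕ} {ε K M T τ : ℝ}

theorem coeFn_flowB (n : ℕ) (ε t : ℝ) (w : Ω.L2) : flowB Ω n ε t w =ᵐ[Ω.measure] fun x =>
    w x * Complex.exp (Complex.I * ((-(t * fReg n ε (‖w x‖ ^ 2)) : ℝ) : ℂ)) :=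
  coeFn_phaseMul _ _ _

theorem norm_flowB_sub_le (hn : 2 ≤ n) (hε : 0 < ε) (hτ : 0 ≤ τ) (v w : Ω.L2) :
    ‖flowB Ω n ε τ v - flowB Ω n ε τ w‖ ≤ (1 + 4 * n * τ) * ‖v - w‖ := by
  refine Lp.norm_le_mul_norm_of_ae_le_mul ?_
  filter_upwards [coeFn_flowB n ε τ v, coeFn_flowB n ε τ w, Lp.coeFn_sub v w,
    Lp.coeFn_sub (flowB Ω n ε τ v) (flowB Ω n ε τ w)] with x h1 h2 h3 h4
  rw [h4, h3, Pi.sub_apply, Pi.sub_apply, h1, h2]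
  exact norm_phase_sub_le hn hε hτ _ _

/-- Pointwise second-order expansion of the phase. The remainder carries f², which is at most a
constant over ε. -/
theorem norm_flowB_sub_add_le (hn : 2 ≤ n) (hε : 0 < ε) (hε1 : ε ≤ 1) (hK : 1 ≤ K) {w : Ω.L2}
    (hw : ∀ᵐ x ∂Ω.measure, ‖w x‖ ≤ K) :
    ‖flowB Ω n ε τ w - w + (Complex.I * τ) • nonlinLp Ω hn hε hε1 hK w‖
      ≤ 2 * growthConst n K ^ 2 / ε * τ ^ 2 * ‖w‖ := by
  refine Lp.norm_le_mul_norm_of_ae_le_mul ?_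
  filter_upwards [coeFn_flowB n ε τ w, coeFn_nonlinLp hn hε hε1 hK w, hw,
    Lp.coeFn_add (flowB Ω n ε τ w - w) ((Complex.I * τ) • nonlinLp Ω hn hε hε1 hK w),
    Lp.coeFn_sub (flowB Ω n ε τ w) w,
    Lp.coeFn_smul (Complex.I * τ) (nonlinLp Ω hn hε hε1 hK w)] with x h1 h2 h3 h4 h5 h6
  rw [h4, Pi.add_apply, h5, Pi.sub_apply, h6, Pi.smul_apply, h1, h2, nonlin_of_norm_le h3]
  set f := fReg n ε (‖w x‖ ^ 2)
  have hf : |f| ≤ growthConst n K / √ε :=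
    abs_fReg_le hn hε hε1 hK (sq_nonneg _) (by gcongr)
  have hexp := norm_exp_I_mul_sub_one_add_le (τ * f)
  have hfac : w x * Complex.exp (Complex.I * ((-(τ * f) : ℝ) : ℂ)) - w x
        + (Complex.I * τ) • (w x * (f : ℂ))
      = (Complex.exp (Complex.I * ((-(τ * f) : ℝ) : ℂ)) - 1 + Complex.I * ((τ * f : ℝ) : ℂ))
        * w x := by
    rw [smul_eq_mul]
    push_cast
    ring
  rw [hfac, norm_mul]
  gcongr
  refine hexp.trans ?_
  have hsq : f ^ 2 ≤ growthConst n K ^ 2 / ε := by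
    have := pow_le_pow_left₀ (abs_nonneg f) hf 2
    rwa [sq_abs, div_pow, Real.sq_sqrt hε.le] at this
  calc 2 * (τ * f) ^ 2 = 2 * τ ^ 2 * f ^ 2 := by ring
    _ ≤ 2 * τ ^ 2 * (growthConst n K ^ 2 / ε) := by gcongr
    _ = 2 * growthConst n K ^ 2 / ε * τ ^ 2 := by ring

/-- The constant of the local error. -/
def Domain.localConst (Ω : Domain) (n : ℕ) (K M : ℝ) : ℝ :=
  Ω.nonlinConst n K M + 2 * lipConst n K * M + lipConst n K ^ 2 * M + 2 * growthConst n K ^ 2 * M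

theorem norm_step_sub_le (hn : 2 ≤ n) (hε : 0 < ε) (hε1 : ε ≤ 1) (hK : 1 ≤ K) {U : ℝ → Ω.L2}
    (hU : Ω.flow.IsWeakEvolution (nonlinLp Ω hn hε hε1 hK) T U)
    (htame : ∀ t ∈ Icc 0 T, IsTame Ω hn hε hε1 hK M (U t)) {t : ℝ} (ht : 0 ≤ t) (hτ : 0 ≤ τ)
    (htT : t + τ ≤ T) :
    ‖flowB Ω n ε τ (Ω.flow.S τ (U t)) - U (t + τ)‖ ≤ Ω.localConst n K M / ε * τ ^ 2 := by
  have htI : t ∈ Icc 0 T := ⟨ht, by linarith⟩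
  have hM : 0 ≤ M := (norm_nonneg _).trans (htame t htI).norm_le
  have hL := lipConst_nonneg n hK
  have hΛ : 0 ≤ lipConst n K / √ε := div_nonneg hL (Real.sqrt_nonneg _)
  have e1 := hU.norm_sub_map_add_nonlin_le (B := Ω.nonlinConst n K M / ε) (M := M) hΛ
    (norm_nonlinLp_sub_le hn hε hε1 hK)
    (fun t ht => (norm_nonlinLp_le hn hε hε1 hK (U t)).trans
      (by gcongr; exact (htame t ht).norm_le))
    (fun t ht r => (htame t ht).norm_map_sub_le r)
    (fun t ht r => (htame t ht).norm_map_nonlin_sub_le r) ht hτ htT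
  have e2 := norm_flowB_sub_add_le (τ := τ) hn hε hε1 hK ((htame t htI).ae_norm_map_le τ)
  rw [(Ω.flow.S τ).norm_map] at e2
  have hsq : ε ≤ √ε := by
    rw [Real.le_sqrt' hε]
    nlinarith
  have f1 : lipConst n K / √ε ≤ lipConst n K / ε := by gcongr
  -- Here the choice of 1/√ε for the logarithmic growth pays off: the squared Lipschitz constant is
  -- exactly of order 1/ε.
  have f2 : (lipConst n K / √ε) ^ 2 = lipConst n K ^ 2 / ε := by
    rw [div_pow, Real.sq_sqrt hε.le]
  set W := Ω.flow.S τ (U t)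
  -- The splitting step and the exact solution are expanded about the same point W, so their
  -- first-order terms cancel.
  calc ‖flowB Ω n ε τ W - U (t + τ)‖
      = ‖(flowB Ω n ε τ W - W + (Complex.I * τ) • nonlinLp Ω hn hε hε1 hK W)
          - (U (t + τ) - W + (Complex.I * τ) • nonlinLp Ω hn hε hε1 hK W)‖ := by
        congr 1
        abel
    _ ≤ 2 * growthConst n K ^ 2 / ε * τ ^ 2 * ‖U t‖
        + (Ω.nonlinConst n K M / ε + 2 * (lipConst n K / √ε) * M + (lipConst n K / √ε) ^ 2 * M)
          * τ ^ 2 := (norm_sub_le _ _).trans (add_le_add e2 e1)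
    _ ≤ 2 * growthConst n K ^ 2 / ε * τ ^ 2 * M
        + (Ω.nonlinConst n K M / ε + 2 * (lipConst n K / ε) * M + lipConst n K ^ 2 / ε * M)
          * τ ^ 2 := by
        rw [f2]
        gcongr
        exact (htame t htI).norm_le
    _ = Ω.localConst n K M / ε * τ ^ 2 := by
        unfold Domain.localConst
        ring

/-- Accumulation of the local errors. -/
theorem le_of_error_recursion {e : ℕ → ℝ} {a δ : ℝ} (ha : 0 ≤ a) (hδ : 0 ≤ δ) (h0 : e 0 = 0)
    {N : ℕ} (h : ∀ k < N, e (k + 1) ≤ (1 + a) * e k + δ) :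
    ∀ k ≤ N, e k ≤ Real.exp (k * a) * (k * δ) := by
  intro k
  induction k with
  | zero => simp [h0]
  | succ k ih =>
    intro hk
    have h1 := ih (by omega)
    have h2 : 1 + a ≤ Real.exp a := by linarith [Real.add_one_le_exp a]
    have h3 : 1 ≤ Real.exp (((k + 1 : ℕ) : ℝ) * a) := Real.one_le_exp (by positivity)
    have h4 : Real.exp a * Real.exp (k * a) = Real.exp (((k + 1 : ℕ) : ℝ) * a) := by
      rw [← Real.exp_add]
      congr 1
      push_cast
      ring
    calc e (k + 1) ≤ (1 + a) * e k + δ := h k (by omega)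
      _ ≤ (1 + a) * (Real.exp (k * a) * (k * δ)) + δ := by gcongr
      _ ≤ Real.exp a * (Real.exp (k * a) * (k * δ)) + δ := by gcongr
      _ = Real.exp (((k + 1 : ℕ) : ℝ) * a) * (k * δ) + δ := by rw [← mul_assoc, h4]
      _ ≤ Real.exp (((k + 1 : ℕ) : ℝ) * a) * (k * δ)
          + Real.exp (((k + 1 : ℕ) : ℝ) * a) * δ := by
          gcongr
          exact le_mul_of_one_le_left hδ h3
      _ = Real.exp (((k + 1 : ℕ) : ℝ) * a) * (((k + 1 : ℕ) : ℝ) * δ) := by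
          push_cast
          ring

/-- In each step the inherited error grows by at most 1 + 4nτ, and a local error of order τ²/ε is
added. Since kτ ≤ T, the growth stays below exp(4nT) and the local errors sum to order Tτ/ε. -/
theorem norm_lieTrotter_sub_le (hn : 2 ≤ n) (hε : 0 < ε) (hε1 : ε ≤ 1) (hK : 1 ≤ K) {U : ℝ → Ω.L2}
    (hU : Ω.flow.IsWeakEvolution (nonlinLp Ω hn hε hε1 hK) T U)
    (htame : ∀ t ∈ Icc 0 T, IsTame Ω hn hε hε1 hK M (U t)) (hτ : 0 < τ) {k : ℕ}
    (hk : k * τ ≤ T) :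
    ‖lieTrotter Ω n ε τ (U 0) k - U (k * τ)‖
      ≤ Real.exp (4 * n * T) * T * Ω.localConst n K M * (τ / ε) := by
  have hkτ : 0 ≤ k * τ := by positivity
  have hT : 0 ≤ T := hkτ.trans hk
  have hM : 0 ≤ M := (norm_nonneg _).trans (htame 0 ⟨le_rfl, hT⟩).norm_le
  have hL : 0 ≤ Ω.localConst n K M := by
    have h1 := nonlinConst_nonneg Ω n hK hM
    have h2 := lipConst_nonneg n hK
    unfold Domain.localConst
    positivity
  have hrec := le_of_error_recursion (e := fun j => ‖lieTrotter Ω n ε τ (U 0) j - U (j * τ)‖)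
    (a := 4 * n * τ) (δ := Ω.localConst n K M / ε * τ ^ 2) (N := k) (by positivity) (by positivity)
    (by simp [lieTrotter]) (fun j hj => ?_) k le_rfl
  · refine hrec.trans ?_
    have hexp : Real.exp (k * (4 * n * τ)) ≤ Real.exp (4 * n * T) := by
      refine Real.exp_le_exp.2 ?_
      calc (k : ℝ) * (4 * n * τ) = 4 * n * (k * τ) := by ring
        _ ≤ 4 * n * T := by gcongr
    calc Real.exp (k * (4 * n * τ)) * (k * (Ω.localConst n K M / ε * τ ^ 2))
        = Real.exp (k * (4 * n * τ)) * (k * τ) * Ω.localConst n K M * (τ / ε) := by ring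
      _ ≤ Real.exp (4 * n * T) * T * Ω.localConst n K M * (τ / ε) := by gcongr
  · have hjT : (j : ℝ) * τ + τ ≤ T := by
      have : ((j + 1 : ℕ) : ℝ) ≤ k := by exact_mod_cast hj
      push_cast at this
      nlinarith
    have hstep := norm_step_sub_le hn hε hε1 hK hU htame (t := j * τ) (by positivity) hτ.le hjT
    have hcast : ((j + 1 : ℕ) : ℝ) * τ = j * τ + τ := by push_cast; ring
    rw [hcast, lieTrotter, flowA_eq]
    set L := lieTrotter Ω n ε τ (U 0) j
    have hst := norm_flowB_sub_le hn hε hτ.le (Ω.flow.S τ L) (Ω.flow.S τ (U (j * τ)))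
    rw [← map_sub, (Ω.flow.S τ).norm_map] at hst
    calc ‖flowB Ω n ε τ (Ω.flow.S τ L) - U (j * τ + τ)‖
        ≤ ‖flowB Ω n ε τ (Ω.flow.S τ L) - flowB Ω n ε τ (Ω.flow.S τ (U (j * τ)))‖
          + ‖flowB Ω n ε τ (Ω.flow.S τ (U (j * τ))) - U (j * τ + τ)‖ :=
          norm_sub_le_norm_sub_add_norm_sub _ _ _
      _ ≤ _ := add_le_add hst hstep

end Splitting

end ERLog

/-! ### The convergence theorem -/

theorem theorem4p5 (Ω : ERLog.Domain) (n : ℕ) (hn : 2 ≤ n) (τ₀ : ℝ) (hτ₀ : 0 < τ₀) :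
    ∃ ε₀ : ℝ≥0 → ℝ, (∀ M, 0 < ε₀ M) ∧
      ∀ T : ℝ, 0 < T → ∃ C : ℝ≥0 → ℝ,
        ∀ (ε : ℝ) (u₀ : Ω.L2) (u : ℝ → Ω.L2) (M M₂ : ℝ≥0),
          0 < ε → ERLog.IsWeakSolution Ω n ε T u₀ u →
          Ω.LinftySobolevNorm 1 T u ≤ M → Ω.LinftySobolevNorm 2 T u ≤ M₂ →
          ε ≤ ε₀ M →
          ∀ (τ : ℝ) (k : ℕ), 0 < τ → τ ≤ τ₀ → k * τ ≤ T →
            ‖ERLog.lieTrotter Ω n ε τ u₀ k - u (k * τ)‖ ≤ C M₂ * (τ / ε) := by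
  -- The growth bounds of f only need ε ≤ 1; the truncation level depends on the H² bound and enters
  -- the constant, not the threshold.
  refine ⟨fun _ => 1, fun _ => one_pos, fun T hT => ?_⟩
  -- The function and its second derivative are each bounded by m + 1, hence the factor 2 in front
  -- of the Sobolev constant; the leading 1 guarantees 1 ≤ K.
  let K : ℝ≥0 → ℝ := fun m => 1 + Ω.sobolevConst * (2 * ((m : ℝ) + 1))
  refine ⟨fun m => Real.exp (4 * n * T) * T * Ω.localConst n (K m) (m + 1), ?_⟩
  intro ε u₀ u M M₂ hε hu _ hM₂ hε1 τ k hτ _ hk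
  have hc := Ω.sobolevConst_nonneg
  have hK : 1 ≤ K M₂ := le_add_of_nonneg_right (by positivity)
  have hMK : Ω.sobolevConst * (2 * ((M₂ : ℝ) + 1)) ≤ K M₂ := le_add_of_nonneg_left zero_le_one
  have hdata := ERLog.ae_isRegularData hu hM₂
  have htame : ∀ t ∈ Icc 0 T, ERLog.IsTame Ω hn hε hε1 hK (M₂ + 1) (u t) :=
    ERLog.forall_mem_of_ae_mem hT hu.continuousOn (ERLog.isClosed_isTame hn hε hε1 hK)
      (ERLog.isTame_zero hn hε hε1 hK (by positivity))
      (hdata.mono fun t ht => ht.isTame hn hε hε1 hK hMK)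
  have hev := hu.isWeakEvolution hn hε hε1 hK hT hdata htame
  set U := IccExtend hT.le ((Icc 0 T).domRestrict u) with hU
  have hUu : ∀ s ∈ Icc 0 T, U s = u s := fun s hs => by
    rw [hU, IccExtend_of_mem _ _ hs, domRestrict_apply]
  have hmain := ERLog.norm_lieTrotter_sub_le hn hε hε1 hK hev
    (fun t ht => by rw [hUu t ht]; exact htame t ht) hτ hk
  rwa [hUu 0 ⟨le_rfl, hT.le⟩, hUu (k * τ) ⟨by positivity, hk⟩, hu.initial] at hmain

end
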